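/- **Setting.** Let $d\ge 1$ and let $p\ge 1$ be a real number. For finite sets $X,C\subset\mathbb R^d$ with $C\neq\emptyset$ put $\mathrm{cost}_p(X,C)=\sum_{x\in X}\min_{c\in C}\|x-c\|_p$, and let $\mathrm{OPT}_{k,p}(X)$ be the infimum of $\mathrm{cost}_p(X,\{c_1,\dots,c_k\})$ over $c_1,\dots,c_k\in\mathbb R^d$. A threshold tree $\mathcal T$ is a binary tree whose inner nodes carry a cut $(i,\vartheta)$ and send $x$ to the left child if $x_i<\vartheta$ and to the right child if $x_i\ge\vartheta$, and whose leaves are labelled by centers; $\mathcal T(x)$ is the label of the leaf that contains $x$, and $\mathrm{cost}_p(X,\mathcal T)=\sum_{x\in X}\|x-\mathcal T(x)\|_p$. **Algorithm.** The input is a set $C$ of $k\ge1$ centers. The algorithm starts with a root that contains all of $C$. If a node $u$ has a set $C_u$ of at least two centers, the procedure Partition_Leaf$(u)$ fixes an anchor $m^u$, which an anchor oracle returns as a function of $C_u$, sets the main part to be $u$, with center set $C_{u_0}=C_u$, and iterates. In each iteration it puts $R=\max_{c\in C_{u_0}}\|c-m^u\|_p$ and samples, with fresh independent randomness, a uniform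 $i\in\{1,\dots,d\}$, a uniform sign $\sigma\in\{-1,1\}$ and $\theta\ge 0$ with $\theta^p$ uniform in $[0,R^p]$; let $\vartheta=m^u_i+\sigma\theta$. If the cut $(i,\vartheta)$ separates two centers of $C_{u_0}$, the main part is split into the cells $\{c_i<\vartheta\}$ and $\{c_i\ge\vartheta\}$, and the new main part is the left cell if $\sigma=1$ and the right cell if $\sigma=-1$; otherwise the cut is discarded. After each iteration a stopping oracle, a measurable function of $C_u$ and of the cuts sampled so far in this call, decides whether to stop. When it stops, Partition_Leaf is called, with new independent randomness, on every leaf of the subtree of $u$ that contains more than one center. A node with a single center is a leaf labelled by it. **Oracles.** Let $\frac14\le a\le\frac12$ and $\gamma<1$. For every $C_u\subseteq C$ with $|C_u|\ge2$ it is required that: * for every coordinate $i$, both $|\{c\in C_u:c_i\ge m^u_i\}|$ and $|\{c\in C_u:c_i\le m^u_i\}|$ are at least $a|C_u|$; * the stopping oracle returns True only if $|C_{u_0}|\le\gamma|C_u|$, and it does return True whenever $|C_{u_0}|\le(1-a)|C_u|$. (With $a=\gamma=\frac12$ this is the standard choice: the anchor is a coordinatewise median, and the call stops as soon as the main part contains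 at most half of the centers of $C_u$.) **Theorem.** For every $\gamma<1$ there is a constant $K>0$, depending only on $\gamma$, such that the following holds for all $d\ge1$, all real $p\ge1$, all sets $C\subset\mathbb R^d$ of $k\ge 1$ centers, all $a\in[\frac14,\frac12]$ and all such oracles. 1. Almost surely the algorithm terminates and outputs a threshold tree $\mathcal T$ with exactly $k$ leaves, labelled by the $k$ distinct centers of $C$, and every center lies in the leaf that it labels. 2. For every finite $X\subset\mathbb R^d$ the cost $\mathrm{cost}_p(X,\mathcal T)$ is integrable, and if $k\ge3$, then $$\mathbb E[\mathrm{cost}_p(X,\mathcal T)]\le K\cdot p\,(\log k)^{1+\frac1p-\frac1{p^2}}\,\log\log k\cdot \mathrm{cost}_p(X,C).$$ In particular, if $k\ge 3$ and $C$ is optimal, i.e. $\mathrm{cost}_p(X,C)=\mathrm{OPT}_{k,p}(X)$, then $\mathbb E[\mathrm{cost}_p(X,\mathcal T)]\le K\cdot p\,(\log k)^{1+\frac1p-\frac1{p^2}}\,\log\log k\cdot\mathrm{OPT}_{k,p}(X)$. -/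

import Mathlib

open MeasureTheory

namespace Explainable

/-- Points of `ℝ^d`, given by their coordinates. -/
abbrev Point (d : ℕ) : Type := Fin d → ℝ

/-- The `ℓ_p` distance `‖x - y‖_p`. -/
noncomputable def lpDist {d : ℕ} (p : ℝ) (x y : Point d) : ℝ :=
  (∑ i, |x i - y i| ^ p) ^ (1 / p)

/-- The unconstrained `ℓ_p` `k`-medians cost `cost_p(X, C)` of a finite data set `X` with the
nonempty set of centers `C`: each point pays its distance to a closest center. -/
noncomputable def cost {d : ℕ} (p : ℝ) (X C : Finset (Point d)) : ℝ :=
  ∑ x ∈ X, ⨅ c : {c // c ∈ C}, lpDist p x c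

open Classical in
/-- The optimal unconstrained cost `OPT_{k,p}(X)`: the infimum of `cost_p(X; c_1, …, c_k)`. -/
noncomputable def optCost {d : ℕ} (p : ℝ) (k : ℕ) (X : Finset (Point d)) : ℝ :=
  ⨅ c : Fin k → Point d, cost p X (Finset.univ.image c)

/-- Binary threshold trees with leaves labelled by `α`. An inner node `node i ϑ l r` sends `x` to
`l` if `x i < ϑ`, and to `r` if `x i ≥ ϑ`. -/
inductive Tree (d : ℕ) (α : Type) : Type
  | leaf (label : α) : Tree d α
  | node (i : Fin d) (ϑ : ℝ) (l r : Tree d α) : Tree d α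

namespace Tree

variable {d : ℕ} {α β : Type}

/-- The label of the leaf that contains the point `x`. -/
noncomputable def eval (x : Point d) : Tree d α → α
  | leaf a => a
  | node i ϑ l r => if x i < ϑ then eval x l else eval x r

/-- The labels of the leaves, from left to right. -/
def leaves : Tree d α → List α
  | leaf a => [a]
  | node _ _ l r => leaves l ++ leaves r

/-- Replace every leaf by the tree that `f` returns for its address and its label. `addr` is the
address of the root; the left and right child of the node at address `b` have the addresses
`false :: b` and `true :: b`. The result is `none` if `f` returns `none` at some leaf. -/
def expand (f : List Bool → α → Option (Tree d β)) : List Bool → Tree d α → Option (Tree d β)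
  | addr, leaf a => f addr a
  | addr, node i ϑ l r =>
    (expand f (false :: addr) l).bind fun l' =>
      (expand f (true :: addr) r).map fun r' => node i ϑ l' r'

end Tree

/-- The cost `cost_p(X, T) = ∑_{x ∈ X} ‖x - T(x)‖_p` of the clustering given by a threshold tree
whose leaves are labelled by centers. -/
noncomputable def treeCost {d : ℕ} (p : ℝ) (X : Finset (Point d)) (T : Tree d (Point d)) : ℝ :=
  ∑ x ∈ X, lpDist p x (T.eval x)

/-! ### Randomness -/

/-- The random bits of one iteration: a coordinate, a sign (`true` is `+1`, `false` is `-1`) and a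
number in `[0,1]`. -/
abbrev Seed (d : ℕ) : Type := Fin d × Bool × unitInterval

/-- The coordinate, the sign and the number in `[0,1]` are uniform and independent. -/
noncomputable def seedLaw (d : ℕ) [NeZero d] : Measure (Seed d) :=
  (PMF.uniformOfFintype (Fin d)).toMeasure.prod
    ((PMF.uniformOfFintype Bool).toMeasure.prod volume)

instance (d : ℕ) [NeZero d] : IsProbabilityMeasure (seedLaw d) := by
  unfold seedLaw; infer_instance

/-- All random bits of a run: `ω (addr, t)` is used in iteration `t` (counted from `0`) of the call
on the node with address `addr`. -/
abbrev Seeds (d : ℕ) : Type := List Bool × ℕ → Seed d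

/-- All seeds are independent with law `seedLaw d`. -/
noncomputable def seedsLaw (d : ℕ) [NeZero d] : Measure (Seeds d) :=
  Measure.infinitePi fun _ => seedLaw d

/-! ### One call of the procedure -/

/-- A sampled cut `(i, σ, ϑ)`: the coordinate, the sign and the threshold. -/
abbrev Cut (d : ℕ) : Type := Fin d × Bool × ℝ

section Call

variable {d : ℕ}

/-- The centers of `M` on the left of the cut. -/
noncomputable def Cut.left (w : Cut d) (M : Finset (Point d)) : Finset (Point d) :=
  M.filter fun c => c w.1 < w.2.2

/-- The centers of `M` on the right of the cut. -/
noncomputable def Cut.right (w : Cut d) (M : Finset (Point d)) : Finset (Point d) :=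
  M.filter fun c => w.2.2 ≤ c w.1

/-- The cut separates two centers of `M`. -/
def Cut.Separates (w : Cut d) (M : Finset (Point d)) : Prop :=
  (w.left M).Nonempty ∧ (w.right M).Nonempty

/-- The radius `max_{c ∈ M} ‖c - m‖_p` of the main part `M` around the anchor `m`. -/
noncomputable def radius (p : ℝ) (m : Point d) (M : Finset (Point d)) : ℝ :=
  ⨆ c : {c // c ∈ M}, lpDist p c m

/-- The cut sampled when the main part is `M`: with `R` the radius, `θ ^ p = u * R ^ p` is uniform
in `[0, R ^ p]` and `ϑ = m_i + σ θ`. -/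
noncomputable def sampleCut (p : ℝ) (m : Point d) (M : Finset (Point d)) (s : Seed d) : Cut d :=
  let θ : ℝ := ((s.2.2 : ℝ) * radius p m M ^ p) ^ (1 / p)
  (s.1, s.2.1, if s.2.1 then m s.1 + θ else m s.1 - θ)

open Classical in
/-- The new main part after the cut `w`: a cut that separates no two centers of `M` is discarded;
otherwise the side that contains the anchor is kept. -/
noncomputable def cutMain (w : Cut d) (M : Finset (Point d)) : Finset (Point d) :=
  if w.Separates M then (if w.2.1 then w.left M else w.right M) else M

/-- The main part after `t` iterations of a call on the set `Cu` with anchor `m`. -/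
noncomputable def mainPart (p : ℝ) (m : Point d) (Cu : Finset (Point d)) (s : ℕ → Seed d) :
    ℕ → Finset (Point d)
  | 0 => Cu
  | t + 1 => cutMain (sampleCut p m (mainPart p m Cu s t) (s t)) (mainPart p m Cu s t)

/-- The cut sampled in iteration `t` (counted from `0`). -/
noncomputable def cutAt (p : ℝ) (m : Point d) (Cu : Finset (Point d)) (s : ℕ → Seed d) (t : ℕ) :
    Cut d :=
  sampleCut p m (mainPart p m Cu s t) (s t)

open Classical in
/-- Continue the subtree at the main part `M` for `n` further iterations, beginning with
iteration `t`. Leaves are labelled by the set of centers they contain. -/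
noncomputable def grow (p : ℝ) (m : Point d) (s : ℕ → Seed d) :
    (n t : ℕ) → Finset (Point d) → Tree d (Finset (Point d))
  | 0, _, M => .leaf M
  | n + 1, t, M =>
    let w := sampleCut p m M (s t)
    if w.Separates M then
      if w.2.1 then .node w.1 w.2.2 (grow p m s n (t + 1) (w.left M)) (.leaf (w.right M))
      else .node w.1 w.2.2 (.leaf (w.left M)) (grow p m s n (t + 1) (w.right M))
    else grow p m s n (t + 1) M

/-- An anchor oracle assigns an anchor to each set of centers. -/
abbrev AnchorOracle (d : ℕ) : Type := Finset (Point d) → Point d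

/-- A stopping oracle, queried after iteration `t ≥ 1` of a call on the set `Cu` with the cuts
sampled in this call so far (which determine the current subtree), tells whether to stop. -/
abbrev StoppingOracle (d : ℕ) : Type :=
  Finset (Point d) → (t : ℕ) → (Fin t → Cut d) → Prop

/-- The iteration counts at which the stopping oracle returns `True` in a call on `Cu`. -/
def stopTimes (p : ℝ) (anchor : AnchorOracle d) (halt : StoppingOracle d)
    (Cu : Finset (Point d)) (s : ℕ → Seed d) : Set ℕ :=
  {t | 1 ≤ t ∧ halt Cu t fun j => cutAt p (anchor Cu) Cu s j}

open Classical in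
/-- The recursive procedure on the node with address `addr` and set of centers `Cu`: a single
center gives a leaf; otherwise sample cuts until the stopping oracle returns `True` for the first
time and recurse on all leaves of the resulting subtree. The first argument bounds the depth of the
recursion. The value `none` means that some loop never stops or that the bound is exceeded. -/
noncomputable def partitionLeaf (p : ℝ) (anchor : AnchorOracle d) (halt : StoppingOracle d)
    (ω : Seeds d) : ℕ → List Bool → Finset (Point d) → Option (Tree d (Point d))
  | 0, _, _ => none
  | n + 1, addr, Cu =>
    if h : Cu.card = 1 then some (.leaf (Finset.card_eq_one.mp h).choose)
    else
      let s : ℕ → Seed d := fun t => ω (addr, t)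
      let times := stopTimes p anchor halt Cu s
      if times.Nonempty then
        Tree.expand (partitionLeaf p anchor halt ω n) addr (grow p (anchor Cu) s (sInf times) 0 Cu)
      else none

/-- The output of the algorithm on the set of centers `C`. A call on at least two centers recurses
only on sets with fewer centers, so that `|C|` levels of recursion suffice. -/
noncomputable def algorithm (p : ℝ) (anchor : AnchorOracle d) (halt : StoppingOracle d)
    (C : Finset (Point d)) (ω : Seeds d) : Option (Tree d (Point d)) :=
  partitionLeaf p anchor halt ω C.card [] C

/-- The cost on the data set `X` of the tree that the algorithm outputs (and `0` if there is
none). -/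
noncomputable def outputCost (p : ℝ) (anchor : AnchorOracle d) (halt : StoppingOracle d)
    (X C : Finset (Point d)) (ω : Seeds d) : ℝ :=
  (algorithm p anchor halt C ω).elim 0 (treeCost p X)

/-! ### Admissible oracles -/

/-- In each coordinate, at least an `a` fraction of the centers lies on either (closed) side of the
anchor, for every set of at least two of the given centers. For `a = 1 / 2` the anchor is a
coordinatewise median. -/
def IsAnchorOracle (a : ℝ) (C : Finset (Point d)) (anchor : AnchorOracle d) : Prop :=
  ∀ Cu ⊆ C, 2 ≤ Cu.card → ∀ i : Fin d,
    a * Cu.card ≤ (Cu.filter fun c => anchor Cu i ≤ c i).card ∧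
    a * Cu.card ≤ (Cu.filter fun c => c i ≤ anchor Cu i).card

/-- The stopping oracle is a measurable function of the sampled cuts. In a call on `Cu` it may
return `True` only when the main part contains at most a `γ` fraction of the centers of `Cu`, and it
has to return `True` when the main part contains at most a `1 - a` fraction of them. -/
def IsStoppingOracle (p a γ : ℝ) (C : Finset (Point d)) (anchor : AnchorOracle d)
    (halt : StoppingOracle d) : Prop :=
  ∀ Cu ⊆ C, 2 ≤ Cu.card → ∀ t : ℕ, 1 ≤ t →
    MeasurableSet {h : Fin t → Cut d | halt Cu t h} ∧
    ∀ s : ℕ → Seed d,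
      (halt Cu t (fun j => cutAt p (anchor Cu) Cu s j) →
        ((mainPart p (anchor Cu) Cu s t).card : ℝ) ≤ γ * Cu.card) ∧
      (((mainPart p (anchor Cu) Cu s t).card : ℝ) ≤ (1 - a) * Cu.card →
        halt Cu t fun j => cutAt p (anchor Cu) Cu s j)

end Call

end Explainable

namespace Explainable

open scoped ENNReal

/-! ### Elementary inequalities -/

/-! Follow a single data point `x` along the run. At any time it lies in a cell `M` of a call on a
set `Cu` with anchor `m`. For a center `c` of `M` let D be the distance from `x` to `c`, δ the
radius of `M` around `c`, and R its radius around `m`. Each position gets a number `value` that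
dominates the cost of `x` once a single center is left, is at most 2^q D for every center at the
root (`valueAt_le`), and does not increase in expectation (`lintegral_value_nextPair_le`). Hence the
expected cost of `x` is at most 2^q times its distance to the nearest center.

The bound is bootstrapped. When a cut splits `x` from `c`, let T be the centers on the side of `x`.
The new value is at most 2δ, and by the bound for the center of T nearest to `x` it is at most 2^q
H, where H is the distance from `x` to T, but at least D. The minimum of the two is 2δ times
`sideWeight`, and this penalty must be paid by the expected decrease of a potential with two parts.

One part is p D log|Cu|. A cut removes `c` from the main part with probability at least (‖c - m‖_p /
R)^p / (2d), and the call then shrinks to at most three quarters of its size. The other part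
averages over the thresholds ϑ between x_i and c_i at which a split could happen, and measures for
each scale j the logarithm of the size of a crowd: the centers farther than about 2^j H from `c`. At
the scale with 2^j H ≈ δ the crowd is nonempty, and if R ≤ 2δ each member is split from `c` with
probability at least 8^(-p) / (2d), so this logarithm drops (`lintegral_crowdPotential_add_le`). If
R > 2δ, then `c` is far from the anchor and the first part pays for everything.

The threshold density near c_i is of order p |c_i - m_i|^(p-1) / R^p, up to a shift by |x_i - c_i|.
A Young-type inequality (`split_penalty_le`) separates density times penalty into a term in |c_i -
m_i|^p, paid by the first part, and a term proportional to `sideWeight`, paid by the crowds. The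
weights of the scales sum to at most q + 2, so the requirement on q is that a multiple of p log k +
(q + 2) log(1 + k) is at most 2^q (`ScaleBound`). This holds with 2^q of order p log k log log k.
Since 1 + 1/p - 1/p² ≥ 1, that is at most the stated rate.

The seeds are indexed by address and time, and the position of `x` depends only on seeds used
earlier (`chain_congr`). The next seed can therefore be integrated out on its own
(`lintegral_infinitePi_fresh`), and Fatou's lemma passes from the positions to the output. -/

theorem rpow_sub_le_sub_rpow {p u v : ℝ} (hp : 1 ≤ p) (hv : 0 ≤ v) (hvu : v ≤ u) :
    (u - v) ^ p ≤ u ^ p - v ^ p := by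
  have h := NNReal.add_rpow_le_rpow_add ⟨u - v, sub_nonneg.2 hvu⟩ ⟨v, hv⟩ hp
  have h' : (u - v) ^ p + v ^ p ≤ (u - v + v) ^ p := by exact_mod_cast h
  rw [sub_add_cancel] at h'
  linarith

/-! ### The `ℓ_p` distance -/

section Dist

variable {d : ℕ} {p : ℝ}

theorem sum_rpow_nonneg (x y : Point d) : 0 ≤ ∑ i, |x i - y i| ^ p :=
  Finset.sum_nonneg fun _ _ => Real.rpow_nonneg (abs_nonneg _) _

theorem lpDist_nonneg (x y : Point d) : 0 ≤ lpDist p x y :=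
  Real.rpow_nonneg (sum_rpow_nonneg x y) _

theorem lpDist_comm (x y : Point d) : lpDist p x y = lpDist p y x := by
  simp only [lpDist, abs_sub_comm]

theorem lpDist_rpow (hp : 1 ≤ p) (x y : Point d) :
    lpDist p x y ^ p = ∑ i, |x i - y i| ^ p := by
  rw [lpDist, ← Real.rpow_mul (sum_rpow_nonneg x y), one_div, inv_mul_cancel₀ (by linarith),
    Real.rpow_one]

theorem lpDist_triangle (hp : 1 ≤ p) (x y z : Point d) :
    lpDist p x z ≤ lpDist p x y + lpDist p y z := by
  have h := Real.Lp_add_le Finset.univ (fun i => x i - y i) (fun i => y i - z i) hp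
  simp only [sub_add_sub_cancel] at h
  exact h

theorem abs_sub_le_lpDist (hp : 1 ≤ p) (x y : Point d) (i : Fin d) :
    |x i - y i| ≤ lpDist p x y := by
  have hp0 : (0 : ℝ) < p := by linarith
  rw [← Real.rpow_le_rpow_iff (abs_nonneg _) (lpDist_nonneg x y) hp0, lpDist_rpow hp]
  exact Finset.single_le_sum (f := fun i => |x i - y i| ^ p)
    (fun _ _ => Real.rpow_nonneg (abs_nonneg _) _) (Finset.mem_univ i)

theorem lpDist_self (hp : 1 ≤ p) (x : Point d) : lpDist p x x = 0 := by
  have hp0 : p ≠ 0 := by linarith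
  simp [lpDist, Real.zero_rpow hp0, hp0]

theorem eq_of_lpDist_eq_zero (hp : 1 ≤ p) {x y : Point d} (h : lpDist p x y = 0) : x = y := by
  ext i
  have := abs_sub_le_lpDist hp x y i
  rw [h] at this
  exact sub_eq_zero.1 (abs_nonpos_iff.1 this)

/-! ### The radius -/

theorem lpDist_le_radius {m c : Point d} {M : Finset (Point d)} (hc : c ∈ M) :
    lpDist p c m ≤ radius p m M := by
  have h : BddAbove (Set.range fun c : {c // c ∈ M} => lpDist p c.1 m) :=
    (Set.finite_range _).bddAbove
  exact le_ciSup h (⟨c, hc⟩ : {c // c ∈ M})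

theorem exists_lpDist_eq_radius (m : Point d) {M : Finset (Point d)} (hM : M.Nonempty) :
    ∃ c ∈ M, lpDist p c m = radius p m M := by
  have : Nonempty {c // c ∈ M} := hM.to_subtype
  obtain ⟨c, hc⟩ := exists_eq_ciSup_of_finite (f := fun c : {c // c ∈ M} => lpDist p c m)
  exact ⟨c, c.2, hc⟩

theorem radius_nonneg (m : Point d) (M : Finset (Point d)) : 0 ≤ radius p m M :=
  Real.iSup_nonneg fun _ => lpDist_nonneg _ _

theorem radius_pos (hp : 1 ≤ p) (m : Point d) {M : Finset (Point d)} (hM : 2 ≤ M.card) :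
    0 < radius p m M := by
  obtain ⟨a, ha, b, hb, hab⟩ := Finset.one_lt_card.1 hM
  rcases (radius_nonneg (p := p) m M).lt_or_eq with h | h
  · exact h
  · exfalso
    have ha' := lpDist_le_radius (p := p) (m := m) ha
    have hb' := lpDist_le_radius (p := p) (m := m) hb
    rw [← h] at ha' hb'
    exact hab ((eq_of_lpDist_eq_zero hp (le_antisymm ha' (lpDist_nonneg _ _))).trans
      (eq_of_lpDist_eq_zero hp (le_antisymm hb' (lpDist_nonneg _ _))).symm)

end Dist

/-! ### Integrals over the seeds -/

section Seed

variable {d : ℕ}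

theorem measurable_seed {α : Type*} [MeasurableSpace α] {F : Seed d → α}
    (hF : ∀ i σ, Measurable fun u => F (i, σ, u)) : Measurable F := by
  refine measurable_from_prod_countable_right fun i => ?_
  exact measurable_from_prod_countable_right fun σ => hF i σ

theorem lintegral_seedLaw [NeZero d] {F : Seed d → ℝ≥0∞} (hF : Measurable F) :
    ∫⁻ s, F s ∂seedLaw d =
      ENNReal.ofReal (1 / (2 * d)) * ∑ i, ∑ σ, ∫⁻ u, F (i, σ, u) := by
  have hd : (d : ℝ) ≠ 0 := Nat.cast_ne_zero.2 (NeZero.ne d)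
  have hd' : (0 : ℝ) < d := lt_of_le_of_ne (Nat.cast_nonneg d) hd.symm
  have key : ENNReal.ofReal (1 / (2 * d)) = (d : ℝ≥0∞)⁻¹ * 2⁻¹ := by
    rw [one_div, ENNReal.ofReal_inv_of_pos (by positivity), ENNReal.ofReal_mul (by norm_num),
      ENNReal.mul_inv (by simp) (by simp), mul_comm]
    simp
  unfold seedLaw
  rw [lintegral_prod _ hF.aemeasurable, lintegral_fintype]
  simp only [PMF.toMeasure_apply_singleton _ _ (MeasurableSet.singleton _),
    PMF.uniformOfFintype_apply, Fintype.card_fin]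
  rw [key, mul_assoc, Finset.mul_sum, Finset.mul_sum]
  refine Finset.sum_congr rfl fun i _ => ?_
  have hFi : Measurable fun y => F (i, y) := hF.comp measurable_prodMk_left
  rw [lintegral_prod _ hFi.aemeasurable, lintegral_fintype]
  simp only [PMF.toMeasure_apply_singleton _ _ (MeasurableSet.singleton _),
    PMF.uniformOfFintype_apply, Fintype.card_bool]
  rw [← Finset.sum_mul, mul_comm, mul_comm (∑ σ, _) _]
  simp

theorem lintegral_unitInterval (g : ℝ → ℝ≥0∞) :
    ∫⁻ u : unitInterval, g u = ∫⁻ u in Set.Icc (0 : ℝ) 1, g u :=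
  lintegral_subtype_comap measurableSet_Icc g

/-- The distance `θ` of the threshold from the anchor when the radius is `R`. -/
noncomputable def offset (p R u : ℝ) : ℝ := (u * R ^ p) ^ (1 / p)

theorem measurable_offset (p R : ℝ) : Measurable (offset p R) := by
  unfold offset; fun_prop

theorem offset_nonneg {p R u : ℝ} (hR : 0 ≤ R) (hu : 0 ≤ u) : 0 ≤ offset p R u :=
  Real.rpow_nonneg (mul_nonneg hu (Real.rpow_nonneg hR _)) _

theorem offset_div_rpow {p R t : ℝ} (hp : 1 ≤ p) (hR : 0 < R) (ht : 0 ≤ t) :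
    offset p R ((t / R) ^ p) = t := by
  have hp0 : p ≠ 0 := by linarith
  rw [offset, Real.div_rpow ht hR.le, div_mul_cancel₀ _ (Real.rpow_pos_of_pos hR p).ne',
    ← Real.rpow_mul ht, mul_one_div_cancel hp0, Real.rpow_one]

theorem div_rpow_offset {p R u : ℝ} (hp : 1 ≤ p) (hR : 0 < R) (hu : 0 ≤ u) :
    (offset p R u / R) ^ p = u := by
  have hp0 : p ≠ 0 := by linarith
  have := Real.rpow_pos_of_pos hR p
  rw [Real.div_rpow (offset_nonneg hR.le hu) hR.le, offset, ← Real.rpow_mul (by positivity),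
    one_div_mul_cancel hp0, Real.rpow_one, mul_div_cancel_right₀ _ this.ne']

theorem offset_lt_offset {p R u v : ℝ} (hp : 1 ≤ p) (hR : 0 < R) (hu : 0 ≤ u) (huv : u < v) :
    offset p R u < offset p R v := by
  have := Real.rpow_pos_of_pos hR p
  exact Real.rpow_lt_rpow (by positivity) (by gcongr) (by positivity)

/-- The offset lies strictly between `v` and `t` with probability at least `(t^p - v^p) / R^p`. -/
theorem le_volume_offset_mem_Ioo {p R v t : ℝ} (hp : 1 ≤ p) (hR : 0 < R) (hv : 0 ≤ v)
    (hvt : v ≤ t) (htR : t ≤ R) :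
    ENNReal.ofReal ((t ^ p - v ^ p) / R ^ p) ≤
      volume {u : unitInterval | v < offset p R u ∧ offset p R u < t} := by
  have hp0 : (0 : ℝ) ≤ p := by linarith
  have ht : 0 ≤ t := hv.trans hvt
  have h1 : (t / R) ^ p ≤ 1 := Real.rpow_le_one (by positivity) (by rwa [div_le_one hR]) hp0
  have h0 : 0 ≤ (v / R) ^ p := by positivity
  have hsub : (Subtype.val ⁻¹' Set.Ioo ((v / R) ^ p) ((t / R) ^ p) : Set unitInterval) ⊆
      {u : unitInterval | v < offset p R u ∧ offset p R u < t} := by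
    rintro u ⟨hu1, hu2⟩
    constructor
    · have := offset_lt_offset hp hR h0 hu1
      rwa [offset_div_rpow hp hR hv] at this
    · have := offset_lt_offset hp hR u.2.1 hu2
      rwa [offset_div_rpow hp hR ht] at this
  refine le_trans (le_of_eq ?_) (measure_mono hsub)
  have : volume (Subtype.val ⁻¹' Set.Ioo ((v / R) ^ p) ((t / R) ^ p) : Set unitInterval) =
      volume (Set.Ioo ((v / R) ^ p) ((t / R) ^ p)) := by
    rw [show (volume : Measure unitInterval) = volume.comap Subtype.val from rfl,
      comap_subtype_coe_apply measurableSet_Icc, Subtype.image_preimage_coe,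
      Set.inter_eq_right.2]
    exact fun u hu => ⟨h0.trans hu.1.le, hu.2.le.trans h1⟩
  rw [this, Real.volume_Ioo, Real.div_rpow ht hR.le, Real.div_rpow hv hR.le, sub_div]

/-- The signed threshold `m ± θ`. -/
noncomputable def thr (p R m : ℝ) (σ : Bool) (u : ℝ) : ℝ :=
  if σ then m + offset p R u else m - offset p R u

theorem measurable_thr (p R m : ℝ) (σ : Bool) : Measurable (thr p R m σ) := by
  have := measurable_offset p R
  unfold thr; split_ifs <;> fun_prop

theorem sampleCut_eq (p : ℝ) (m : Point d) (M : Finset (Point d)) (i : Fin d) (σ : Bool)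
    (u : unitInterval) :
    sampleCut p m M (i, σ, u) = (i, σ, thr p (radius p m M) (m i) σ u) := rfl

/-- The function is the inverse of the map from u to the threshold on the side of the anchor chosen
by the sign ε. It serves the change of variables in `lintegral_thr_le`. -/
theorem injOn_offset_inv {p R m : ℝ} (hp : 1 ≤ p) (hR : 0 < R) {ε : ℝ} (hε : ε ≠ 0) :
    Set.InjOn (fun x => (ε * (x - m) / R) ^ p) {x | 0 < ε * (x - m)} := by
  have hp0 : (0 : ℝ) < p := by linarith
  intro x hx y hy h
  have hx' : 0 ≤ ε * (x - m) / R := div_nonneg (le_of_lt hx) hR.le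
  have hy' : 0 ≤ ε * (y - m) / R := div_nonneg (le_of_lt hy) hR.le
  have := (Real.rpow_left_injOn hp0.ne') hx' hy' h
  have := (div_left_inj' hR.ne').1 this
  have := mul_left_cancel₀ hε this
  linarith

/-- The law of the threshold, restricted to points at distance at most `Y` from the anchor, has a
density of at most `p Y^(p-1) / R^p`. -/
theorem lintegral_thr_le {p R m Y : ℝ} (hp : 1 ≤ p) (hR : 0 < R) (σ : Bool) {I : Set ℝ}
    (hI : MeasurableSet I) (hY : ∀ x ∈ I, |x - m| ≤ Y) (φ : ℝ → ℝ≥0∞) :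
    ∫⁻ u : unitInterval, I.indicator φ (thr p R m σ u) ≤
      ENNReal.ofReal (p * Y ^ (p - 1) / R ^ p) * ∫⁻ x in I, φ x := by
  have hp0 : (0 : ℝ) < p := by linarith
  -- The endpoint u = 0, where the threshold equals the anchor, is null. Without it the offset is
  -- positive and the threshold determines u.
  rw [lintegral_unitInterval (fun u => I.indicator φ (thr p R m σ u)),
    ← restrict_Ioc_eq_restrict_Icc]
  set ε : ℝ := if σ then 1 else -1 with hε
  have hε2 : ε * ε = 1 := by rw [hε]; split_ifs <;> norm_num
  have hε0 : ε ≠ 0 := by rintro h; simp [h] at hε2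
  have habs : |ε| = 1 := by rw [hε]; split_ifs <;> simp
  have hthr : ∀ u, thr p R m σ u = m + ε * offset p R u := by
    intro u; simp only [thr, hε]; split_ifs <;> ring
  set s : Set ℝ := I ∩ {x | 0 < ε * (x - m)} with hs
  have hsm : MeasurableSet s :=
    hI.inter (measurableSet_lt measurable_const (by fun_prop))
  set f : ℝ → ℝ := fun x => (ε * (x - m) / R) ^ p with hf
  set f' : ℝ → ℝ := fun x => ε / R * p * (ε * (x - m) / R) ^ (p - 1) with hf'
  have hder : ∀ x ∈ s, HasDerivWithinAt f (f' x) s x := by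
    intro x hx
    have h1 : HasDerivAt (fun x => ε * (x - m) / R) (ε / R) x := by
      have := (((hasDerivAt_id x).sub_const m).const_mul ε).div_const R
      simpa using this
    have h2 := h1.rpow_const (p := p) (Or.inr hp)
    exact h2.hasDerivWithinAt
  have hcv := lintegral_image_eq_lintegral_abs_deriv_mul hsm hder
    ((injOn_offset_inv hp hR hε0).mono Set.inter_subset_right)
    (fun u => I.indicator φ (thr p R m σ u))
  -- Points of `s` farther than R from the anchor correspond to no u ≤ 1. They are counted on the
  -- right only, hence an inequality.
  have hle : ∫⁻ u in Set.Ioc (0 : ℝ) 1, I.indicator φ (thr p R m σ u) ≤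
      ∫⁻ u in f '' s, I.indicator φ (thr p R m σ u) := by
    have hms : MeasurableSet (f '' s) :=
      hsm.image_of_continuousOn_injOn (fun x hx => (hder x hx).continuousWithinAt)
        ((injOn_offset_inv hp hR hε0).mono Set.inter_subset_right)
    rw [← lintegral_indicator measurableSet_Ioc, ← lintegral_indicator hms]
    refine lintegral_mono fun u => ?_
    by_cases hu : u ∈ Set.Ioc (0 : ℝ) 1
    · rw [Set.indicator_of_mem hu]
      by_cases hI' : thr p R m σ u ∈ I
      · have hmem : u ∈ f '' s := by
          have hpos : 0 < offset p R u := by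
            have := Real.rpow_pos_of_pos hR p
            exact Real.rpow_pos_of_pos (mul_pos hu.1 this) _
          have heq : ε * (thr p R m σ u - m) = offset p R u := by
            rw [hthr, add_sub_cancel_left, ← mul_assoc, hε2, one_mul]
          refine ⟨thr p R m σ u, ⟨hI', ?_⟩, ?_⟩
          · change 0 < ε * (thr p R m σ u - m)
            rw [heq]; exact hpos
          · simp only [hf]
            rw [heq, div_rpow_offset hp hR hu.1.le]
        rw [Set.indicator_of_mem hmem]
      · rw [Set.indicator_of_notMem hI']; exact zero_le
    · rw [Set.indicator_of_notMem hu]; exact zero_le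
  refine hle.trans ?_
  rw [hcv]
  have hY0 : ∀ x ∈ s, |f' x| ≤ p * Y ^ (p - 1) / R ^ p := by
    intro x hx
    have hxm : 0 < ε * (x - m) := hx.2
    have hxY : ε * (x - m) ≤ Y := by
      have := hY x hx.1
      have h2 : |ε * (x - m)| = |x - m| := by rw [abs_mul, habs, one_mul]
      rw [abs_of_pos hxm] at h2
      linarith
    have hRp : R ^ p = R * R ^ (p - 1) := by
      rw [mul_comm, ← Real.rpow_add_one hR.ne']; ring_nf
    simp only [hf']
    rw [abs_mul, abs_mul, abs_div, habs, abs_of_pos hR, abs_of_pos hp0,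
      abs_of_nonneg (Real.rpow_nonneg (by positivity) _), Real.div_rpow hxm.le hR.le, hRp]
    have h3 : (ε * (x - m)) ^ (p - 1) ≤ Y ^ (p - 1) :=
      Real.rpow_le_rpow hxm.le hxY (by linarith)
    have h4 : 0 < R ^ (p - 1) := Real.rpow_pos_of_pos hR _
    calc 1 / R * p * ((ε * (x - m)) ^ (p - 1) / R ^ (p - 1))
        = p * (ε * (x - m)) ^ (p - 1) / (R * R ^ (p - 1)) := by field_simp
      _ ≤ _ := by gcongr
  calc ∫⁻ x in s, ENNReal.ofReal |f' x| * I.indicator φ (thr p R m σ (f x))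
      ≤ ∫⁻ x in s, ENNReal.ofReal (p * Y ^ (p - 1) / R ^ p) * φ x := by
        refine setLIntegral_mono' hsm fun x hx => ?_
        have hxm : 0 < ε * (x - m) := hx.2
        have h5 : thr p R m σ (f x) = x := by
          rw [hthr]
          simp only [hf]
          rw [offset_div_rpow hp hR hxm.le, ← mul_assoc, hε2]; ring
        rw [h5, Set.indicator_of_mem hx.1]
        gcongr
        exact hY0 x hx
    _ = ENNReal.ofReal (p * Y ^ (p - 1) / R ^ p) * ∫⁻ x in s, φ x :=
        lintegral_const_mul' _ _ ENNReal.ofReal_ne_top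
    _ ≤ _ := by
        gcongr
        exact Set.inter_subset_left

end Seed

/-! ### Independence of the seeds -/

section Independence

/-- Replacing one coordinate of an independent family by a fresh sample preserves the law. -/
theorem measurePreserving_update_infinitePi {ι S : Type*} [DecidableEq ι] [MeasurableSpace S] (ν : Measure S)
    [IsProbabilityMeasure ν] (j : ι) :
    MeasurePreserving (fun q : (ι → S) × S => Function.update q.1 j q.2)
      ((Measure.infinitePi fun _ : ι => ν).prod ν) (Measure.infinitePi fun _ : ι => ν) := by
  have hm : Measurable fun q : (ι → S) × S => Function.update q.1 j q.2 := by
    refine measurable_pi_lambda _ fun i => ?_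
    by_cases h : i = j
    · subst h; simpa using measurable_snd
    · simp only [Function.update_of_ne h]
      exact (measurable_pi_apply i).comp measurable_fst
  refine ⟨hm, ?_⟩
  refine Measure.eq_infinitePi _ fun s t ht => ?_
  rw [Measure.map_apply hm (MeasurableSet.pi s.countable_toSet fun i _ => ht i)]
  -- The updated coordinate is read from the fresh sample only, so the preimage of a cylinder is a
  -- rectangle.
  have hpre : (fun q : (ι → S) × S => Function.update q.1 j q.2) ⁻¹' (Set.pi s t) =
      (Set.pi (s.erase j) t) ×ˢ (if j ∈ s then t j else Set.univ) := by
    ext ⟨ω, u⟩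
    simp only [Set.mem_preimage, Set.mem_pi, Set.mem_prod, Finset.mem_coe, Finset.mem_erase]
    constructor
    · intro h
      refine ⟨fun i hi => ?_, ?_⟩
      · have := h i hi.2
        rwa [Function.update_of_ne hi.1] at this
      · split_ifs with hj
        · simpa using h j hj
        · trivial
    · rintro ⟨h1, h2⟩ i hi
      by_cases hij : i = j
      · subst hij
        rw [if_pos hi] at h2
        simpa using h2
      · rw [Function.update_of_ne hij]
        exact h1 i ⟨hij, hi⟩
  rw [hpre, Measure.prod_prod, Measure.infinitePi_pi _ (fun i _ => ht i)]
  split_ifs with hj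
  · rw [Finset.prod_erase_mul _ _ hj]
  · rw [measure_univ, mul_one, Finset.erase_eq_of_notMem hj]

/-- A coordinate is independent of an event that does not depend on it. -/
theorem setLIntegral_infinitePi_coord {ι S : Type*} [DecidableEq ι] [MeasurableSpace S] (ν : Measure S)
    [IsProbabilityMeasure ν] (j : ι) {A : Set (ι → S)} (hA : MeasurableSet A)
    (hAj : ∀ ω u, Function.update ω j u ∈ A ↔ ω ∈ A) {h : S → ℝ≥0∞} (hh : Measurable h) :
    ∫⁻ ω in A, h (ω j) ∂(Measure.infinitePi fun _ : ι => ν) =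
      (Measure.infinitePi fun _ : ι => ν) A * ∫⁻ u, h u ∂ν := by
  set P := Measure.infinitePi fun _ : ι => ν with hP
  have hmp := measurePreserving_update_infinitePi ν j
  have hmeas : Measurable fun ω : ι → S => A.indicator (fun ω => h (ω j)) ω :=
    (hh.comp (measurable_pi_apply j)).indicator hA
  have hmeas' : Measurable fun q : (ι → S) × S =>
      A.indicator (fun ω => h (ω j)) (Function.update q.1 j q.2) := hmeas.comp hmp.measurable
  rw [← lintegral_indicator hA, ← hmp.lintegral_comp hmeas,
    lintegral_prod _ hmeas'.aemeasurable]
  have : ∀ ω, ∫⁻ u, A.indicator (fun ω => h (ω j)) (Function.update ω j u) ∂ν =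
      A.indicator (fun _ => ∫⁻ u, h u ∂ν) ω := by
    intro ω
    by_cases hω : ω ∈ A
    · rw [Set.indicator_of_mem hω]
      refine lintegral_congr fun u => ?_
      rw [Set.indicator_of_mem ((hAj ω u).2 hω), Function.update_self]
    · rw [Set.indicator_of_notMem hω]
      simp_rw [Set.indicator_of_notMem (fun h => hω ((hAj ω _).1 h))]
      simp
  simp_rw [this]
  rw [lintegral_indicator hA, setLIntegral_const, mul_comm]

end Independence

/-! ### Random variables with countably many values -/

/-- A function with countably many values and measurable fibers. -/
def CountablyValued {Ω α : Type*} [MeasurableSpace Ω] (Z : Ω → α) : Prop :=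
  (Set.range Z).Countable ∧ ∀ z, MeasurableSet (Z ⁻¹' {z})

namespace CountablyValued

variable {Ω Ω' α β : Type*} [MeasurableSpace Ω] [MeasurableSpace Ω'] {Z : Ω → α}

theorem const (a : α) : CountablyValued fun _ : Ω => a := by
  refine ⟨(Set.countable_singleton a).mono ?_, fun z => ?_⟩
  · rintro _ ⟨_, rfl⟩; rfl
  · by_cases h : a = z
    · subst h; simp
    · simp [h]

/-- Restricting to the range matters for the path of a point: the stopping oracle is known to be
measurable only at positions that can be reached. -/
theorem bind_range (hZ : CountablyValued Z) {W : α → Ω → β}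
    (hW : ∀ z ∈ Set.range Z, CountablyValued (W z)) : CountablyValued fun ω => W (Z ω) ω := by
  constructor
  · refine (hZ.1.biUnion fun z hz => (hW z hz).1).mono ?_
    rintro _ ⟨ω, rfl⟩
    exact Set.mem_biUnion (Set.mem_range_self ω) (Set.mem_range_self ω)
  · intro w
    have : (fun ω => W (Z ω) ω) ⁻¹' {w} = ⋃ z ∈ Set.range Z, Z ⁻¹' {z} ∩ (W z) ⁻¹' {w} := by
      ext ω
      simp only [Set.mem_preimage, Set.mem_singleton_iff, Set.mem_iUnion, Set.mem_inter_iff,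
        exists_prop]
      constructor
      · intro h; exact ⟨Z ω, ⟨ω, rfl⟩, rfl, h⟩
      · rintro ⟨z, _, rfl, h⟩; exact h
    rw [this]
    exact MeasurableSet.biUnion hZ.1 fun z hz => (hZ.2 z).inter ((hW z hz).2 w)

theorem bind (hZ : CountablyValued Z) {W : α → Ω → β} (hW : ∀ z, CountablyValued (W z)) :
    CountablyValued fun ω => W (Z ω) ω :=
  hZ.bind_range fun z _ => hW z

theorem comp (hZ : CountablyValued Z) (g : α → β) : CountablyValued fun ω => g (Z ω) :=
  hZ.bind (W := fun z _ => g z) fun z => const (g z)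

theorem prodMk (hZ : CountablyValued Z) {W : Ω → β} (hW : CountablyValued W) :
    CountablyValued fun ω => (Z ω, W ω) :=
  hZ.bind (W := fun z ω => (z, W ω)) fun z => hW.comp fun w => (z, w)

theorem measurableSet_preimage (hZ : CountablyValued Z) (B : Set α) :
    MeasurableSet (Z ⁻¹' B) := by
  have : Z ⁻¹' B = ⋃ z ∈ Set.range Z ∩ B, Z ⁻¹' {z} := by
    ext ω; simp
  rw [this]
  exact MeasurableSet.biUnion (hZ.1.mono Set.inter_subset_left) fun z _ => hZ.2 z

/-- No σ-algebra on the values of `Z` is involved, so every function of a random set of centers is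
measurable, however the oracles and potentials are defined. -/
theorem measurable [MeasurableSpace β] (hZ : CountablyValued Z) (g : α → β) :
    Measurable fun ω => g (Z ω) :=
  fun B _ => hZ.measurableSet_preimage (g ⁻¹' B)

theorem comp_measurable (hZ : CountablyValued Z) {g : Ω' → Ω} (hg : Measurable g) :
    CountablyValued fun ω => Z (g ω) := by
  refine ⟨hZ.1.mono ?_, fun z => hg (hZ.2 z)⟩
  rintro _ ⟨ω, rfl⟩; exact ⟨g ω, rfl⟩

theorem of_measurableSet {P : Ω → Prop} (hP : MeasurableSet {ω | P ω}) : CountablyValued P := by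
  refine ⟨Set.to_countable _, fun z => ?_⟩
  by_cases hz : z
  · have : P ⁻¹' {z} = {ω | P ω} := by ext ω; simp [hz]
    rw [this]; exact hP
  · have : P ⁻¹' {z} = {ω | P ω}ᶜ := by ext ω; simp [hz]
    rw [this]; exact hP.compl

theorem ite {P : Ω → Prop} [∀ ω, Decidable (P ω)] (hP : MeasurableSet {ω | P ω})
    {W W' : Ω → β} (hW : CountablyValued W) (hW' : CountablyValued W') :
    CountablyValued fun ω => if P ω then W ω else W' ω := by
  classical
  have := (of_measurableSet hP).bind (W := fun q ω => if q then W ω else W' ω) fun q => by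
    by_cases hq : q
    · simpa [hq] using hW
    · simpa [hq] using hW'
  convert this

theorem filter (N : Finset α) {P : α → Ω → Prop} [∀ a ω, Decidable (P a ω)]
    (hP : ∀ a ∈ N, MeasurableSet {ω | P a ω}) :
    CountablyValued fun ω => N.filter fun a => P a ω := by
  classical
  refine ⟨(N.powerset.finite_toSet.countable).mono ?_, fun S => ?_⟩
  · rintro _ ⟨ω, rfl⟩
    exact Finset.mem_coe.2 (Finset.mem_powerset.2 (Finset.filter_subset _ _))
  · have : (fun ω => N.filter fun a => P a ω) ⁻¹' {S} =
        {_ω : Ω | S ⊆ N} ∩ ⋂ a ∈ N, {ω | P a ω ↔ a ∈ S} := by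
      ext ω
      simp only [Set.mem_preimage, Set.mem_singleton_iff, Set.mem_inter_iff, Set.mem_ofPred_eq,
        Set.mem_iInter]
      constructor
      · rintro rfl
        exact ⟨Finset.filter_subset _ _, fun a ha => by simp [ha]⟩
      · rintro ⟨h1, h2⟩
        ext a
        rw [Finset.mem_filter]
        exact ⟨fun h => (h2 a h.1).1 h.2, fun h => ⟨h1 h, (h2 a (h1 h)).2 h⟩⟩
    rw [this]
    refine MeasurableSet.inter (MeasurableSet.const _) ?_
    refine Finset.measurableSet_biInter _ fun a ha => ?_
    by_cases haS : a ∈ S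
    · simpa [haS] using hP a ha
    · have h : {ω | P a ω ↔ a ∈ S} = {ω | P a ω}ᶜ := by ext ω; simp [haS]
      rw [h]; exact (hP a ha).compl

/-- The integral of a function of a countably valued random variable, fiber by fiber. -/
theorem lintegral_eq_tsum {μ : Measure Ω} (hZ : CountablyValued Z) (F : Ω → ℝ≥0∞) :
    ∫⁻ ω, F ω ∂μ = ∑' z : Set.range Z, ∫⁻ ω in Z ⁻¹' {z.1}, F ω ∂μ := by
  have : Countable (Set.range Z) := hZ.1.to_subtype
  rw [← lintegral_iUnion (fun z : Set.range Z => hZ.2 z.1)]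
  · have h : ⋃ z : Set.range Z, Z ⁻¹' {z.1} = Set.univ := by
      ext ω; simp
    rw [h, Measure.restrict_univ]
  · intro z z' hzz'
    refine Set.disjoint_left.2 fun ω h h' => hzz' (Subtype.ext ?_)
    exact (Set.mem_singleton_iff.1 h).symm.trans h'

end CountablyValued

/-! ### One cut -/

section Cut

variable {d : ℕ} {p : ℝ}

/-- The cut keeps `y` on the side of the main part. -/
def Cut.Keeps (w : Cut d) (y : Point d) : Prop :=
  if w.2.1 then y w.1 < w.2.2 else w.2.2 ≤ y w.1

/-- The cut splits the two points. -/
def Cut.Splits (w : Cut d) (y z : Point d) : Prop :=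
  ¬(y w.1 < w.2.2 ↔ z w.1 < w.2.2)

open Classical in
/-- The points of `M` on the same side of the cut as `y`. -/
noncomputable def Cut.side (w : Cut d) (y : Point d) (M : Finset (Point d)) : Finset (Point d) :=
  M.filter fun c => c w.1 < w.2.2 ↔ y w.1 < w.2.2

theorem Cut.left_union_right (w : Cut d) (M : Finset (Point d)) (c : Point d) :
    c ∈ M ↔ c ∈ w.left M ∨ c ∈ w.right M := by
  simp only [Cut.left, Cut.right, Finset.mem_filter, ← and_or_left]
  exact ⟨fun h => ⟨h, lt_or_ge _ _⟩, fun h => h.1⟩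

theorem Cut.side_eq_left {w : Cut d} {y : Point d} (h : y w.1 < w.2.2) (M : Finset (Point d)) :
    w.side y M = w.left M := by
  classical
  simp [Cut.side, Cut.left, h]

theorem Cut.side_eq_right {w : Cut d} {y : Point d} (h : ¬y w.1 < w.2.2)
    (M : Finset (Point d)) : w.side y M = w.right M := by
  classical
  simp [Cut.side, Cut.right, h]

theorem Cut.side_subset (w : Cut d) (y : Point d) (M : Finset (Point d)) : w.side y M ⊆ M :=
  Finset.filter_subset _ _

theorem Cut.Separates.side_nonempty {w : Cut d} {M : Finset (Point d)} (h : w.Separates M)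
    (y : Point d) : (w.side y M).Nonempty := by
  by_cases hy : y w.1 < w.2.2
  · rw [Cut.side_eq_left hy]; exact h.1
  · rw [Cut.side_eq_right hy]; exact h.2

theorem Cut.Separates.side_card_lt {w : Cut d} {M : Finset (Point d)} (h : w.Separates M)
    (y : Point d) : (w.side y M).card < M.card := by
  refine Finset.card_lt_card ⟨w.side_subset y M, fun hsub => ?_⟩
  obtain ⟨a, ha⟩ := h.1
  obtain ⟨b, hb⟩ := h.2
  simp only [Cut.left, Cut.right, Finset.mem_filter] at ha hb
  have h1 := hsub ha.1
  have h2 := hsub hb.1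
  simp only [Cut.side, Finset.mem_filter] at h1 h2
  exact absurd (h2.2.2 (h1.2.1 ha.2)) (not_lt.2 hb.2)

theorem Cut.Splits.separates {w : Cut d} {M : Finset (Point d)} {y z : Point d}
    (h : w.Splits y z) (hy : y ∈ M) (hz : z ∈ M) : w.Separates M := by
  unfold Cut.Splits at h
  by_cases hyw : y w.1 < w.2.2
  · exact ⟨⟨y, by simp [Cut.left, hy, hyw]⟩, ⟨z, by
      simp only [hyw, true_iff] at h; simp [Cut.right, hz, not_lt.1 h]⟩⟩
  · exact ⟨⟨z, by simp only [hyw, false_iff, not_not] at h; simp [Cut.left, hz, h]⟩, ⟨y, by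
      simp [Cut.right, hy, not_lt.1 hyw]⟩⟩

theorem Cut.Separates.cutMain_eq_side {w : Cut d} {M : Finset (Point d)} (h : w.Separates M)
    {y : Point d} (hy : w.Keeps y) : cutMain w M = w.side y M := by
  unfold Cut.Keeps at hy
  unfold cutMain
  rw [if_pos h]
  split_ifs at hy ⊢ with hσ
  · rw [Cut.side_eq_left hy]
  · rw [Cut.side_eq_right (not_lt.2 hy)]

theorem cutMain_subset (w : Cut d) (M : Finset (Point d)) : cutMain w M ⊆ M := by
  unfold cutMain
  split_ifs
  · exact Finset.filter_subset _ _
  · exact Finset.filter_subset _ _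
  · exact Finset.Subset.refl _

theorem cutMain_nonempty (w : Cut d) {M : Finset (Point d)} (hM : M.Nonempty) :
    (cutMain w M).Nonempty := by
  unfold cutMain
  split_ifs with h
  · exact h.1
  · exact h.2
  · exact hM

/-! ### Measurability of the operations on cuts -/

theorem measurable_sampleCut (p : ℝ) (m : Point d) (M : Finset (Point d)) :
    Measurable fun s : Seed d => sampleCut p m M s := by
  refine measurable_seed fun i σ => ?_
  simp only [sampleCut_eq]
  exact measurable_const.prodMk (measurable_const.prodMk
    ((measurable_thr _ _ _ _).comp measurable_subtype_coe))

theorem measurableSet_lt_cut (y : Point d) : MeasurableSet {w : Cut d | y w.1 < w.2.2} := by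
  have h : Measurable fun w : Cut d => (y w.1, w.2.2) := by
    refine measurable_from_prod_countable_right fun i => ?_
    exact (measurable_const (a := y i)).prodMk measurable_snd
  exact measurableSet_lt h.fst h.snd

theorem measurableSet_keeps (y : Point d) : MeasurableSet {w : Cut d | w.Keeps y} := by
  have h := CountablyValued.ite (P := fun w : Cut d => w.2.1 = true)
    (W := fun w : Cut d => y w.1 < w.2.2) (W' := fun w : Cut d => w.2.2 ≤ y w.1)
    ((measurableSet_singleton true).preimage (measurable_fst.comp measurable_snd))
    (CountablyValued.of_measurableSet (measurableSet_lt_cut y))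
    (CountablyValued.of_measurableSet
      (by simpa only [Set.compl_ofPred, not_lt] using (measurableSet_lt_cut y).compl))
  have h' := h.measurableSet_preimage {True}
  convert h' using 1
  ext w
  simp [Cut.Keeps]

theorem measurableSet_cut_ne (m : Point d) : MeasurableSet {w : Cut d | w.2.2 ≠ m w.1} := by
  have h : Measurable fun w : Cut d => m w.1 :=
    (measurable_of_finite fun i => m i).comp measurable_fst
  exact (measurableSet_eq_fun (measurable_snd.comp measurable_snd) h).compl

theorem countablyValued_left (M : Finset (Point d)) :
    CountablyValued fun w : Cut d => w.left M :=
  CountablyValued.filter M (P := fun c (w : Cut d) => c w.1 < w.2.2)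
    fun a _ => measurableSet_lt_cut a

theorem countablyValued_right (M : Finset (Point d)) :
    CountablyValued fun w : Cut d => w.right M :=
  CountablyValued.filter M (P := fun c (w : Cut d) => w.2.2 ≤ c w.1)
    fun a _ => by simpa only [Set.compl_ofPred, not_lt] using (measurableSet_lt_cut a).compl

theorem countablyValued_side (y : Point d) (M : Finset (Point d)) :
    CountablyValued fun w : Cut d => w.side y M := by
  classical
  have := CountablyValued.ite (measurableSet_lt_cut y) (countablyValued_left M)
    (countablyValued_right M)
  convert this using 2 with w
  split_ifs with h
  · exact Cut.side_eq_left h M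
  · exact Cut.side_eq_right h M

theorem measurableSet_separates (M : Finset (Point d)) :
    MeasurableSet {w : Cut d | w.Separates M} :=
  ((countablyValued_left M).measurableSet_preimage {S | S.Nonempty}).inter
    ((countablyValued_right M).measurableSet_preimage {S | S.Nonempty})

theorem measurableSet_splits (y z : Point d) : MeasurableSet {w : Cut d | w.Splits y z} := by
  have : {w : Cut d | w.Splits y z} =
      symmDiff {w : Cut d | y w.1 < w.2.2} {w : Cut d | z w.1 < w.2.2} := by
    ext w
    simp only [Cut.Splits, Set.mem_ofPred_eq, Set.mem_symmDiff]
    tauto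
  rw [this]
  exact (measurableSet_lt_cut y).symmDiff (measurableSet_lt_cut z)

theorem countablyValued_cutMain (M : Finset (Point d)) :
    CountablyValued fun w : Cut d => cutMain w M := by
  classical
  have h := CountablyValued.ite (measurableSet_separates M)
    (CountablyValued.ite (P := fun w : Cut d => w.2.1 = true)
      ((measurableSet_singleton true).preimage (measurable_fst.comp measurable_snd))
      (countablyValued_left M) (countablyValued_right M))
    (CountablyValued.const M)
  unfold cutMain
  convert h

/-! ### Lower bounds on the probabilities of cuts -/

/-- One favourable sign per coordinate suffices; giving up the other sign costs the factor 2 in the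
denominator. -/
theorem le_seedLaw [NeZero d] {A : Set (Seed d)} (hA : MeasurableSet A) {a : Fin d → ℝ}
    (ha : ∀ i, 0 ≤ a i)
    (h : ∀ i, ∃ σ, ENNReal.ofReal (a i) ≤ volume {u : unitInterval | (i, σ, u) ∈ A}) :
    ENNReal.ofReal ((∑ i, a i) / (2 * d)) ≤ seedLaw d A := by
  rw [← lintegral_indicator_one hA, lintegral_seedLaw (measurable_one.indicator hA),
    div_eq_mul_one_div, mul_comm, ENNReal.ofReal_mul (by positivity),
    ENNReal.ofReal_sum_of_nonneg fun i _ => ha i]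
  gcongr with i
  obtain ⟨σ, hσ⟩ := h i
  refine hσ.trans ?_
  have hm : MeasurableSet {u : unitInterval | (i, σ, u) ∈ A} :=
    hA.preimage (measurable_prodMk_left.comp measurable_prodMk_left)
  rw [← lintegral_indicator_one hm]
  exact Finset.single_le_sum
    (f := fun σ => ∫⁻ u : unitInterval, A.indicator 1 (i, σ, u)) (fun _ _ => zero_le)
    (Finset.mem_univ σ)

/-- A center is cut off from the main part with probability at least
`(‖c - m‖_p / R)^p / (2 d)`. -/
theorem le_seedLaw_not_keeps [NeZero d] (hp : 1 ≤ p) (m : Point d) {M : Finset (Point d)}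
    (hR : 0 < radius p m M) {c : Point d} (hc : c ∈ M) :
    ENNReal.ofReal ((lpDist p c m / radius p m M) ^ p / (2 * d)) ≤
      seedLaw d {s | ¬(sampleCut p m M s).Keeps c ∧
        (sampleCut p m M s).2.2 ≠ m (sampleCut p m M s).1} := by
  set R := radius p m M with hRdef
  have hsum : (lpDist p c m / R) ^ p = ∑ i, |c i - m i| ^ p / R ^ p := by
    rw [Real.div_rpow (lpDist_nonneg _ _) hR.le, lpDist_rpow hp, Finset.sum_div]
  rw [hsum]
  refine le_seedLaw (((measurableSet_keeps c).compl.inter (measurableSet_cut_ne m)).preimage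
    (measurable_sampleCut p m M)) (fun i => by positivity) fun i => ?_
  have hp0 : p ≠ 0 := by linarith
  have hle : |c i - m i| ≤ R := (abs_sub_le_lpDist hp c m i).trans (lpDist_le_radius hc)
  have hvol := le_volume_offset_mem_Ioo hp hR le_rfl (abs_nonneg (c i - m i)) hle
  rw [Real.zero_rpow hp0, sub_zero] at hvol
  rcases le_total (m i) (c i) with hmc | hmc
  · refine ⟨true, hvol.trans (measure_mono ?_)⟩
    rintro u ⟨hu0, hu1⟩
    rw [abs_of_nonneg (sub_nonneg.2 hmc)] at hu1
    change ¬c i < m i + offset p R u ∧ m i + offset p R u ≠ m i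
    exact ⟨by linarith, fun h => by linarith⟩
  · refine ⟨false, hvol.trans (measure_mono ?_)⟩
    rintro u ⟨hu0, hu1⟩
    rw [abs_of_nonpos (sub_nonpos.2 hmc)] at hu1
    change ¬m i - offset p R u ≤ c i ∧ m i - offset p R u ≠ m i
    exact ⟨by linarith, fun h => by linarith⟩

/-- For each coordinate, the sampled threshold falls strictly between `α` and `β` with one of the
signs with probability at least `(|β - α| / (2 R))^p`. -/
theorem exists_le_volume_thr_mem_Ioo {R m α β : ℝ} (hp : 1 ≤ p) (hR : 0 < R) (hαβ : α ≤ β)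
    (hα : |α - m| ≤ R) (hβ : |β - m| ≤ R) :
    ∃ σ, ENNReal.ofReal (((β - α) / (2 * R)) ^ p) ≤
      volume {u : unitInterval | α < thr p R m σ u ∧ thr p R m σ u < β} := by
  have hp0 : (0 : ℝ) ≤ p := by linarith
  have key : ∀ v t : ℝ, 0 ≤ v → (β - α) / 2 ≤ t - v → v ≤ t → t ≤ R →
      ENNReal.ofReal (((β - α) / (2 * R)) ^ p) ≤
        volume {u : unitInterval | v < offset p R u ∧ offset p R u < t} := by
    intro v t hv hvt hvt' htR
    refine le_trans (ENNReal.ofReal_le_ofReal ?_) (le_volume_offset_mem_Ioo hp hR hv hvt' htR)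
    rw [← div_div, Real.div_rpow (by linarith) hR.le]
    gcongr
    exact (Real.rpow_le_rpow (by linarith) hvt hp0).trans (rpow_sub_le_sub_rpow hp hv hvt')
  rw [abs_le] at hα hβ
  -- At least half of the interval lies on one side of the anchor, and superadditivity of the p-th
  -- power bounds the probability of that half from below.
  rcases le_total m ((α + β) / 2) with h | h
  · refine ⟨true, (key (max (α - m) 0) (β - m) (le_max_right _ _) ?_ ?_ (by linarith)).trans
      (measure_mono ?_)⟩
    · rcases max_cases (α - m) 0 with ⟨h', _⟩ | ⟨h', _⟩ <;> rw [h'] <;> linarith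
    · exact max_le (by linarith) (by linarith)
    · rintro u ⟨hu0, hu1⟩
      have := (le_max_left _ _).trans_lt hu0
      simp only [Set.mem_ofPred_eq, thr, if_true]
      constructor <;> linarith
  · refine ⟨false, (key (max (m - β) 0) (m - α) (le_max_right _ _) ?_ ?_ (by linarith)).trans
      (measure_mono ?_)⟩
    · rcases max_cases (m - β) 0 with ⟨h', _⟩ | ⟨h', _⟩ <;> rw [h'] <;> linarith
    · exact max_le (by linarith) (by linarith)
    · rintro u ⟨hu0, hu1⟩
      have := (le_max_left _ _).trans_lt hu0
      simp only [Set.mem_ofPred_eq, thr, Bool.false_eq_true, if_false]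
      constructor <;> linarith

/-- Two centers of the main part are split with probability at least
`(‖c - c'‖_p / (2 R))^p / (2 d)`. -/
theorem le_seedLaw_splits [NeZero d] (hp : 1 ≤ p) (m : Point d) {M : Finset (Point d)}
    (hR : 0 < radius p m M) {c c' : Point d} (hc : c ∈ M) (hc' : c' ∈ M) :
    ENNReal.ofReal ((lpDist p c c' / (2 * radius p m M)) ^ p / (2 * d)) ≤
      seedLaw d {s | (sampleCut p m M s).Splits c c'} := by
  set R := radius p m M with hRdef
  have hsum : (lpDist p c c' / (2 * R)) ^ p = ∑ i, (|c i - c' i| / (2 * R)) ^ p := by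
    rw [Real.div_rpow (lpDist_nonneg _ _) (by positivity), lpDist_rpow hp, Finset.sum_div]
    refine Finset.sum_congr rfl fun i _ => ?_
    rw [Real.div_rpow (abs_nonneg _) (by positivity)]
  rw [hsum]
  refine le_seedLaw ((measurableSet_splits c c').preimage (measurable_sampleCut p m M))
    (fun i => by positivity) fun i => ?_
  have h1 : |c i - m i| ≤ R := (abs_sub_le_lpDist hp c m i).trans (lpDist_le_radius hc)
  have h2 : |c' i - m i| ≤ R := (abs_sub_le_lpDist hp c' m i).trans (lpDist_le_radius hc')
  rcases le_total (c i) (c' i) with h | h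
  · obtain ⟨σ, hσ⟩ := exists_le_volume_thr_mem_Ioo hp hR h h1 h2
    refine ⟨σ, ?_⟩
    rw [abs_sub_comm, abs_of_nonneg (sub_nonneg.2 h)]
    refine hσ.trans (measure_mono ?_)
    rintro u ⟨hu0, hu1⟩
    change ¬(c i < thr p R (m i) σ u ↔ c' i < thr p R (m i) σ u)
    simp [hu0, hu1.le]
  · obtain ⟨σ, hσ⟩ := exists_le_volume_thr_mem_Ioo hp hR h h2 h1
    refine ⟨σ, ?_⟩
    rw [abs_of_nonneg (sub_nonneg.2 h)]
    refine hσ.trans (measure_mono ?_)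
    rintro u ⟨hu0, hu1⟩
    change ¬(c i < thr p R (m i) σ u ↔ c' i < thr p R (m i) σ u)
    simp [hu0, hu1.le]

end Cut

section Step

variable {d : ℕ} {p : ℝ}

/-! ### The transition of a point in one iteration -/

open Classical in
/-- The set of centers of the call and the set of centers of the cell that contain the point `y`
after the cut `w`, when they are `Cu` and `M` before. -/
noncomputable def nextPair (w : Cut d) (y : Point d) (Cu M : Finset (Point d)) :
    Finset (Point d) × Finset (Point d) :=
  if w.Separates M then
    if w.Keeps y then (Cu, w.side y M) else (w.side y M, w.side y M)
  else (Cu, M)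

theorem Cut.mem_side_self (w : Cut d) {c : Point d} {M : Finset (Point d)} (hc : c ∈ M) :
    c ∈ w.side c M := by
  simp [Cut.side, hc]

theorem Cut.side_congr {w : Cut d} {x c : Point d} (h : ¬w.Splits x c)
    (M : Finset (Point d)) : w.side x M = w.side c M := by
  classical
  simp only [Cut.Splits, not_not] at h
  simp only [Cut.side, h]

theorem Cut.keeps_congr {w : Cut d} {x c : Point d} (h : ¬w.Splits x c) :
    w.Keeps x ↔ w.Keeps c := by
  simp only [Cut.Splits, not_not] at h
  simp only [Cut.Keeps, h, ← not_lt]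

/-- Both the side and whether it is kept depend on a point only through its position relative to the
threshold. Hence, until a split, the path of `x` can be read off from that of `c`. -/
theorem nextPair_congr {w : Cut d} {x c : Point d} (h : ¬w.Splits x c)
    (Cu M : Finset (Point d)) : nextPair w x Cu M = nextPair w c Cu M := by
  classical
  simp only [nextPair, Cut.side_congr h, Cut.keeps_congr h]

theorem nextPair_snd_eq_side (w : Cut d) {c : Point d} (Cu : Finset (Point d))
    {M : Finset (Point d)} (hc : c ∈ M) : (nextPair w c Cu M).2 = w.side c M := by
  classical
  unfold nextPair
  split_ifs with h h'
  · rfl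
  · rfl
  · symm
    refine Finset.filter_true_of_mem fun c' hc' => ?_
    by_contra hne
    exact h (Cut.Splits.separates (w := w) hne hc' hc)

theorem nextPair_snd_subset (w : Cut d) (y : Point d) (Cu M : Finset (Point d)) :
    (nextPair w y Cu M).2 ⊆ M := by
  unfold nextPair
  split_ifs
  · exact w.side_subset y M
  · exact w.side_subset y M
  · exact Finset.Subset.refl _

theorem nextPair_fst_subset (w : Cut d) (y : Point d) {Cu M : Finset (Point d)} (h : M ⊆ Cu) :
    (nextPair w y Cu M).1 ⊆ Cu := by
  unfold nextPair
  split_ifs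
  · exact Finset.Subset.refl _
  · exact (w.side_subset y M).trans h
  · exact Finset.Subset.refl _

theorem nextPair_subset (w : Cut d) (y : Point d) {Cu M : Finset (Point d)} (h : M ⊆ Cu) :
    (nextPair w y Cu M).2 ⊆ (nextPair w y Cu M).1 := by
  unfold nextPair
  split_ifs
  · exact (w.side_subset y M).trans h
  · exact Finset.Subset.refl _
  · exact h

theorem nextPair_snd_nonempty (w : Cut d) (y : Point d) (Cu : Finset (Point d))
    {M : Finset (Point d)} (h : M.Nonempty) : (nextPair w y Cu M).2.Nonempty := by
  unfold nextPair
  split_ifs with hs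
  · exact hs.side_nonempty y
  · exact hs.side_nonempty y
  · exact h

theorem countablyValued_nextPair (y : Point d) (Cu M : Finset (Point d)) :
    CountablyValued fun w : Cut d => nextPair w y Cu M := by
  classical
  have h := CountablyValued.ite (measurableSet_separates M)
    (CountablyValued.ite (measurableSet_keeps y)
      ((countablyValued_side y M).comp fun S => (Cu, S))
      ((countablyValued_side y M).comp fun S => (S, S)))
    (CountablyValued.const (Cu, M))
  unfold nextPair
  convert h

/-- The situation in a call that has not stopped: in each coordinate the main part contains
centers on both closed sides of the anchor, and at most three quarters of the centers of the call
are strictly on one side of the anchor. -/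
structure Balanced (m : Point d) (Cu M : Finset (Point d)) : Prop where
  subset : M ⊆ Cu
  two_le : 2 ≤ M.card
  exists_le : ∀ i, ∃ c ∈ M, c i ≤ m i
  exists_ge : ∀ i, ∃ c ∈ M, m i ≤ c i
  card_gt : ∀ i, 4 * (Cu.filter fun c => m i < c i).card ≤ 3 * Cu.card
  card_lt : ∀ i, 4 * (Cu.filter fun c => c i < m i).card ≤ 3 * Cu.card

theorem Balanced.nonempty {m : Point d} {Cu M : Finset (Point d)} (h : Balanced m Cu M) :
    M.Nonempty := Finset.card_pos.1 (by have := h.two_le; omega)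

theorem Balanced.radius_pos {m : Point d} {Cu M : Finset (Point d)} (h : Balanced m Cu M)
    (hp : 1 ≤ p) : 0 < radius p m M := Explainable.radius_pos hp m h.two_le

/-- Balance provides a center of `M` on the side of such a cut that contains the anchor, so only the
side of `c` could be empty. -/
theorem Balanced.cut_off {m : Point d} {Cu M : Finset (Point d)} (h : Balanced m Cu M)
    (hp : 1 ≤ p) {s : Seed d} {c : Point d} (hc : ¬(sampleCut p m M s).Keeps c)
    (hne : (sampleCut p m M s).2.2 ≠ m (sampleCut p m M s).1) :
    (sampleCut p m M s).Separates M ↔ ((sampleCut p m M s).side c M).Nonempty := by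
  refine ⟨fun hs => hs.side_nonempty c, fun hside => ?_⟩
  obtain ⟨i, σ, u⟩ := s
  have hθ := offset_nonneg (p := p) (h.radius_pos hp).le u.2.1
  cases σ
  · change ¬m i - offset p (radius p m M) u ≤ c i at hc
    change m i - offset p (radius p m M) u ≠ m i at hne
    rw [Cut.side_eq_left (not_le.1 hc)] at hside
    obtain ⟨c', hc', hle⟩ := h.exists_ge i
    refine ⟨hside, ⟨c', Finset.mem_filter.2 ⟨hc', ?_⟩⟩⟩
    change m i - offset p (radius p m M) u ≤ c' i
    linarith
  · change ¬c i < m i + offset p (radius p m M) u at hc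
    change m i + offset p (radius p m M) u ≠ m i at hne
    rw [Cut.side_eq_right hc] at hside
    obtain ⟨c', hc', hle⟩ := h.exists_le i
    refine ⟨⟨c', Finset.mem_filter.2 ⟨hc', ?_⟩⟩, hside⟩
    change c' i < m i + offset p (radius p m M) u
    have : 0 < offset p (radius p m M) u :=
      lt_of_le_of_ne hθ fun h0 => hne (by rw [← h0, add_zero])
    linarith

/-- The side that is cut off lies strictly beyond the anchor in one coordinate. A threshold equal to
the anchor is excluded because it could also cut off the centers level with the anchor. -/
theorem Balanced.card_side_le {m : Point d} {Cu M : Finset (Point d)} (h : Balanced m Cu M)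
    (hp : 1 ≤ p) {s : Seed d} {c : Point d} (hc : ¬(sampleCut p m M s).Keeps c)
    (hne : (sampleCut p m M s).2.2 ≠ m (sampleCut p m M s).1) :
    4 * ((sampleCut p m M s).side c M).card ≤ 3 * Cu.card := by
  obtain ⟨i, σ, u⟩ := s
  have hθ := offset_nonneg (p := p) (h.radius_pos hp).le u.2.1
  cases σ
  · change ¬m i - offset p (radius p m M) u ≤ c i at hc
    rw [Cut.side_eq_left (not_le.1 hc)]
    refine le_trans (Nat.mul_le_mul_left 4 (Finset.card_le_card fun c' hc' => ?_)) (h.card_lt i)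
    rw [Cut.left, Finset.mem_filter] at hc'
    have hc2 : c' i < m i - offset p (radius p m M) u := hc'.2
    exact Finset.mem_filter.2 ⟨h.subset hc'.1, by linarith⟩
  · change ¬c i < m i + offset p (radius p m M) u at hc
    change m i + offset p (radius p m M) u ≠ m i at hne
    have : 0 < offset p (radius p m M) u :=
      lt_of_le_of_ne hθ fun h0 => hne (by rw [← h0, add_zero])
    rw [Cut.side_eq_right hc]
    refine le_trans (Nat.mul_le_mul_left 4 (Finset.card_le_card fun c' hc' => ?_)) (h.card_gt i)
    rw [Cut.right, Finset.mem_filter] at hc'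
    have hc2 : m i + offset p (radius p m M) u ≤ c' i := hc'.2
    exact Finset.mem_filter.2 ⟨h.subset hc'.1, by linarith⟩

/-- The new call has at most three quarters of the centers, and log(3/4) ≤ -1/4. -/
theorem Balanced.log_card_add_le {m : Point d} {Cu M : Finset (Point d)} (h : Balanced m Cu M)
    (hp : 1 ≤ p) {s : Seed d} {c : Point d} (hcM : c ∈ M) (hc : ¬(sampleCut p m M s).Keeps c)
    (hne : (sampleCut p m M s).2.2 ≠ m (sampleCut p m M s).1) :
    Real.log (nextPair (sampleCut p m M s) c Cu M).1.card + 1 / 4 ≤ Real.log Cu.card := by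
  have hside : ((sampleCut p m M s).side c M).Nonempty := ⟨c, Cut.mem_side_self _ hcM⟩
  have hsep := (h.cut_off hp hc hne).2 hside
  rw [nextPair, if_pos hsep, if_neg hc]
  have h1 : (0 : ℝ) < ((sampleCut p m M s).side c M).card := by
    exact_mod_cast Finset.card_pos.2 hside
  have h2 : (4 : ℝ) * ((sampleCut p m M s).side c M).card ≤ 3 * Cu.card := by
    exact_mod_cast h.card_side_le hp hc hne
  have h3 : (0 : ℝ) < Cu.card := by linarith
  have h4 : ((sampleCut p m M s).side c M).card ≤ (3 / 4 : ℝ) * Cu.card := by linarith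
  have h5 := Real.log_le_log h1 h4
  rw [Real.log_mul (by norm_num) h3.ne'] at h5
  have h6 := Real.log_le_sub_one_of_pos (show (0 : ℝ) < 3 / 4 by norm_num)
  linarith

theorem log_card_nextPair_le (w : Cut d) (y : Point d) {Cu M : Finset (Point d)} (h : M ⊆ Cu)
    (hM : M.Nonempty) : Real.log (nextPair w y Cu M).1.card ≤ Real.log Cu.card := by
  have h1 : 0 < (nextPair w y Cu M).1.card := Finset.card_pos.2
    ((nextPair_snd_nonempty w y Cu hM).mono (nextPair_subset w y h))
  exact Real.log_le_log (by exact_mod_cast h1)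
    (by exact_mod_cast Finset.card_le_card (nextPair_fst_subset w y h))

/-- The drift of the logarithm of the size of the call that contains the center `c`. -/
theorem Balanced.lintegral_log_card_le [NeZero d] {m : Point d} {Cu M : Finset (Point d)}
    (h : Balanced m Cu M) (hp : 1 ≤ p) {c : Point d} (hc : c ∈ M) {A : ℝ} (hA : 0 ≤ A) :
    ∫⁻ s, ENNReal.ofReal
        (A * Real.log (nextPair (sampleCut p m M s) c Cu M).1.card) ∂seedLaw d +
      ENNReal.ofReal (A / (8 * d) * (lpDist p c m / radius p m M) ^ p) ≤
    ENNReal.ofReal (A * Real.log Cu.card) := by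
  set E : Set (Seed d) := {s | ¬(sampleCut p m M s).Keeps c ∧
        (sampleCut p m M s).2.2 ≠ m (sampleCut p m M s).1} with hE
  have hEm : MeasurableSet E :=
    ((measurableSet_keeps c).compl.inter (measurableSet_cut_ne m)).preimage
      (measurable_sampleCut p m M)
  have hEν := le_seedLaw_not_keeps hp m (h.radius_pos hp) hc
  have hmeas : Measurable fun s : Seed d => ENNReal.ofReal
        (A * Real.log (nextPair (sampleCut p m M s) c Cu M).1.card) :=
    ((countablyValued_nextPair c Cu M).comp_measurable (measurable_sampleCut p m M)).measurable
      fun q => ENNReal.ofReal (A * Real.log q.1.card)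
  -- A loss of A / 4 on an event of probability at least (‖c - m‖_p / R)^p / (2d) yields the
  -- denominator 8d.
  calc _ ≤ ∫⁻ s, ENNReal.ofReal
        (A * Real.log (nextPair (sampleCut p m M s) c Cu M).1.card) ∂seedLaw d +
          ∫⁻ s, E.indicator (fun _ => ENNReal.ofReal (A / 4)) s ∂seedLaw d := by
        gcongr
        rw [lintegral_indicator_const hEm,
          show A / (8 * d) * (lpDist p c m / radius p m M) ^ p =
            A / 4 * ((lpDist p c m / radius p m M) ^ p / (2 * d)) by ring,
          ENNReal.ofReal_mul (by positivity)]
        gcongr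
    _ = ∫⁻ s, (ENNReal.ofReal
        (A * Real.log (nextPair (sampleCut p m M s) c Cu M).1.card) +
          E.indicator (fun _ => ENNReal.ofReal (A / 4)) s) ∂seedLaw d := by
        rw [lintegral_add_left hmeas]
    _ ≤ ∫⁻ _, ENNReal.ofReal (A * Real.log Cu.card) ∂seedLaw d := by
        refine lintegral_mono fun s => ?_
        by_cases hs : s ∈ E
        · rw [Set.indicator_of_mem hs]
          have h1 := h.log_card_add_le hp hc hs.1 hs.2
          rw [← ENNReal.ofReal_add (mul_nonneg hA (Real.log_natCast_nonneg _)) (by positivity)]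
          refine ENNReal.ofReal_le_ofReal ?_
          nlinarith
        · rw [Set.indicator_of_notMem hs, add_zero]
          refine ENNReal.ofReal_le_ofReal ?_
          exact mul_le_mul_of_nonneg_left
            (log_card_nextPair_le _ c h.subset h.nonempty) hA
    _ = _ := by simp

end Step

section Potential

variable {d : ℕ} {p : ℝ}

/-! ### The potential of the centers that are far from `c` -/

open Classical in
/-- The points of `M` that are on the same side of the threshold `ϑ` in coordinate `i` as `x`. -/
noncomputable def sideAt (x : Point d) (i : Fin d) (ϑ : ℝ) (M : Finset (Point d)) :
    Finset (Point d) :=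
  M.filter fun c => c i < ϑ ↔ x i < ϑ

theorem Cut.side_eq_sideAt (w : Cut d) (x : Point d) (M : Finset (Point d)) :
    w.side x M = sideAt x w.1 w.2.2 M := rfl

theorem sideAt_mono (x : Point d) (i : Fin d) (ϑ : ℝ) {M N : Finset (Point d)} (h : M ⊆ N) :
    sideAt x i ϑ M ⊆ sideAt x i ϑ N :=
  Finset.filter_subset_filter _ h

theorem countablyValued_sideAt (x : Point d) (i : Fin d) (M : Finset (Point d)) :
    CountablyValued fun ϑ : ℝ => sideAt x i ϑ M := by
  classical
  refine CountablyValued.filter M (P := fun c ϑ => c i < ϑ ↔ x i < ϑ) fun c _ => ?_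
  have h := ((CountablyValued.of_measurableSet (measurableSet_Ioi (a := c i))).bind
    (W := fun q ϑ => (q, x i < ϑ)) fun q =>
      (CountablyValued.of_measurableSet (measurableSet_Ioi (a := x i))).comp fun r => (q, r))
  exact h.measurableSet_preimage {q | q.1 ↔ q.2}

open Classical in
/-- The centers of `M` whose distance from `c` is more than `2 ^ j / 2` times the distance of some
center of `T` from `x`. -/
noncomputable def crowd (p : ℝ) (x c : Point d) (j : ℕ) (T M : Finset (Point d)) :
    Finset (Point d) :=
  M.filter fun c' => ∃ c'' ∈ T,
    2 ^ j * max (lpDist p x c) (lpDist p x c'') / 2 < lpDist p c' c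

theorem crowd_mono (x c : Point d) (j : ℕ) {T T' M M' : Finset (Point d)} (hT : T ⊆ T')
    (hM : M ⊆ M') : crowd p x c j T M ⊆ crowd p x c j T' M' := by
  intro c' hc'
  simp only [crowd, Finset.mem_filter] at hc' ⊢
  obtain ⟨h1, c'', h2, h3⟩ := hc'
  exact ⟨hM h1, c'', hT h2, h3⟩

/-- The weight `min 1 (2 ^ q / 2 ^ j)` of the scale `j`. -/
noncomputable def scaleWeight (q j : ℕ) : ℝ := min 1 (2 ^ q / 2 ^ j)

theorem scaleWeight_nonneg (q j : ℕ) : 0 ≤ scaleWeight q j := by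
  unfold scaleWeight; positivity

/-- The weighted sum of the logarithms of the sizes of the crowds at all scales. -/
noncomputable def crowdPotential (p : ℝ) (q : ℕ) (x c : Point d) (T M : Finset (Point d)) :
    ℝ≥0∞ :=
  ∑' j, ENNReal.ofReal (scaleWeight q j) *
    ENNReal.ofReal (Real.log (1 + (crowd p x c j T M).card))

theorem crowdPotential_mono (q : ℕ) (x c : Point d) {T T' M M' : Finset (Point d)} (hT : T ⊆ T')
    (hM : M ⊆ M') : crowdPotential p q x c T M ≤ crowdPotential p q x c T' M' := by
  refine ENNReal.tsum_le_tsum fun j => ?_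
  gcongr
  exact crowd_mono x c j hT hM

/-- The first q weights are at most 1 and the others are dominated by a geometric series with sum 2.
This number of scales is the source of the factor log log k. -/
theorem tsum_scaleWeight_le (q : ℕ) :
    ∑' j, ENNReal.ofReal (scaleWeight q j) ≤ ENNReal.ofReal (q + 2) := by
  have hs : Summable fun j : ℕ => scaleWeight q j := by
    refine Summable.of_nonneg_of_le (scaleWeight_nonneg q) (fun j => min_le_right _ _)
      (f := fun j : ℕ => (2 : ℝ) ^ q / 2 ^ j) ?_
    simpa [div_eq_mul_inv] using
      (summable_geometric_of_lt_one (r := (2 : ℝ)⁻¹) (by norm_num) (by norm_num)).mul_left _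
  rw [← ENNReal.ofReal_tsum_of_nonneg (scaleWeight_nonneg q) hs]
  refine ENNReal.ofReal_le_ofReal ?_
  rw [← hs.sum_add_tsum_nat_add q]
  have h1 : ∑ j ∈ Finset.range q, scaleWeight q j ≤ q := by
    calc _ ≤ ∑ j ∈ Finset.range q, (1 : ℝ) := Finset.sum_le_sum fun j _ => min_le_left _ _
      _ = q := by simp
  have h2 : ∑' j, scaleWeight q (j + q) ≤ 2 := by
    rw [← tsum_geometric_two]
    refine Summable.tsum_le_tsum (fun j => ?_) ((summable_nat_add_iff q).2 hs)
      summable_geometric_two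
    refine (min_le_right _ _).trans (le_of_eq ?_)
    rw [pow_add, one_div, inv_pow]
    field_simp
  linarith

theorem crowdPotential_le (q : ℕ) (x c : Point d) {k : ℕ} {T M : Finset (Point d)}
    (hM : M.card ≤ k) :
    crowdPotential p q x c T M ≤ ENNReal.ofReal ((q + 2) * Real.log (1 + k)) := by
  unfold crowdPotential
  calc _ ≤ ∑' j, ENNReal.ofReal (scaleWeight q j) * ENNReal.ofReal (Real.log (1 + k)) := by
        refine ENNReal.tsum_le_tsum fun j => ?_
        gcongr
        exact (Finset.card_le_card (Finset.filter_subset _ _)).trans hM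
    _ ≤ _ := by
        rw [ENNReal.tsum_mul_right, ENNReal.ofReal_mul (by positivity)]
        gcongr
        exact tsum_scaleWeight_le q

/-- The drift of the logarithm of the size of a set of centers that are likely to be split
from `c`. -/
theorem lintegral_log_card_add_le [NeZero d] {m : Point d} {M F : Finset (Point d)} {c : Point d}
    (hF : F.Nonempty) {β : ℝ} (hβ : 0 ≤ β)
    (hsplit : ∀ c' ∈ F, ENNReal.ofReal β ≤ seedLaw d {s | (sampleCut p m M s).Splits c c'})
    {G : Finset (Point d) → Finset (Point d)}
    (hG : ∀ w : Cut d, G (w.side c M) ⊆ F ∧ ∀ c' ∈ G (w.side c M), ¬w.Splits c c') :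
    ∫⁻ s, ENNReal.ofReal
        (Real.log (1 + (G ((sampleCut p m M s).side c M)).card)) ∂seedLaw d +
      ENNReal.ofReal (β / 2) ≤ ENNReal.ofReal (Real.log (1 + F.card)) := by
  classical
  have hmeas : Measurable fun s : Seed d => ENNReal.ofReal
      (Real.log (1 + (G ((sampleCut p m M s).side c M)).card)) :=
    ((countablyValued_side c M).comp_measurable (measurable_sampleCut p m M)).measurable
      fun S => ENNReal.ofReal (Real.log (1 + (G S).card))
  have hEm : ∀ c', MeasurableSet {s : Seed d | (sampleCut p m M s).Splits c c'} := fun c' =>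
    (measurableSet_splits c c').preimage (measurable_sampleCut p m M)
  have hN : (1 : ℝ) ≤ F.card := by exact_mod_cast Finset.card_pos.2 hF
  -- Since log t ≤ t - 1, losing n members of `F` lowers the logarithm by at least n * a. The
  -- expected loss is at least |F| a β ≥ β / 2, as |F| ≥ 1.
  set a : ℝ := 1 / (1 + F.card) with ha
  have ha0 : 0 ≤ a := by positivity
  set E : Point d → Set (Seed d) := fun c' => {s | (sampleCut p m M s).Splits c c'} with hE
  calc _ ≤ ∫⁻ s, ENNReal.ofReal
        (Real.log (1 + (G ((sampleCut p m M s).side c M)).card)) ∂seedLaw d +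
        ∫⁻ s, ∑ c' ∈ F, (E c').indicator (fun _ => ENNReal.ofReal a) s ∂seedLaw d := by
        gcongr
        rw [lintegral_finsetSum _ fun c' _ => measurable_const.indicator (hEm c')]
        calc ENNReal.ofReal (β / 2) ≤ ENNReal.ofReal (∑ c' ∈ F, a * β) := by
              refine ENNReal.ofReal_le_ofReal ?_
              rw [Finset.sum_const, nsmul_eq_mul, ← mul_assoc, ha, div_eq_mul_one_div,
                mul_comm β]
              refine mul_le_mul_of_nonneg_right ?_ hβ
              rw [mul_one_div, div_le_div_iff₀ (by norm_num) (by positivity)]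
              linarith
          _ = ∑ c' ∈ F, ENNReal.ofReal (a * β) :=
              ENNReal.ofReal_sum_of_nonneg fun _ _ => by positivity
          _ ≤ _ := by
              refine Finset.sum_le_sum fun c' hc' => ?_
              rw [lintegral_indicator_const (hEm c'), ENNReal.ofReal_mul ha0]
              gcongr
              exact hsplit c' hc'
    _ = ∫⁻ s, (ENNReal.ofReal
        (Real.log (1 + (G ((sampleCut p m M s).side c M)).card)) +
        ∑ c' ∈ F, (E c').indicator (fun _ => ENNReal.ofReal a) s) ∂seedLaw d := by
        rw [lintegral_add_left hmeas]
    _ ≤ ∫⁻ _, ENNReal.ofReal (Real.log (1 + F.card)) ∂seedLaw d := by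
        refine lintegral_mono fun s => ?_
        set w := sampleCut p m M s
        set N' := (G (w.side c M)).card with hN'
        have hsum : ∑ c' ∈ F, (E c').indicator (fun _ => ENNReal.ofReal a) s =
            ENNReal.ofReal ((F.filter fun c' => w.Splits c c').card * a) := by
          rw [ENNReal.ofReal_mul (by positivity), ENNReal.ofReal_natCast, ← nsmul_eq_mul,
            ← Finset.sum_const, Finset.sum_filter]
          refine Finset.sum_congr rfl fun c' _ => ?_
          simp only [Set.indicator, hE, Set.mem_ofPred_eq, w]
        have hcard : N' + (F.filter fun c' => w.Splits c c').card ≤ F.card := by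
          rw [hN', ← Finset.card_union_of_disjoint]
          · exact Finset.card_le_card (Finset.union_subset (hG w).1 (Finset.filter_subset _ _))
          · refine Finset.disjoint_left.2 fun c' h1 h2 => ?_
            exact (hG w).2 c' h1 (Finset.mem_filter.1 h2).2
        rw [hsum, ← ENNReal.ofReal_add (Real.log_nonneg (by simp)) (by positivity)]
        refine ENNReal.ofReal_le_ofReal ?_
        have hcard' : (N' : ℝ) + (F.filter fun c' => w.Splits c c').card ≤ F.card := by
          exact_mod_cast hcard
        have hlog := Real.log_le_sub_one_of_pos
          (show (0 : ℝ) < (1 + N') / (1 + F.card) by positivity)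
        rw [Real.log_div (by positivity) (by positivity)] at hlog
        have h2 : (1 + N' : ℝ) / (1 + F.card) - 1 = (N' - F.card) * a := by
          rw [ha]; field_simp; ring
        rw [h2] at hlog
        have h3 : ((F.filter fun c' => w.Splits c c').card : ℝ) * a ≤ (F.card - N') * a :=
          mul_le_mul_of_nonneg_right (by linarith) ha0
        linarith
    _ = _ := by simp

open Classical in
/-- The relative weight `min 1 (2 ^ q H / (2 δ))`, where `H` is the distance from `x` to `T`, but
at least the distance from `x` to `c`. -/
noncomputable def sideWeight (p : ℝ) (q : ℕ) (x c : Point d) (δ : ℝ) (T : Finset (Point d)) : ℝ :=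
  if h : T.Nonempty then
    min 1 (2 ^ q * max (lpDist p x c) (T.inf' h (lpDist p x)) / (2 * δ))
  else 0

theorem exists_sideWeight_eq (q : ℕ) (x c : Point d) (δ : ℝ) {T : Finset (Point d)}
    (hT : T.Nonempty) : ∃ c₀ ∈ T, (∀ c' ∈ T, lpDist p x c₀ ≤ lpDist p x c') ∧
      sideWeight p q x c δ T = min 1 (2 ^ q * max (lpDist p x c) (lpDist p x c₀) / (2 * δ)) := by
  obtain ⟨c₀, hc₀, h⟩ := Finset.exists_mem_eq_inf' hT (lpDist p x)
  refine ⟨c₀, hc₀, fun c' hc' => ?_, ?_⟩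
  · rw [← h]; exact Finset.inf'_le _ hc'
  · rw [sideWeight, dif_pos hT, h]

theorem sideWeight_nonneg (q : ℕ) (x c : Point d) {δ : ℝ} (hδ : 0 ≤ δ) (T : Finset (Point d)) :
    0 ≤ sideWeight p q x c δ T := by
  unfold sideWeight
  split_ifs with h
  · have := lpDist_nonneg (p := p) x c
    have := this.trans (le_max_left _ (T.inf' h (lpDist p x)))
    positivity
  · exact le_rfl

theorem sideWeight_le_one (q : ℕ) (x c : Point d) (δ : ℝ) (T : Finset (Point d)) :
    sideWeight p q x c δ T ≤ 1 := by
  unfold sideWeight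
  split_ifs with h
  · exact min_le_left _ _
  · exact zero_le_one

/-- The drift of the crowd potential. -/
theorem lintegral_crowdPotential_add_le [NeZero d] (hp : 1 ≤ p) (q : ℕ) {m : Point d}
    {M : Finset (Point d)} (hR : 0 < radius p m M) {x c : Point d} (hc : c ∈ M)
    (hD : 0 < lpDist p x c) (hδ : lpDist p x c < radius p c M)
    (hRδ : radius p m M ≤ 2 * radius p c M) (i : Fin d) (ϑ : ℝ) :
    ∫⁻ s, crowdPotential p q x c (sideAt x i ϑ ((sampleCut p m M s).side c M))
        ((sampleCut p m M s).side c M) ∂seedLaw d +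
      ENNReal.ofReal ((1 / 8) ^ p / (4 * d) *
        sideWeight p q x c (radius p c M) (sideAt x i ϑ M)) ≤
    crowdPotential p q x c (sideAt x i ϑ M) M := by
  set δ := radius p c M with hδdef
  set R := radius p m M with hRdef
  set T := sideAt x i ϑ M with hTdef
  have hmono : ∀ s, crowdPotential p q x c (sideAt x i ϑ ((sampleCut p m M s).side c M))
      ((sampleCut p m M s).side c M) ≤ crowdPotential p q x c T M := fun s =>
    crowdPotential_mono q x c (sideAt_mono x i ϑ (Cut.side_subset _ _ _)) (Cut.side_subset _ _ _)
  -- With no center on the side of `x` there is no penalty to pay for, and monotonicity suffices.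
  rcases T.eq_empty_or_nonempty with hT | hT
  · have h0 : sideWeight p q x c δ T = 0 := by
      rw [sideWeight, dif_neg (by simp [hT])]
    rw [h0, mul_zero, ENNReal.ofReal_zero, add_zero]
    refine (lintegral_mono hmono).trans ?_
    simp
  obtain ⟨c₀, hc₀, hmin, hw⟩ := exists_sideWeight_eq (p := p) q x c δ hT
  have hc₀M : c₀ ∈ M := Finset.filter_subset _ _ hc₀
  set H := max (lpDist p x c) (lpDist p x c₀) with hH
  have hH0 : 0 < H := hD.trans_le (le_max_left _ _)
  have hδ0 : 0 < δ := hD.trans hδ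
  have hH2 : H < 2 * δ := by
    refine max_lt (by linarith) ?_
    have h1 := lpDist_triangle hp x c c₀
    have h2 := lpDist_le_radius (p := p) (m := c) hc₀M
    rw [lpDist_comm] at h2
    linarith
  -- J is the last scale whose crowd contains the centers farthest from `c`. It exists because H < 2
  -- * δ.
  obtain ⟨J, hJ1, hJ2⟩ : ∃ J : ℕ, 2 ^ J * H / 2 < δ ∧ δ ≤ 2 ^ J * H := by
    have hex : ∃ j : ℕ, δ ≤ 2 ^ j * H / 2 := by
      obtain ⟨j, hj⟩ := pow_unbounded_of_one_lt (2 * δ / H) (one_lt_two)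
      refine ⟨j, ?_⟩
      rw [div_lt_iff₀ hH0] at hj
      linarith
    classical
    have hspec := Nat.find_spec hex
    have hne : Nat.find hex ≠ 0 := by
      intro h0
      rw [h0] at hspec
      norm_num at hspec
      linarith
    obtain ⟨J, hJ⟩ := Nat.exists_eq_succ_of_ne_zero hne
    refine ⟨J, not_le.1 (Nat.find_min hex (by omega)), ?_⟩
    rw [hJ, Nat.succ_eq_add_one, pow_succ] at hspec
    linarith
  have hFne : (crowd p x c J T M).Nonempty := by
    obtain ⟨c', hc', h⟩ := exists_lpDist_eq_radius (p := p) c ⟨c, hc⟩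
    refine ⟨c', Finset.mem_filter.2 ⟨hc', c₀, hc₀, ?_⟩⟩
    rw [h]; exact hJ1
  have hd : (0 : ℝ) < d := Nat.cast_pos.2 (NeZero.pos d)
  -- Members of this crowd are farther than δ / 2 ≥ R / 4 from `c`. The splitting bound divides this
  -- by 2 * R, which gives the base 1 / 8.
  have hβ : ∀ c' ∈ crowd p x c J T M, ENNReal.ofReal ((1 / 8) ^ p / (2 * d)) ≤
      seedLaw d {s | (sampleCut p m M s).Splits c c'} := by
    intro c' hc'
    obtain ⟨hc'M, c'', hc'', hlt⟩ := Finset.mem_filter.1 hc'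
    refine le_trans (ENNReal.ofReal_le_ofReal ?_) (le_seedLaw_splits hp m hR hc hc'M)
    have h1 : H ≤ max (lpDist p x c) (lpDist p x c'') := max_le_max le_rfl (hmin c'' hc'')
    have h2 : (2 : ℝ) ^ J * H ≤ 2 ^ J * max (lpDist p x c) (lpDist p x c'') := by gcongr
    rw [lpDist_comm c' c] at hlt
    gcongr ?_ ^ p / _
    rw [le_div_iff₀ (by positivity), ← hRdef]
    linarith
  have hlog := lintegral_log_card_add_le (G := fun S => crowd p x c J (sideAt x i ϑ S) S)
    hFne (by positivity) hβ fun w =>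
      ⟨crowd_mono x c J (sideAt_mono x i ϑ (Cut.side_subset _ _ _)) (Cut.side_subset _ _ _),
        fun c' hc' => by
          have h1 := (Finset.mem_filter.1 (Finset.filter_subset _ _ hc')).2
          simp only [Cut.Splits, not_not]
          exact h1.symm⟩
  -- From 2 ^ J * H < 2 * δ: the weight of the scale J dominates the relative penalty of the split.
  have hwJ : sideWeight p q x c δ T ≤ scaleWeight q J := by
    rw [hw, scaleWeight]
    refine min_le_min le_rfl ?_
    rw [div_le_div_iff₀ (by positivity) (by positivity)]
    have : (2 : ℝ) ^ q * (2 ^ J * H) ≤ 2 ^ q * (2 * δ) :=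
      mul_le_mul_of_nonneg_left (by linarith) (by positivity)
    linarith
  have hmeasj : ∀ j, Measurable fun s : Seed d => ENNReal.ofReal (scaleWeight q j) *
      ENNReal.ofReal (Real.log (1 + (crowd p x c j
        (sideAt x i ϑ ((sampleCut p m M s).side c M)) ((sampleCut p m M s).side c M)).card)) :=
    fun j => ((countablyValued_side c M).comp_measurable (measurable_sampleCut p m M)).measurable
      fun S => ENNReal.ofReal (scaleWeight q j) *
        ENNReal.ofReal (Real.log (1 + (crowd p x c j (sideAt x i ϑ S) S).card))
  unfold crowdPotential
  rw [lintegral_tsum fun j => (hmeasj j).aemeasurable]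
  set e := ENNReal.ofReal ((1 / 8) ^ p / (4 * d) * sideWeight p q x c δ T) with he
  rw [← tsum_ite_eq J (fun _ => e), ← ENNReal.tsum_add]
  refine ENNReal.tsum_le_tsum fun j => ?_
  by_cases hj : j = J
  · subst hj
    rw [if_pos rfl, lintegral_const_mul' _ _ ENNReal.ofReal_ne_top]
    have he' : e ≤ ENNReal.ofReal (scaleWeight q j) *
        ENNReal.ofReal ((1 / 8) ^ p / (2 * d) / 2) := by
      rw [← ENNReal.ofReal_mul (scaleWeight_nonneg q j), he]
      refine ENNReal.ofReal_le_ofReal ?_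
      rw [mul_comm, div_div, show (2 * d * 2 : ℝ) = 4 * d by ring]
      gcongr
    calc _ ≤ _ := add_le_add le_rfl he'
      _ = _ := (mul_add _ _ _).symm
      _ ≤ _ := by gcongr
  -- Only the scale J is asked for a gain; at all others the crowds merely do not grow.
  · rw [if_neg hj, add_zero, lintegral_const_mul' _ _ ENNReal.ofReal_ne_top]
    gcongr
    refine (lintegral_mono (g := fun _ => ENNReal.ofReal
      (Real.log (1 + (crowd p x c j T M).card))) fun s => ?_).trans (by simp)
    refine ENNReal.ofReal_le_ofReal (Real.log_le_log (by positivity) ?_)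
    gcongr
    exact crowd_mono x c j (sideAt_mono x i ϑ (Cut.side_subset _ _ _)) (Cut.side_subset _ _ _)

/-- The expectation of a penalty for splitting `x` from `c`. -/
theorem lintegral_splits_le [NeZero d] (hp : 1 ≤ p) {m : Point d} {M : Finset (Point d)}
    (hR : 0 < radius p m M) (x c : Point d) {φ : Fin d → ℝ → ℝ≥0∞}
    (hφ : ∀ i, Measurable (φ i)) :
    ∫⁻ s, {w : Cut d | w.Splits x c}.indicator (fun w => φ w.1 w.2.2) (sampleCut p m M s)
        ∂seedLaw d ≤
      ENNReal.ofReal (1 / d) * ∑ i, ENNReal.ofReal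
        (p * (|c i - m i| + |x i - c i|) ^ (p - 1) / radius p m M ^ p) *
          ∫⁻ ϑ in Set.uIoc (x i) (c i), φ i ϑ := by
  have hd : (0 : ℝ) < d := Nat.cast_pos.2 (NeZero.pos d)
  have hind : ∀ i σ (u : unitInterval),
      {w : Cut d | w.Splits x c}.indicator (fun w => φ w.1 w.2.2) (sampleCut p m M (i, σ, u)) =
        (Set.uIoc (x i) (c i)).indicator (φ i) (thr p (radius p m M) (m i) σ u) := by
    intro i σ u
    rw [sampleCut_eq]
    set ϑ := thr p (radius p m M) (m i) σ u
    have hiff : (i, σ, ϑ) ∈ {w : Cut d | w.Splits x c} ↔ ϑ ∈ Set.uIoc (x i) (c i) := by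
      change ¬(x i < ϑ ↔ c i < ϑ) ↔ _
      rw [Set.mem_uIoc, ← not_lt, ← not_lt]
      tauto
    by_cases h : ϑ ∈ Set.uIoc (x i) (c i)
    · rw [Set.indicator_of_mem h, Set.indicator_of_mem (hiff.2 h)]
    · rw [Set.indicator_of_notMem h, Set.indicator_of_notMem fun h' => h (hiff.1 h')]
  have hmeas : Measurable fun s : Seed d =>
      {w : Cut d | w.Splits x c}.indicator (fun w => φ w.1 w.2.2) (sampleCut p m M s) := by
    refine measurable_seed fun i σ => ?_
    simp only [hind]
    exact ((hφ i).indicator measurableSet_uIoc).comp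
      ((measurable_thr _ _ _ _).comp measurable_subtype_coe)
  rw [lintegral_seedLaw hmeas]
  simp only [hind]
  have hY : ∀ i, ∀ ϑ ∈ Set.uIoc (x i) (c i), |ϑ - m i| ≤ |c i - m i| + |x i - c i| := by
    intro i ϑ hϑ
    have h1 : |ϑ - c i| ≤ |x i - c i| := by
      rw [abs_sub_comm ϑ, abs_sub_comm (x i)]
      exact Set.abs_sub_right_of_mem_uIcc (Set.uIoc_subset_uIcc hϑ)
    calc |ϑ - m i| = |(c i - m i) + (ϑ - c i)| := by ring_nf
      _ ≤ |c i - m i| + |ϑ - c i| := abs_add_le _ _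
      _ ≤ _ := by gcongr
  calc _ ≤ ENNReal.ofReal (1 / (2 * d)) * ∑ i, ∑ _σ : Bool, ENNReal.ofReal
        (p * (|c i - m i| + |x i - c i|) ^ (p - 1) / radius p m M ^ p) *
          ∫⁻ ϑ in Set.uIoc (x i) (c i), φ i ϑ := by
        gcongr with i _ σ _
        exact lintegral_thr_le hp hR σ measurableSet_uIoc (hY i) _
    _ = _ := by
        simp only [Finset.sum_const, Finset.card_univ, Fintype.card_bool, ← Finset.smul_sum]
        rw [nsmul_eq_mul, ← mul_assoc]
        congr 1
        rw [Nat.cast_ofNat, ← ENNReal.ofReal_ofNat, ← ENNReal.ofReal_mul (by positivity)]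
        congr 1
        field_simp

end Potential

/-! ### Elementary estimates -/

theorem mul_rpow_sub_one_eq {t p : ℝ} (hp : 1 ≤ p) (ht : 0 ≤ t) : t * t ^ (p - 1) = t ^ p := by
  have hp0 : p ≠ 0 := by linarith
  rcases ht.eq_or_lt with rfl | ht
  · simp [Real.zero_rpow hp0]
  · rw [mul_comm, ← Real.rpow_add_one ht.ne', sub_add_cancel]

/-- With t = max(b, a/16) the left side is at most 16 t^p. The unequal weighting by 16 leaves room
for a factor p ≤ 2^p next to the splitting probability 8^(-p). -/
theorem mul_rpow_sub_one_le {a b p : ℝ} (hp : 1 ≤ p) (ha : 0 ≤ a) (hb : 0 ≤ b) :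
    a * b ^ (p - 1) ≤ 16 * (b ^ p + (a / 16) ^ p) := by
  set t := max b (a / 16) with ht
  have ht0 : 0 ≤ t := hb.trans (le_max_left _ _)
  have h1 : a ≤ 16 * t := by have := le_max_right b (a / 16); rw [← ht] at this; linarith
  have h2 : b ^ (p - 1) ≤ t ^ (p - 1) :=
    Real.rpow_le_rpow hb (le_max_left _ _) (by linarith)
  have h3 : t ^ p ≤ b ^ p + (a / 16) ^ p := by
    have := Real.rpow_nonneg hb p
    have := Real.rpow_nonneg (show 0 ≤ a / 16 by positivity) p
    rcases max_cases b (a / 16) with ⟨h, _⟩ | ⟨h, _⟩ <;> rw [ht, h] <;> linarith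
  calc a * b ^ (p - 1) ≤ 16 * t * t ^ (p - 1) :=
        mul_le_mul h1 h2 (Real.rpow_nonneg hb _) (by positivity)
    _ = 16 * t ^ p := by rw [mul_assoc, mul_rpow_sub_one_eq hp ht0]
    _ ≤ _ := by linarith

theorem one_add_one_div_rpow_le {p : ℝ} (hp : 1 ≤ p) : (1 + 1 / p) ^ (p - 1) ≤ 3 := by
  have hp0 : 0 < p := by linarith
  have h1 : 1 + 1 / p ≤ Real.exp (1 / p) := by have := Real.add_one_le_exp (1 / p); linarith
  calc (1 + 1 / p) ^ (p - 1) ≤ Real.exp (1 / p) ^ (p - 1) :=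
        Real.rpow_le_rpow (by positivity) h1 (by linarith)
    _ = Real.exp (1 / p * (p - 1)) := (Real.exp_mul _ _).symm
    _ ≤ Real.exp 1 := by
        refine Real.exp_le_exp.2 ?_
        rw [mul_sub, one_div_mul_cancel hp0.ne']
        have : 0 < 1 / p := by positivity
        linarith
    _ ≤ 3 := by have := Real.exp_one_lt_d9; linarith

/-- Either r D ≤ y / p, and the shift enlarges the power by a factor of at most 3, or y + r D ≤ 2 p
r D, which the lower bound on w turns into at most r w R / 16. -/
theorem split_weight_le {p r w y D R : ℝ} (hp : 1 ≤ p) (hr : 0 ≤ r) (hw : 0 ≤ w) (hy : 0 ≤ y)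
    (hD : 0 ≤ D) (hR : 0 < R) (hwD : 32 * p * D / R ≤ w) :
    r * w * ((y + r * D) / R) ^ (p - 1) ≤ 48 * ((y / R) ^ p + (r * w / 16) ^ p) := by
  have hp0 : 0 < p := by linarith
  have hrw : 0 ≤ r * w := mul_nonneg hr hw
  have hrD : 0 ≤ r * D := mul_nonneg hr hD
  have hA : 0 ≤ (y / R) ^ p := by positivity
  have hB : 0 ≤ (r * w / 16) ^ p := by positivity
  rcases le_total (r * D) (y / p) with h | h
  · have h1 : (y + r * D) / R ≤ (1 + 1 / p) * (y / R) := by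
      rw [div_le_iff₀ hR]
      have : (1 + 1 / p) * (y / R) * R = y + y / p := by field_simp
      linarith
    calc r * w * ((y + r * D) / R) ^ (p - 1)
        ≤ r * w * ((1 + 1 / p) * (y / R)) ^ (p - 1) := by
          gcongr
      _ = (1 + 1 / p) ^ (p - 1) * (r * w * (y / R) ^ (p - 1)) := by
          rw [Real.mul_rpow (by positivity) (by positivity)]; ring
      _ ≤ 3 * (16 * ((y / R) ^ p + (r * w / 16) ^ p)) :=
          mul_le_mul (one_add_one_div_rpow_le hp)
            (mul_rpow_sub_one_le hp hrw (by positivity)) (by positivity) (by norm_num)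
      _ = _ := by ring
  · have h1 : (y + r * D) / R ≤ r * w / 16 := by
      have h2 : y ≤ p * (r * D) := by rwa [div_le_iff₀ hp0, mul_comm] at h
      have h3 : r * D ≤ p * (r * D) := by nlinarith
      have h4 : r * (32 * p * D / R) ≤ r * w := by gcongr
      rw [div_le_iff₀ hR]
      have h5 : r * (32 * p * D / R) * R = 32 * (p * (r * D)) := by field_simp
      have h6 : r * (32 * p * D / R) * R ≤ r * w * R := by gcongr
      linarith
    calc r * w * ((y + r * D) / R) ^ (p - 1) ≤ 16 * (r * w / 16 * (r * w / 16) ^ (p - 1)) := by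
          have := Real.rpow_le_rpow (by positivity) h1 (show 0 ≤ p - 1 by linarith)
          have := mul_le_mul_of_nonneg_left this hrw
          linarith
      _ = 16 * (r * w / 16) ^ p := by rw [mul_rpow_sub_one_eq hp (by positivity)]
      _ ≤ _ := by linarith

theorem self_le_two_rpow {p : ℝ} (hp : 1 ≤ p) : p ≤ 2 ^ p := by
  have := one_add_mul_self_le_rpow_one_add (show (-1 : ℝ) ≤ 1 by norm_num) hp
  norm_num at this
  linarith

/-- The density of the penalty for splitting `x` from `c` in one coordinate. -/
theorem split_penalty_le {p r w y D R δ : ℝ} (hp : 1 ≤ p) (hr : 0 < r) (hw : 0 ≤ w)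
    (hw1 : w ≤ 1) (hy : 0 ≤ y) (hD : 0 ≤ D) (hR : 0 < R) (hδ : δ ≤ 2 * R)
    (hwD : 32 * p * D / R ≤ w) :
    p * (y + r * D) ^ (p - 1) / R ^ p * (2 * δ * w) ≤
      192 * p * (y / R) ^ p / r + 192 * (1 / 8) ^ p * r ^ (p - 1) * w := by
  have hp0 : 0 < p := by linarith
  have hRp : R ^ p = R * R ^ (p - 1) := (mul_rpow_sub_one_eq hp hR.le).symm
  have hR1 : 0 < R ^ (p - 1) := Real.rpow_pos_of_pos hR _
  have hb : 0 ≤ ((y + r * D) / R) ^ (p - 1) := by positivity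
  have h1 : p * (y + r * D) ^ (p - 1) / R ^ p * (2 * δ * w) ≤
      4 * p * (w * ((y + r * D) / R) ^ (p - 1)) := by
    rw [Real.div_rpow (by positivity) hR.le, hRp]
    have h2 : p * (y + r * D) ^ (p - 1) / (R * R ^ (p - 1)) * (2 * δ * w) =
        (2 * δ / R) * (p * (w * ((y + r * D) ^ (p - 1) / R ^ (p - 1)))) := by
      field_simp
    rw [h2]
    have h3 : 2 * δ / R ≤ 4 := by rw [div_le_iff₀ hR]; linarith
    have h4 : 0 ≤ p * (w * ((y + r * D) ^ (p - 1) / R ^ (p - 1))) := by positivity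
    nlinarith
  have h5 := split_weight_le hp hr.le hw hy hD hR hwD
  -- Here p ≤ 2^p turns p 16^(-p) into at most 8^(-p), and w ≤ 1 turns w^p into at most w.
  have h6 : p * (r * w / 16) ^ p ≤ (1 / 8) ^ p * r ^ p * w := by
    have e1 : (r * w / 16) ^ p = r ^ p * w ^ p * (1 / 16) ^ p := by
      rw [div_eq_mul_one_div, Real.mul_rpow (by positivity) (by norm_num),
        Real.mul_rpow hr.le hw]
    have e2 : (1 / 8 : ℝ) ^ p = 2 ^ p * (1 / 16) ^ p := by
      rw [← Real.mul_rpow (by norm_num) (by norm_num)]; norm_num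
    have e3 : w ^ p ≤ w := by
      have := Real.rpow_le_rpow_of_exponent_ge' hw hw1 zero_le_one hp
      rwa [Real.rpow_one] at this
    have e4 := self_le_two_rpow hp
    rw [e1, e2]
    have e5 : 0 ≤ r ^ p * (1 / 16) ^ p := by positivity
    have e6 : p * w ^ p ≤ 2 ^ p * w := mul_le_mul e4 e3 (by positivity) (by positivity)
    nlinarith
  have h7 : w * ((y + r * D) / R) ^ (p - 1) ≤
      48 * ((y / R) ^ p + (r * w / 16) ^ p) / r := by
    rw [le_div_iff₀ hr]; linarith
  have h8 : r ^ (p - 1) = r ^ p / r := by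
    rw [eq_div_iff hr.ne', mul_comm, mul_rpow_sub_one_eq hp hr.le]
  calc _ ≤ 4 * p * (48 * ((y / R) ^ p + (r * w / 16) ^ p) / r) := by
        refine h1.trans ?_; gcongr
    _ = 192 * p * (y / R) ^ p / r + 192 * (p * (r * w / 16) ^ p) / r := by ring
    _ ≤ 192 * p * (y / R) ^ p / r + 192 * ((1 / 8) ^ p * r ^ p * w) / r := by gcongr
    _ = _ := by rw [h8]; ring

section Value

variable {d : ℕ} {p : ℝ}

/-- For D > 0 each summand is D times the p-th power of a ratio, and these powers sum to 1.
Weighting the coordinates in this way makes the potential proportional to the ℓ_p distance rather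
than the ℓ_1 distance. -/
theorem sum_ratio_rpow_mul (hp : 1 ≤ p) (x c : Point d) :
    ∑ i, (|x i - c i| / lpDist p x c) ^ (p - 1) * |x i - c i| = lpDist p x c := by
  rcases (lpDist_nonneg (p := p) x c).eq_or_lt with h | h
  · have hx := eq_of_lpDist_eq_zero hp h.symm
    subst hx
    simp [lpDist_self hp]
  · have h1 : ∀ i, (|x i - c i| / lpDist p x c) ^ (p - 1) * |x i - c i| =
        lpDist p x c * (|x i - c i| ^ p / lpDist p x c ^ p) := by
      intro i
      rw [← Real.div_rpow (abs_nonneg _) h.le,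
        ← mul_rpow_sub_one_eq hp (div_nonneg (abs_nonneg _) h.le)]
      field_simp
    simp_rw [h1]
    rw [← Finset.mul_sum, ← Finset.sum_div, ← lpDist_rpow hp,
      div_self (Real.rpow_pos_of_pos h p).ne', mul_one]

/-- The potential of the cell `M` of the call on `Cu` with respect to the center `c` of `x`. -/
noncomputable def potential (p : ℝ) (q : ℕ) (x c : Point d) (Cu M : Finset (Point d)) : ℝ≥0∞ :=
  ENNReal.ofReal (3072 * p * lpDist p x c * Real.log Cu.card) +
    ∑ i, ENNReal.ofReal (768 * (|x i - c i| / lpDist p x c) ^ (p - 1)) *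
      ∫⁻ ϑ in Set.uIoc (x i) (c i), crowdPotential p q x c (sideAt x i ϑ M) M

/-- The bound on the expected cost of `x` that is obtained from the center `c`. -/
noncomputable def valueAt (p : ℝ) (q : ℕ) (x c : Point d) (Cu M : Finset (Point d)) : ℝ≥0∞ :=
  ENNReal.ofReal (65 * p * lpDist p x c) + potential p q x c Cu M

/-- The bound on the expected cost of `x` when it lies in the cell `M` of the call on `Cu`. -/
noncomputable def value (p : ℝ) (q : ℕ) (x : Point d) (Cu M : Finset (Point d)) : ℝ≥0∞ :=
  (⨆ c ∈ M, ENNReal.ofReal (lpDist p x c)) ⊓ ⨅ c ∈ M, valueAt p q x c Cu M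

theorem value_le_valueAt (q : ℕ) (x : Point d) {c : Point d} {Cu M : Finset (Point d)}
    (hc : c ∈ M) : value p q x Cu M ≤ valueAt p q x c Cu M :=
  inf_le_right.trans (iInf₂_le c hc)

theorem value_le_ofReal (q : ℕ) (x : Point d) {Cu M : Finset (Point d)} {B : ℝ}
    (h : ∀ c ∈ M, lpDist p x c ≤ B) : value p q x Cu M ≤ ENNReal.ofReal B :=
  inf_le_left.trans (iSup₂_le fun c hc => ENNReal.ofReal_le_ofReal (h c hc))

theorem potential_mono (hp : 1 ≤ p) (q : ℕ) (x c : Point d) {Cu Cu' M M' : Finset (Point d)}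
    (hCu : Cu ⊆ Cu') (hM : M ⊆ M') (hne : Cu.Nonempty) :
    potential p q x c Cu M ≤ potential p q x c Cu' M' := by
  have := lpDist_nonneg (p := p) x c
  have hpos : (0 : ℝ) < Cu.card := by exact_mod_cast Finset.card_pos.2 hne
  unfold potential
  gcongr
  exact crowdPotential_mono q x c (sideAt_mono x _ _ hM) hM

theorem value_mono_left (hp : 1 ≤ p) (q : ℕ) (x : Point d) {Cu Cu' M : Finset (Point d)}
    (hCu : Cu ⊆ Cu') (hne : Cu.Nonempty) : value p q x Cu M ≤ value p q x Cu' M := by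
  unfold value valueAt
  gcongr
  exact potential_mono hp q x _ hCu (Finset.Subset.refl _) hne

/-- The condition under which the value is at most `2 ^ q` times the distance to any center. -/
def ScaleBound (p : ℝ) (q k : ℕ) : Prop :=
  65 * p + 3072 * p * Real.log k + 768 * ((q + 2) * Real.log (1 + k)) ≤ 2 ^ q

/-- This closes the bootstrap: 2^q enters the weights of the scales, and `ScaleBound` makes the
resulting bound at most 2^q again. -/
theorem valueAt_le (hp : 1 ≤ p) {q k : ℕ} (hq : ScaleBound p q k) (x c : Point d)
    {Cu M : Finset (Point d)} (hM : M ⊆ Cu) (hne : Cu.Nonempty) (hk : Cu.card ≤ k) :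
    valueAt p q x c Cu M ≤ ENNReal.ofReal (2 ^ q * lpDist p x c) := by
  have hD := lpDist_nonneg (p := p) x c
  have hpos : (0 : ℝ) < Cu.card := by exact_mod_cast Finset.card_pos.2 hne
  have hL : 0 ≤ (q + 2) * Real.log (1 + k) := by
    have := Real.log_nonneg (show (1 : ℝ) ≤ 1 + k by simp)
    positivity
  have hcrowd : ∀ i, ∫⁻ ϑ in Set.uIoc (x i) (c i), crowdPotential p q x c (sideAt x i ϑ M) M ≤
      ENNReal.ofReal (((q + 2) * Real.log (1 + k)) * |x i - c i|) := by
    intro i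
    calc _ ≤ ∫⁻ _ in Set.uIoc (x i) (c i), ENNReal.ofReal ((q + 2) * Real.log (1 + k)) :=
          lintegral_mono fun ϑ => crowdPotential_le q x c ((Finset.card_le_card hM).trans hk)
      _ = _ := by
          rw [setLIntegral_const, Real.volume_uIoc, abs_sub_comm, ENNReal.ofReal_mul hL]
  unfold valueAt potential
  calc _ ≤ ENNReal.ofReal (65 * p * lpDist p x c) +
        (ENNReal.ofReal (3072 * p * lpDist p x c * Real.log k) +
        ∑ i, ENNReal.ofReal (768 * (|x i - c i| / lpDist p x c) ^ (p - 1)) *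
          ENNReal.ofReal (((q + 2) * Real.log (1 + k)) * |x i - c i|)) := by
        gcongr with i
        exact hcrowd i
    _ = ENNReal.ofReal (65 * p * lpDist p x c) +
        (ENNReal.ofReal (3072 * p * lpDist p x c * Real.log k) +
        ENNReal.ofReal (768 * ((q + 2) * Real.log (1 + k)) * lpDist p x c)) := by
        congr 2
        conv_rhs => rw [← sum_ratio_rpow_mul hp x c, Finset.mul_sum]
        rw [ENNReal.ofReal_sum_of_nonneg fun i _ => by positivity]
        refine Finset.sum_congr rfl fun i _ => ?_
        rw [← ENNReal.ofReal_mul (by positivity)]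
        congr 1
        ring
    _ = ENNReal.ofReal ((65 * p + 3072 * p * Real.log k + 768 * ((q + 2) * Real.log (1 + k))) *
          lpDist p x c) := by
        have := Real.log_natCast_nonneg k
        rw [← ENNReal.ofReal_add (by positivity) (by positivity),
          ← ENNReal.ofReal_add (by positivity) (by positivity)]
        congr 1
        ring
    _ ≤ _ := ENNReal.ofReal_le_ofReal (mul_le_mul_of_nonneg_right hq hD)

/-! ### The drift of the value -/

theorem measurable_sideWeight_sideAt (q : ℕ) (x c : Point d) (δ : ℝ) (i : Fin d)
    (M : Finset (Point d)) : Measurable fun ϑ => sideWeight p q x c δ (sideAt x i ϑ M) :=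
  (countablyValued_sideAt x i M).measurable fun T => sideWeight p q x c δ T

/-- The prospective threshold ϑ stays fixed while the actual cut is random, so by Tonelli the drift
for each single ϑ can be integrated over `I`. -/
theorem lintegral_setLIntegral_crowdPotential_le [NeZero d] (hp : 1 ≤ p) (q : ℕ) {m : Point d}
    {M : Finset (Point d)} (hR : 0 < radius p m M) {x c : Point d} (hc : c ∈ M)
    (hD : 0 < lpDist p x c) (hδ : lpDist p x c < radius p c M)
    (hRδ : radius p m M ≤ 2 * radius p c M) (i : Fin d) (I : Set ℝ) :
    ∫⁻ s, (∫⁻ ϑ in I, crowdPotential p q x c (sideAt x i ϑ ((sampleCut p m M s).side c M))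
        ((sampleCut p m M s).side c M)) ∂seedLaw d +
      ∫⁻ ϑ in I, ENNReal.ofReal ((1 / 8) ^ p / (4 * d) *
        sideWeight p q x c (radius p c M) (sideAt x i ϑ M)) ≤
    ∫⁻ ϑ in I, crowdPotential p q x c (sideAt x i ϑ M) M := by
  have hmeas : Measurable fun z : Seed d × ℝ =>
      crowdPotential p q x c (sideAt x i z.2 ((sampleCut p m M z.1).side c M))
        ((sampleCut p m M z.1).side c M) := by
    have h1 := ((countablyValued_side c M).comp_measurable (measurable_sampleCut p m M)
      ).comp_measurable (measurable_fst (α := Seed d) (β := ℝ))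
    exact (h1.bind (W := fun S z => (S, sideAt x i z.2 S)) fun S =>
      ((countablyValued_sideAt x i S).comp_measurable measurable_snd).comp
        fun T => (S, T)).measurable fun q' => crowdPotential p q x c q'.2 q'.1
  rw [lintegral_lintegral_swap hmeas.aemeasurable, ← lintegral_add_right _
    ((measurable_sideWeight_sideAt q x c _ i M).const_mul _).ennreal_ofReal]
  exact lintegral_mono fun ϑ =>
    lintegral_crowdPotential_add_le hp q hR hc hD hδ hRδ i ϑ

/-- The expected penalty for splitting `x` from `c` in one iteration. -/
theorem lintegral_split_penalty_le [NeZero d] (hp : 1 ≤ p) {q : ℕ} (hqp : 128 * p ≤ 2 ^ q)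
    {m : Point d} {M : Finset (Point d)} (hR : 0 < radius p m M) {x c : Point d} (hc : c ∈ M)
    (hD : 0 < lpDist p x c) (hδ : 64 * p * lpDist p x c < radius p c M) :
    ∫⁻ s, {w : Cut d | w.Splits x c}.indicator (fun w => ENNReal.ofReal (2 * radius p c M *
        sideWeight p q x c (radius p c M) (sideAt x w.1 w.2.2 M))) (sampleCut p m M s)
        ∂seedLaw d ≤
      ENNReal.ofReal (192 * p * lpDist p x c / d * (lpDist p c m / radius p m M) ^ p) +
        ∑ i, ENNReal.ofReal (768 * (|x i - c i| / lpDist p x c) ^ (p - 1)) *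
          ∫⁻ ϑ in Set.uIoc (x i) (c i), ENNReal.ofReal ((1 / 8) ^ p / (4 * d) *
            sideWeight p q x c (radius p c M) (sideAt x i ϑ M)) := by
  set δ := radius p c M with hδdef
  set R := radius p m M with hRdef
  set D := lpDist p x c with hDdef
  have hd : (0 : ℝ) < d := Nat.cast_pos.2 (NeZero.pos d)
  have hp0 : 0 < p := by linarith
  have hδR : δ ≤ 2 * R := by
    obtain ⟨c', hc', h⟩ := exists_lpDist_eq_radius (p := p) c ⟨c, hc⟩
    have h1 := lpDist_triangle hp c' m c
    have h2 := lpDist_le_radius (p := p) (m := m) hc'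
    have h3 := lpDist_le_radius (p := p) (m := m) hc
    rw [lpDist_comm m c] at h1
    linarith
  have hδ0 : 0 < δ := lt_trans (by positivity) hδ
  refine (lintegral_splits_le hp hR x c (φ := fun i ϑ => ENNReal.ofReal (2 * δ *
    sideWeight p q x c δ (sideAt x i ϑ M))) fun i =>
      ((measurable_sideWeight_sideAt q x c δ i M).const_mul _).ennreal_ofReal).trans ?_
  have hpt : ∀ i, ∀ ϑ ∈ Set.uIoc (x i) (c i),
      ENNReal.ofReal (p * (|c i - m i| + |x i - c i|) ^ (p - 1) / R ^ p) *
        ENNReal.ofReal (2 * δ * sideWeight p q x c δ (sideAt x i ϑ M)) ≤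
      ENNReal.ofReal (192 * p * (|c i - m i| / R) ^ p / (|x i - c i| / D)) +
        ENNReal.ofReal (192 * (|x i - c i| / D) ^ (p - 1)) *
          ENNReal.ofReal ((1 / 8) ^ p *
            sideWeight p q x c δ (sideAt x i ϑ M)) := by
    intro i ϑ hϑ
    set T := sideAt x i ϑ M with hT
    have hne : x i ≠ c i := by
      intro h
      simp [h] at hϑ
    have hr : 0 < |x i - c i| / D := div_pos (abs_pos.2 (sub_ne_zero.2 hne)) hD
    have hrD : |x i - c i| = |x i - c i| / D * D := by field_simp
    have hw0 := sideWeight_nonneg (p := p) q x c hδ0.le T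
    rcases T.eq_empty_or_nonempty with hTe | hTn
    · have h0 : sideWeight p q x c δ T = 0 := by rw [sideWeight, dif_neg (by simp [hTe])]
      rw [h0]; simp
    -- This is why `sideWeight` never uses a distance below D. The entry 1 is handled by 64 p D < δ
    -- ≤ 2R, the other entry by 128 p ≤ 2^q.
    have hwD : 32 * p * D / R ≤ sideWeight p q x c δ T := by
      obtain ⟨c₀, _, _, hw⟩ := exists_sideWeight_eq (p := p) q x c δ hTn
      rw [hw]
      refine le_min ?_ ?_
      · rw [div_le_one hR]; linarith
      · have hH : D ≤ max (lpDist p x c) (lpDist p x c₀) := le_max_left _ _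
        rw [div_le_div_iff₀ hR (by positivity)]
        calc 32 * p * D * (2 * δ) ≤ 32 * p * D * (2 * (2 * R)) := by gcongr
          _ = 128 * p * D * R := by ring
          _ ≤ _ := by gcongr
    rw [← ENNReal.ofReal_mul (by positivity), ← ENNReal.ofReal_mul (by positivity),
      ← ENNReal.ofReal_add (by positivity) (by positivity)]
    refine ENNReal.ofReal_le_ofReal ?_
    have := split_penalty_le (y := |c i - m i|) hp hr hw0 (sideWeight_le_one q x c δ T)
      (abs_nonneg _) hD.le hR hδR hwD
    rw [← hrD] at this
    linarith
  have hint : ∀ i, ENNReal.ofReal (p * (|c i - m i| + |x i - c i|) ^ (p - 1) / R ^ p) *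
        ∫⁻ ϑ in Set.uIoc (x i) (c i),
          ENNReal.ofReal (2 * δ * sideWeight p q x c δ (sideAt x i ϑ M)) ≤
      ENNReal.ofReal (192 * p * D * (|c i - m i| ^ p / R ^ p)) +
        ENNReal.ofReal (192 * (|x i - c i| / D) ^ (p - 1)) *
          ∫⁻ ϑ in Set.uIoc (x i) (c i), ENNReal.ofReal ((1 / 8) ^ p *
            sideWeight p q x c δ (sideAt x i ϑ M)) := by
    intro i
    rw [← lintegral_const_mul' _ _ ENNReal.ofReal_ne_top]
    refine (setLIntegral_mono' measurableSet_uIoc (hpt i)).trans ?_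
    rw [lintegral_add_left measurable_const, lintegral_const_mul' _ _ ENNReal.ofReal_ne_top,
      setLIntegral_const, Real.volume_uIoc, ← ENNReal.ofReal_mul (by positivity)]
    refine add_le_add (ENNReal.ofReal_le_ofReal ?_) le_rfl
    -- The division by |x_i - c_i| / D is compensated by the length |x_i - c_i| of the interval,
    -- leaving D. An empty interval contributes nothing.
    rcases eq_or_ne (x i) (c i) with h | h
    · simp only [h, sub_self, abs_zero, mul_zero]; positivity
    · have h1 : |x i - c i| ≠ 0 := abs_ne_zero.2 (sub_ne_zero.2 h)
      rw [abs_sub_comm (c i) (x i), Real.div_rpow (abs_nonneg _) hR.le]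
      refine le_of_eq ?_
      field_simp
  calc _ ≤ ENNReal.ofReal (1 / d) * ∑ i,
        (ENNReal.ofReal (192 * p * D * (|c i - m i| ^ p / R ^ p)) +
        ENNReal.ofReal (192 * (|x i - c i| / D) ^ (p - 1)) *
          ∫⁻ ϑ in Set.uIoc (x i) (c i), ENNReal.ofReal ((1 / 8) ^ p *
            sideWeight p q x c δ (sideAt x i ϑ M))) := by
        gcongr with i
        exact hint i
    _ = _ := by
        rw [Finset.sum_add_distrib, mul_add]
        congr 1
        · rw [← ENNReal.ofReal_sum_of_nonneg fun i _ => by positivity,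
            ← ENNReal.ofReal_mul (by positivity), ← Finset.mul_sum, ← Finset.sum_div,
            ← lpDist_rpow hp, ← Real.div_rpow (lpDist_nonneg _ _) hR.le]
          congr 1
          ring
        -- The coefficient 768 is 4 * 192, which offsets the 4 in the drift of the crowd potential.
        · rw [Finset.mul_sum]
          refine Finset.sum_congr rfl fun i _ => ?_
          rw [← lintegral_const_mul' _ _ ENNReal.ofReal_ne_top,
            ← lintegral_const_mul' _ _ ENNReal.ofReal_ne_top,
            ← lintegral_const_mul' _ _ ENNReal.ofReal_ne_top]
          refine lintegral_congr fun ϑ => ?_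
          rw [← ENNReal.ofReal_mul (by positivity), ← ENNReal.ofReal_mul (by positivity),
            ← ENNReal.ofReal_mul (by positivity)]
          congr 1
          ring

end Value

/-! ### The value is a supermartingale -/

section Drift

variable {d : ℕ} {p : ℝ}

theorem measurable_setLIntegral_crowdPotential (q : ℕ) (x c : Point d) (i : Fin d) (I : Set ℝ)
    (m : Point d) (M : Finset (Point d)) : Measurable fun s : Seed d =>
      ∫⁻ ϑ in I, crowdPotential p q x c (sideAt x i ϑ ((sampleCut p m M s).side c M))
        ((sampleCut p m M s).side c M) :=
  ((countablyValued_side c M).comp_measurable (measurable_sampleCut p m M)).measurable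
    fun S => ∫⁻ ϑ in I, crowdPotential p q x c (sideAt x i ϑ S) S

theorem measurable_log_card_nextPair (A : ℝ) (y : Point d) (Cu : Finset (Point d))
    (m : Point d) (M : Finset (Point d)) : Measurable fun s : Seed d =>
      ENNReal.ofReal (A * Real.log (nextPair (sampleCut p m M s) y Cu M).1.card) :=
  ((countablyValued_nextPair y Cu M).comp_measurable (measurable_sampleCut p m M)).measurable
    fun q => ENNReal.ofReal (A * Real.log q.1.card)

theorem lintegral_potential_nextPair [NeZero d] (q : ℕ) (x c : Point d) (m : Point d)
    (Cu : Finset (Point d)) {M : Finset (Point d)} (hc : c ∈ M) :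
    ∫⁻ s, potential p q x c (nextPair (sampleCut p m M s) c Cu M).1
        (nextPair (sampleCut p m M s) c Cu M).2 ∂seedLaw d =
      ∫⁻ s, ENNReal.ofReal (3072 * p * lpDist p x c *
          Real.log (nextPair (sampleCut p m M s) c Cu M).1.card) ∂seedLaw d +
        ∑ i, ENNReal.ofReal (768 * (|x i - c i| / lpDist p x c) ^ (p - 1)) *
          ∫⁻ s, (∫⁻ ϑ in Set.uIoc (x i) (c i),
            crowdPotential p q x c (sideAt x i ϑ ((sampleCut p m M s).side c M))
              ((sampleCut p m M s).side c M)) ∂seedLaw d := by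
  simp only [potential, nextPair_snd_eq_side _ Cu hc]
  rw [lintegral_add_left (measurable_log_card_nextPair _ _ _ _ _), lintegral_finsetSum]
  · congr 1
    refine Finset.sum_congr rfl fun i _ => ?_
    rw [lintegral_const_mul' _ _ ENNReal.ofReal_ne_top]
  · exact fun i _ => (measurable_setLIntegral_crowdPotential q x c i _ m M).const_mul _

/-- The drift of the potential compensates for the expected penalty. -/
theorem lintegral_potential_add_penalty_le [NeZero d] (hp : 1 ≤ p) {q : ℕ}
    (hqp : 128 * p ≤ 2 ^ q) {m : Point d} {Cu M : Finset (Point d)} (hB : Balanced m Cu M)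
    {x c : Point d} (hc : c ∈ M) (hD : 0 < lpDist p x c)
    (hδ : 64 * p * lpDist p x c < radius p c M) :
    ∫⁻ s, potential p q x c (nextPair (sampleCut p m M s) c Cu M).1
        (nextPair (sampleCut p m M s) c Cu M).2 ∂seedLaw d +
      ∫⁻ s, {w : Cut d | w.Splits x c}.indicator (fun w => ENNReal.ofReal (2 * radius p c M *
        sideWeight p q x c (radius p c M) (sideAt x w.1 w.2.2 M))) (sampleCut p m M s)
        ∂seedLaw d ≤
    potential p q x c Cu M := by
  have hp0 : 0 < p := by linarith
  have hR := hB.radius_pos hp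
  have hd : (0 : ℝ) < d := Nat.cast_pos.2 (NeZero.pos d)
  have hδ0 : 0 < radius p c M := lt_trans (by positivity) hδ
  have hpen := lintegral_split_penalty_le hp hqp hR hc hD hδ
  have hlog := hB.lintegral_log_card_le hp hc
    (show 0 ≤ 3072 * p * lpDist p x c by positivity)
  have hδ' : lpDist p x c < radius p c M := by
    refine lt_of_le_of_lt ?_ hδ
    nlinarith
  rw [lintegral_potential_nextPair q x c m Cu hc]
  set L := ∫⁻ s, ENNReal.ofReal (3072 * p * lpDist p x c *
    Real.log (nextPair (sampleCut p m M s) c Cu M).1.card) ∂seedLaw d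
  set Y := (lpDist p c m / radius p m M) ^ p with hY
  have hY0 : 0 ≤ Y := Real.rpow_nonneg (div_nonneg (lpDist_nonneg _ _) hR.le) _
  set V : Fin d → ℝ≥0∞ := fun i => ∫⁻ s, (∫⁻ ϑ in Set.uIoc (x i) (c i),
    crowdPotential p q x c (sideAt x i ϑ ((sampleCut p m M s).side c M))
      ((sampleCut p m M s).side c M)) ∂seedLaw d with hV
  set W : Fin d → ℝ≥0∞ := fun i => ∫⁻ ϑ in Set.uIoc (x i) (c i),
    ENNReal.ofReal ((1 / 8) ^ p / (4 * d) *
      sideWeight p q x c (radius p c M) (sideAt x i ϑ M)) with hW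
  -- The coefficient 3072 = 8 * 2 * 192 makes the logarithmic drift twice the first part of the
  -- penalty. The spare half is spent only when `c` is far from the anchor.
  have hYd : 3072 * p * lpDist p x c / (8 * d) * Y =
      192 * p * lpDist p x c / d * Y + 192 * p * lpDist p x c / d * Y := by
    field_simp; ring
  have hYnn : 0 ≤ 192 * p * lpDist p x c / d * Y := by positivity
  rw [hYd, ENNReal.ofReal_add hYnn hYnn] at hlog
  set E := ENNReal.ofReal (192 * p * lpDist p x c / d * Y) with hE
  set r : Fin d → ℝ := fun i => |x i - c i| / lpDist p x c with hr
  -- If R ≤ 2δ, the crowds pay for the second part of the penalty. Otherwise the triangle inequality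
  -- gives ‖c - m‖_p ≥ R - δ > R / 2, and the spare half of the logarithmic drift pays for it.
  rcases le_or_gt (radius p m M) (2 * radius p c M) with hRδ | hRδ
  · calc _ ≤ (L + ∑ i, ENNReal.ofReal (768 * r i ^ (p - 1)) * V i) +
          (E + ∑ i, ENNReal.ofReal (768 * r i ^ (p - 1)) * W i) := by gcongr
      _ = (L + E) + ∑ i, ENNReal.ofReal (768 * r i ^ (p - 1)) * (V i + W i) := by
          rw [add_add_add_comm, ← Finset.sum_add_distrib]
          simp only [mul_add]
      _ ≤ _ := by
          unfold potential
          gcongr with i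
          · refine le_trans ?_ hlog
            gcongr
            exact le_self_add
          · exact lintegral_setLIntegral_crowdPotential_le hp q hR hc hD hδ' hRδ i _
  · have hY8 : (1 / 8 : ℝ) ^ p ≤ Y := by
      refine Real.rpow_le_rpow (by norm_num) ?_ hp0.le
      rw [le_div_iff₀ hR]
      obtain ⟨c', hc', h⟩ := exists_lpDist_eq_radius (p := p) m ⟨c, hc⟩
      have h1 := lpDist_triangle hp c' c m
      have h2 := lpDist_le_radius (p := p) (m := c) hc'
      linarith
    have hWE : ∑ i, ENNReal.ofReal (768 * r i ^ (p - 1)) * W i ≤ E := by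
      calc _ ≤ ∑ i, ENNReal.ofReal (768 * r i ^ (p - 1)) *
            ENNReal.ofReal ((1 / 8) ^ p / (4 * d) * |x i - c i|) := by
            gcongr with i
            calc W i ≤ ∫⁻ _ in Set.uIoc (x i) (c i), ENNReal.ofReal ((1 / 8) ^ p / (4 * d)) := by
                  refine lintegral_mono fun ϑ => ENNReal.ofReal_le_ofReal ?_
                  exact mul_le_of_le_one_right (by positivity) (sideWeight_le_one _ _ _ _ _)
              _ = _ := by
                  rw [setLIntegral_const, Real.volume_uIoc, abs_sub_comm,
                    ENNReal.ofReal_mul (by positivity)]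
        _ = ENNReal.ofReal (∑ i, 768 * r i ^ (p - 1) * ((1 / 8) ^ p / (4 * d) * |x i - c i|)) := by
            rw [ENNReal.ofReal_sum_of_nonneg fun i _ => by positivity]
            refine Finset.sum_congr rfl fun i _ => ?_
            rw [← ENNReal.ofReal_mul (by positivity)]
        _ ≤ E := by
            refine ENNReal.ofReal_le_ofReal ?_
            have h1 : ∑ i, 768 * r i ^ (p - 1) * ((1 / 8) ^ p / (4 * d) * |x i - c i|) =
                192 / d * (1 / 8) ^ p * ∑ i, r i ^ (p - 1) * |x i - c i| := by
              rw [Finset.mul_sum]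
              refine Finset.sum_congr rfl fun i _ => ?_
              ring
            rw [h1, hr, sum_ratio_rpow_mul hp x c]
            have h2 : 192 * p * lpDist p x c / d * Y = 192 / d * (p * Y) * lpDist p x c := by ring
            rw [h2]
            have h3 : (1 / 8 : ℝ) ^ p ≤ p * Y := by nlinarith
            gcongr
    calc _ ≤ (L + ∑ i, ENNReal.ofReal (768 * r i ^ (p - 1)) * V i) + (E + E) := by
          gcongr
          exact hpen.trans (add_le_add le_rfl hWE)
      _ = (L + (E + E)) + ∑ i, ENNReal.ofReal (768 * r i ^ (p - 1)) * V i := by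
          rw [add_right_comm]
      _ ≤ _ := by
          unfold potential
          gcongr with i
          refine (lintegral_mono (g := fun _ => ∫⁻ ϑ in Set.uIoc (x i) (c i),
            crowdPotential p q x c (sideAt x i ϑ M) M) fun s => ?_).trans (by simp)
          exact lintegral_mono fun ϑ => crowdPotential_mono q x c
            (sideAt_mono x i ϑ (Cut.side_subset _ _ _)) (Cut.side_subset _ _ _)

/-- The value after a cut that splits `x` from the center `c`. -/
theorem value_nextPair_le_of_splits (hp : 1 ≤ p) {q k : ℕ} (hq : ScaleBound p q k)
    {x c : Point d} {Cu M : Finset (Point d)} (hM : M ⊆ Cu) (hk : Cu.card ≤ k) (hc : c ∈ M)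
    {w : Cut d} (hsep : w.Separates M) (hδ : lpDist p x c ≤ radius p c M) :
    value p q x (nextPair w x Cu M).1 (nextPair w x Cu M).2 ≤
      ENNReal.ofReal (2 * radius p c M *
        sideWeight p q x c (radius p c M) (sideAt x w.1 w.2.2 M)) := by
  have hside : (nextPair w x Cu M).2 = sideAt x w.1 w.2.2 M := by
    rw [← Cut.side_eq_sideAt]
    unfold nextPair
    rw [if_pos hsep]
    split_ifs <;> rfl
  have hne : (sideAt x w.1 w.2.2 M).Nonempty := by
    rw [← Cut.side_eq_sideAt]; exact hsep.side_nonempty x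
  obtain ⟨c₀, hc₀, _, hw⟩ := exists_sideWeight_eq (p := p) q x c (radius p c M) hne
  have hδ0 : 0 ≤ radius p c M := radius_nonneg _ _
  rw [hw, mul_min_of_nonneg _ _ (by positivity), mul_one, ENNReal.ofReal_min]
  refine le_min ?_ ?_
  · refine value_le_ofReal q x fun c' hc' => ?_
    have h1 := lpDist_triangle hp x c c'
    have h2 := lpDist_le_radius (p := p) (m := c) (nextPair_snd_subset w x Cu M hc')
    rw [lpDist_comm c c'] at h1
    linarith
  -- For δ = 0 the quotient takes its default value 0. This is harmless, since the whole cell is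
  -- then at distance 0 from `x`.
  · rcases hδ0.eq_or_lt with h0 | h0
    · refine (value_le_ofReal q x fun c' hc' => ?_).trans (ENNReal.ofReal_le_ofReal le_rfl)
      rw [← h0] at hδ ⊢
      have h1 := lpDist_triangle hp x c c'
      have h2 := lpDist_le_radius (p := p) (m := c) (nextPair_snd_subset w x Cu M hc')
      rw [lpDist_comm c c'] at h1
      rw [← h0] at h2
      linarith
    · rw [mul_div_cancel₀ _ (by positivity)]
      rw [← hside] at hc₀
      -- The center `c₀` nearest to `x` on its side takes over the role of `c`, and the bootstrapped
      -- bound applies to it.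
      refine (value_le_valueAt q x hc₀).trans ((valueAt_le hp hq x c₀ (nextPair_subset w x hM)
        (((nextPair_snd_nonempty w x Cu ⟨c, hc⟩)).mono (nextPair_subset w x hM))
        ((Finset.card_le_card (nextPair_fst_subset w x hM)).trans hk)).trans
        (ENNReal.ofReal_le_ofReal ?_))
      gcongr
      exact le_max_right _ _

/-- The value does not increase in expectation. -/
theorem lintegral_value_nextPair_le [NeZero d] (hp : 1 ≤ p) {q k : ℕ} (hq : ScaleBound p q k)
    {m : Point d} {Cu M : Finset (Point d)} (hB : Balanced m Cu M) (hk : Cu.card ≤ k)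
    (x : Point d) :
    ∫⁻ s, value p q x (nextPair (sampleCut p m M s) x Cu M).1
        (nextPair (sampleCut p m M s) x Cu M).2 ∂seedLaw d ≤
      value p q x Cu M := by
  have hp0 : 0 < p := by linarith
  -- The maximal distance to the cell cannot grow because cells shrink. The other entry of the
  -- minimum is treated one center at a time.
  refine le_inf ?_ (le_iInf₂ fun c hc => ?_)
  · refine (lintegral_mono (g := fun _ => ⨆ c ∈ M, ENNReal.ofReal (lpDist p x c))
      fun s => ?_).trans (by simp)
    exact inf_le_left.trans (biSup_mono fun c hc => nextPair_snd_subset _ _ _ _ hc)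
  have hnext : ∀ w : Cut d, (nextPair w c Cu M).1.Nonempty := fun w =>
    (nextPair_snd_nonempty w c Cu hB.nonempty).mono (nextPair_subset w c hB.subset)
  have hcnext : ∀ w : Cut d, c ∈ (nextPair w c Cu M).2 := fun w => by
    rw [nextPair_snd_eq_side w Cu hc]; exact Cut.mem_side_self w hc
  have hmono : ∀ w : Cut d, potential p q x c (nextPair w c Cu M).1 (nextPair w c Cu M).2 ≤
      potential p q x c Cu M := fun w => potential_mono hp q x c
    (nextPair_fst_subset w c hB.subset) (nextPair_snd_subset w c Cu M) (hnext w)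
  have hunsplit : ∀ w : Cut d, ¬(w.Splits x c ∧ w.Separates M) →
      value p q x (nextPair w x Cu M).1 (nextPair w x Cu M).2 ≤
        valueAt p q x c (nextPair w c Cu M).1 (nextPair w c Cu M).2 := by
    intro w hw
    -- A cut that splits `x` from `c` but separates no centers is discarded, so both stay in the
    -- same cell.
    have heq : nextPair w x Cu M = nextPair w c Cu M := by
      by_cases hs : w.Splits x c
      · have hns : ¬w.Separates M := fun h => hw ⟨hs, h⟩
        simp only [nextPair, if_neg hns]
      · exact nextPair_congr hs Cu M
    rw [heq]
    exact value_le_valueAt q x (hcnext w)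
  -- The ratios in the potential divide by D, so D = 0 is separate: then `x` equals `c` and is never
  -- split from it.
  rcases (lpDist_nonneg (p := p) x c).eq_or_lt with h0 | hD
  · have hx := eq_of_lpDist_eq_zero hp h0.symm
    refine le_trans (le_of_eq ?_) zero_le
    rw [lintegral_eq_zero_iff' ]
    · refine Filter.Eventually.of_forall fun s => ?_
      refine le_antisymm ((hunsplit _ fun h => ?_).trans ((valueAt_le hp hq x c
        (nextPair_subset _ c hB.subset) (hnext _) ((Finset.card_le_card
          (nextPair_fst_subset _ c hB.subset)).trans hk)).trans ?_)) zero_le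
      · rw [hx] at h; exact h.1 Iff.rfl
      · rw [← h0]; simp
    · exact (((countablyValued_nextPair x Cu M).comp_measurable
        (measurable_sampleCut p m M)).measurable fun q' => value p q x q'.1 q'.2).aemeasurable
  -- If the cell is within 64 p D of `c`, a split costs at most D + 64 p D ≤ 65 p D; this is the
  -- constant term of `valueAt`.
  rcases le_or_gt (radius p c M) (64 * p * lpDist p x c) with hδ | hδ
  · calc _ ≤ ∫⁻ _, (ENNReal.ofReal (65 * p * lpDist p x c) + potential p q x c Cu M)
          ∂seedLaw d := by
          refine lintegral_mono fun s => ?_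
          set w := sampleCut p m M s
          by_cases hs : w.Splits x c ∧ w.Separates M
          · refine (value_le_ofReal q x fun c' hc' => ?_).trans le_self_add
            have h1 := lpDist_triangle hp x c c'
            have h2 := lpDist_le_radius (p := p) (m := c) (nextPair_snd_subset w x Cu M hc')
            rw [lpDist_comm c c'] at h1
            nlinarith
          · exact (hunsplit w hs).trans (add_le_add le_rfl (hmono w))
      _ = _ := by simp [valueAt]
  · have hlogk : (128 : ℝ) * p ≤ 2 ^ q := by
      refine le_trans ?_ hq
      have hk2 : (2 : ℝ) ≤ k := by
        exact_mod_cast (hB.two_le.trans (Finset.card_le_card hB.subset)).trans hk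
      have h1 := Real.log_le_log (by norm_num) hk2
      have h2 := Real.log_two_gt_d9
      have h3 := Real.log_nonneg (show (1 : ℝ) ≤ 1 + k by linarith)
      have h4 : 0 ≤ 768 * ((q + 2) * Real.log (1 + k)) := by positivity
      have h5 : p * (1 / 2) ≤ p * Real.log k := by gcongr; linarith
      linarith
    have hδ' : lpDist p x c ≤ radius p c M := by
      refine le_trans ?_ hδ.le
      nlinarith
    calc _ ≤ ∫⁻ s, (ENNReal.ofReal (65 * p * lpDist p x c) +
          (potential p q x c (nextPair (sampleCut p m M s) c Cu M).1
            (nextPair (sampleCut p m M s) c Cu M).2 +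
          {w : Cut d | w.Splits x c}.indicator (fun w => ENNReal.ofReal (2 * radius p c M *
            sideWeight p q x c (radius p c M) (sideAt x w.1 w.2.2 M))) (sampleCut p m M s)))
          ∂seedLaw d := by
          refine lintegral_mono fun s => ?_
          set w := sampleCut p m M s
          by_cases hs : w.Splits x c ∧ w.Separates M
          · rw [Set.indicator_of_mem (show w ∈ {w : Cut d | w.Splits x c} from hs.1)]
            exact (value_nextPair_le_of_splits hp hq hB.subset hk hc hs.2 hδ').trans
              (le_add_self.trans le_add_self)
          · exact (hunsplit w hs).trans (add_le_add le_rfl le_self_add)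
      _ = ENNReal.ofReal (65 * p * lpDist p x c) +
          (∫⁻ s, potential p q x c (nextPair (sampleCut p m M s) c Cu M).1
            (nextPair (sampleCut p m M s) c Cu M).2 ∂seedLaw d +
          ∫⁻ s, {w : Cut d | w.Splits x c}.indicator (fun w => ENNReal.ofReal (2 * radius p c M *
            sideWeight p q x c (radius p c M) (sideAt x w.1 w.2.2 M))) (sampleCut p m M s)
            ∂seedLaw d) := by
          rw [lintegral_add_left measurable_const, lintegral_add_left
            (((countablyValued_nextPair c Cu M).comp_measurable
              (measurable_sampleCut p m M)).measurable fun q' => potential p q x c q'.1 q'.2)]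
          simp
      _ ≤ _ := by
          unfold valueAt
          gcongr
          exact lintegral_potential_add_penalty_le hp hlogk hB hc hD hδ

end Drift

/-! ### Fresh coordinates -/

section Fresh

/-- The coordinate `j (Z ω)` may be integrated separately if the event `Z ω = z` does not depend
on the coordinate `j z`. -/
theorem lintegral_infinitePi_fresh {ι S α : Type*} [DecidableEq ι] [MeasurableSpace S] (ν : Measure S)
    [IsProbabilityMeasure ν] {Z : (ι → S) → α} (hZ : CountablyValued Z) (j : α → ι)
    (hj : ∀ ω u, Z (Function.update ω (j (Z ω)) u) = Z ω) {g : α → S → ℝ≥0∞}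
    (hg : ∀ z, Measurable (g z)) :
    ∫⁻ ω, g (Z ω) (ω (j (Z ω))) ∂(Measure.infinitePi fun _ : ι => ν) =
      ∫⁻ ω, ∫⁻ u, g (Z ω) u ∂ν ∂(Measure.infinitePi fun _ : ι => ν) := by
  rw [hZ.lintegral_eq_tsum, hZ.lintegral_eq_tsum]
  refine tsum_congr fun z => ?_
  have hinv : ∀ ω u, Function.update ω (j z.1) u ∈ Z ⁻¹' {z.1} ↔ ω ∈ Z ⁻¹' {z.1} := by
    intro ω u
    constructor
    · intro h
      have h' : Z (Function.update ω (j z.1) u) = z.1 := h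
      -- The invariance is applied at the updated family, and the old coordinate is put back.
      have := hj (Function.update ω (j z.1) u) (ω (j z.1))
      rw [h', Function.update_idem, Function.update_eq_self] at this
      exact this
    · intro h
      have h' : Z ω = z.1 := h
      have := hj ω u
      rw [h'] at this
      exact this
  calc _ = ∫⁻ ω in Z ⁻¹' {z.1}, g z.1 (ω (j z.1)) ∂(Measure.infinitePi fun _ : ι => ν) := by
        refine setLIntegral_congr_fun (hZ.2 z.1) fun ω hω => ?_
        have h : Z ω = z.1 := hω
        simp only [h]
    _ = _ := setLIntegral_infinitePi_coord ν (j z.1) (hZ.2 z.1) hinv (hg z.1)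
    _ = ∫⁻ ω in Z ⁻¹' {z.1}, ∫⁻ u, g z.1 u ∂ν ∂(Measure.infinitePi fun _ : ι => ν) := by
        rw [setLIntegral_const, mul_comm]
    _ = _ := by
        refine setLIntegral_congr_fun (hZ.2 z.1) fun ω hω => ?_
        have h : Z ω = z.1 := hω
        simp only [h]

end Fresh

section Call

variable {d : ℕ} {p : ℝ}

/-! ### The main part -/

theorem mainPart_succ (p : ℝ) (m : Point d) (Cu : Finset (Point d)) (s : ℕ → Seed d) (t : ℕ) :
    mainPart p m Cu s (t + 1) =
      cutMain (sampleCut p m (mainPart p m Cu s t) (s t)) (mainPart p m Cu s t) := rfl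

theorem mainPart_subset (p : ℝ) (m : Point d) (Cu : Finset (Point d)) (s : ℕ → Seed d) (t : ℕ) :
    mainPart p m Cu s t ⊆ Cu := by
  induction t with
  | zero => exact Finset.Subset.refl _
  | succ t ih => exact (cutMain_subset _ _).trans ih

theorem mainPart_nonempty (p : ℝ) (m : Point d) {Cu : Finset (Point d)} (h : Cu.Nonempty)
    (s : ℕ → Seed d) (t : ℕ) : (mainPart p m Cu s t).Nonempty := by
  induction t with
  | zero => exact h
  | succ t ih => exact cutMain_nonempty _ ih

theorem mainPart_congr (p : ℝ) (m : Point d) (Cu : Finset (Point d)) {s s' : ℕ → Seed d} {t : ℕ}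
    (h : ∀ j < t, s j = s' j) : mainPart p m Cu s t = mainPart p m Cu s' t := by
  induction t with
  | zero => rfl
  | succ t ih =>
    rw [mainPart_succ, mainPart_succ, ih fun j hj => h j (by omega), h t (by omega)]

theorem cutAt_congr (p : ℝ) (m : Point d) (Cu : Finset (Point d)) {s s' : ℕ → Seed d} {t : ℕ}
    (h : ∀ j ≤ t, s j = s' j) : cutAt p m Cu s t = cutAt p m Cu s' t := by
  rw [cutAt, cutAt, mainPart_congr p m Cu fun j hj => h j hj.le, h t le_rfl]

theorem countablyValued_mainPart (p : ℝ) (m : Point d) (Cu : Finset (Point d)) (t : ℕ) :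
    CountablyValued fun s : ℕ → Seed d => mainPart p m Cu s t := by
  induction t with
  | zero => exact CountablyValued.const Cu
  | succ t ih =>
    exact ih.bind (W := fun M s => cutMain (sampleCut p m M (s t)) M) fun M =>
      (countablyValued_cutMain M).comp_measurable
        ((measurable_sampleCut p m M).comp (measurable_pi_apply t))

theorem measurable_cutAt (p : ℝ) (m : Point d) (Cu : Finset (Point d)) (t : ℕ) :
    Measurable fun s : ℕ → Seed d => cutAt p m Cu s t := by
  intro B hB
  have hcv := countablyValued_mainPart p m Cu t
  have : (fun s : ℕ → Seed d => cutAt p m Cu s t) ⁻¹' B =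
      ⋃ M ∈ Set.range fun s : ℕ → Seed d => mainPart p m Cu s t,
        (fun s => mainPart p m Cu s t) ⁻¹' {M} ∩ {s | sampleCut p m M (s t) ∈ B} := by
    ext s
    simp only [Set.mem_preimage, Set.mem_iUnion, Set.mem_inter_iff, Set.mem_singleton_iff,
      exists_prop, Set.mem_ofPred_eq]
    constructor
    · intro h; exact ⟨_, ⟨s, rfl⟩, rfl, h⟩
    · rintro ⟨M, _, rfl, h⟩; exact h
  rw [this]
  exact MeasurableSet.biUnion hcv.1 fun M _ => (hcv.2 M).inter
    (((measurable_sampleCut p m M).comp (measurable_pi_apply t)) hB)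

/-! ### Consequences of the requirements on the oracles -/

/-- A main part with more than (1 - a)|Cu| centers meets every subset of `Cu` with at least a|Cu|
elements, and the complement of such a subset has at most three quarters of the elements because a ≥
1/4. -/
theorem IsAnchorOracle.balanced {a : ℝ} {C Cu M : Finset (Point d)} {anchor : AnchorOracle d}
    (h : IsAnchorOracle a C anchor) (ha : 1 / 4 ≤ a) (ha' : a ≤ 1 / 2) (hCu : Cu ⊆ C)
    (h2 : 2 ≤ Cu.card) (hM : M ⊆ Cu) (hcard : (1 - a) * Cu.card < M.card) :
    Balanced (anchor Cu) Cu M := by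
  have h2' : (2 : ℝ) ≤ Cu.card := by exact_mod_cast h2
  have key : ∀ (P : Point d → Prop) [DecidablePred P],
      a * Cu.card ≤ ((Cu.filter P).card : ℝ) → ∃ c ∈ M, P c := by
    intro P _ hP
    by_contra! hcon
    have hdisj : Disjoint (Cu.filter P) M := Finset.disjoint_left.2 fun c h1 h3 =>
      hcon c h3 (Finset.mem_filter.1 h1).2
    have h4 := Finset.card_le_card (Finset.union_subset (Finset.filter_subset P Cu) hM)
    rw [Finset.card_union_of_disjoint hdisj] at h4
    have h5 : ((Cu.filter P).card : ℝ) + M.card ≤ Cu.card := by exact_mod_cast h4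
    linarith
  have key' : ∀ (P : Point d → Prop) [DecidablePred P],
      a * Cu.card ≤ ((Cu.filter P).card : ℝ) →
      4 * (Cu.filter fun c => ¬P c).card ≤ 3 * Cu.card := by
    intro P _ hP
    have h4 : ((Cu.filter P).card : ℝ) + (Cu.filter fun c => ¬P c).card = Cu.card := by
      exact_mod_cast Finset.card_filter_add_card_filter_not (s := Cu) P
    have h5 : (4 : ℝ) * (Cu.filter fun c => ¬P c).card ≤ 3 * Cu.card := by nlinarith
    exact_mod_cast h5
  refine ⟨hM, ?_, fun i => key _ (h Cu hCu h2 i).2, fun i => key _ (h Cu hCu h2 i).1,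
    fun i => ?_, fun i => ?_⟩
  · have : (1 : ℝ) < M.card := by nlinarith
    exact_mod_cast this
  · simpa only [not_le] using key' _ (h Cu hCu h2 i).2
  · simpa only [not_le] using key' _ (h Cu hCu h2 i).1

/-! ### Every call stops -/

/-- A center farthest from the anchor is cut off with probability at least 1 / (2d), and then the
main part loses at least one center. -/
theorem lintegral_card_cutMain_le [NeZero d] (hp : 1 ≤ p) {m : Point d} {Cu M : Finset (Point d)}
    (hB : Balanced m Cu M) :
    ∫⁻ s, ((cutMain (sampleCut p m M s) M).card : ℝ≥0∞) ∂seedLaw d +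
      ENNReal.ofReal (1 / (2 * d)) ≤ M.card := by
  have hR := hB.radius_pos hp
  obtain ⟨c, hc, hcR⟩ := exists_lpDist_eq_radius (p := p) m hB.nonempty
  set E : Set (Seed d) := {s | ¬(sampleCut p m M s).Keeps c ∧
        (sampleCut p m M s).2.2 ≠ m (sampleCut p m M s).1} with hE
  have hEm : MeasurableSet E :=
    ((measurableSet_keeps c).compl.inter (measurableSet_cut_ne m)).preimage
      (measurable_sampleCut p m M)
  have hEν : ENNReal.ofReal (1 / (2 * d)) ≤ seedLaw d E := by
    have := le_seedLaw_not_keeps hp m hR hc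
    rwa [hcR, div_self hR.ne', Real.one_rpow] at this
  have hmeas : Measurable fun s : Seed d => ((cutMain (sampleCut p m M s) M).card : ℝ≥0∞) :=
    ((countablyValued_cutMain M).comp_measurable (measurable_sampleCut p m M)).measurable
      fun S => (S.card : ℝ≥0∞)
  calc _ ≤ ∫⁻ s, ((cutMain (sampleCut p m M s) M).card : ℝ≥0∞) ∂seedLaw d +
        ∫⁻ s, E.indicator 1 s ∂seedLaw d := by
        rw [lintegral_indicator_one hEm]
        gcongr
    _ = ∫⁻ s, (((cutMain (sampleCut p m M s) M).card : ℝ≥0∞) + E.indicator 1 s) ∂seedLaw d := by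
        rw [lintegral_add_left hmeas]
    _ ≤ ∫⁻ _, (M.card : ℝ≥0∞) ∂seedLaw d := by
        refine lintegral_mono fun s => ?_
        by_cases hs : s ∈ E
        · rw [Set.indicator_of_mem hs]
          have hsep := (hB.cut_off hp hs.1 hs.2).2 ⟨c, Cut.mem_side_self _ hc⟩
          have hlt : (cutMain (sampleCut p m M s) M).card < M.card := by
            refine Finset.card_lt_card ⟨cutMain_subset _ _, fun hsub => ?_⟩
            have h1 := hsub hc
            have h2 := hs.1
            unfold Cut.Keeps at h2
            unfold cutMain at h1
            rw [if_pos hsep] at h1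
            split_ifs at h1 h2 with hσ
            · exact h2 (Finset.mem_filter.1 h1).2
            · exact h2 (Finset.mem_filter.1 h1).2
          have : (((cutMain (sampleCut p m M s) M).card + 1 : ℕ) : ℝ≥0∞) ≤ (M.card : ℕ) :=
            Nat.cast_le.2 hlt
          simpa using this
        · rw [Set.indicator_of_notMem hs, add_zero]
          exact Nat.cast_le.2 (Finset.card_le_card (cutMain_subset _ _))
    _ = _ := by simp

/-- While the main part is large, its expected size falls by a fixed amount per iteration. An
expectation that stays nonnegative allows this forever only on a null event. -/
theorem ae_exists_mainPart_card_le [NeZero d] (hp : 1 ≤ p) {a : ℝ} (ha : 1 / 4 ≤ a)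
    (ha' : a ≤ 1 / 2) {C : Finset (Point d)} {anchor : AnchorOracle d}
    (hA : IsAnchorOracle a C anchor) {Cu : Finset (Point d)} (hCu : Cu ⊆ C) (h2 : 2 ≤ Cu.card)
    (addr : List Bool) :
    ∀ᵐ ω ∂seedsLaw d, ∃ t, ((mainPart p (anchor Cu) Cu (fun t => ω (addr, t)) t).card : ℝ) ≤
      (1 - a) * Cu.card := by
  classical
  set m := anchor Cu with hm
  set Z : ℕ → Seeds d → Finset (Point d) := fun t ω => mainPart p m Cu (fun t => ω (addr, t)) t
    with hZ
  have hsm : Measurable fun (ω : Seeds d) (t : ℕ) => ω (addr, t) :=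
    measurable_pi_lambda _ fun t => measurable_pi_apply _
  have hcv : ∀ t, CountablyValued (Z t) := fun t =>
    (countablyValued_mainPart p m Cu t).comp_measurable hsm
  set B : ℕ → Set (Seeds d) := fun t => Z t ⁻¹' {M | (1 - a) * Cu.card < (M.card : ℝ)} with hBdef
  have hBm : ∀ t, MeasurableSet (B t) := fun t => (hcv t).measurableSet_preimage _
  set κ := ENNReal.ofReal (1 / (2 * d)) with hκ
  have hd : (0 : ℝ) < d := Nat.cast_pos.2 (NeZero.pos d)
  have hκ0 : κ ≠ 0 := by
    rw [hκ, Ne, ENNReal.ofReal_eq_zero, not_le]; positivity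
  have hstep : ∀ t, ∫⁻ ω, ((Z (t + 1) ω).card : ℝ≥0∞) ∂seedsLaw d + κ * seedsLaw d (B t) ≤
      ∫⁻ ω, ((Z t ω).card : ℝ≥0∞) ∂seedsLaw d := by
    intro t
    have hfresh := lintegral_infinitePi_fresh (seedLaw d) (hcv t) (fun _ => (addr, t))
      (fun ω u => mainPart_congr p m Cu fun j hj => by
        rw [Function.update_of_ne]; simp; omega)
      (g := fun M s => ((cutMain (sampleCut p m M s) M).card : ℝ≥0∞)) fun M =>
        ((countablyValued_cutMain M).comp_measurable (measurable_sampleCut p m M)).measurable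
          fun S => (S.card : ℝ≥0∞)
    have h1 : ∫⁻ ω, ((Z (t + 1) ω).card : ℝ≥0∞) ∂seedsLaw d =
        ∫⁻ ω, ∫⁻ s, ((cutMain (sampleCut p m (Z t ω) s) (Z t ω)).card : ℝ≥0∞) ∂seedLaw d
          ∂seedsLaw d := hfresh
    rw [h1, ← lintegral_indicator_const (hBm t), ← lintegral_add_right _
      (measurable_const.indicator (hBm t))]
    refine lintegral_mono fun ω => ?_
    by_cases hω : ω ∈ B t
    · rw [Set.indicator_of_mem hω]
      exact lintegral_card_cutMain_le hp
        (hA.balanced ha ha' hCu h2 (mainPart_subset p m Cu _ t) hω)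
    · rw [Set.indicator_of_notMem hω, add_zero]
      refine (lintegral_mono (g := fun _ => ((Z t ω).card : ℝ≥0∞)) fun s => ?_).trans (by simp)
      exact Nat.cast_le.2 (Finset.card_le_card (cutMain_subset _ _))
  have hsum : ∀ n, ∫⁻ ω, ((Z n ω).card : ℝ≥0∞) ∂seedsLaw d +
      n * (κ * seedsLaw d (⋂ t, B t)) ≤ Cu.card := by
    intro n
    induction n with
    | zero => simp [hZ, mainPart, seedsLaw]
    | succ n ih =>
      refine le_trans ?_ ih
      have h3 : seedsLaw d (⋂ t, B t) ≤ seedsLaw d (B n) :=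
        measure_mono (Set.iInter_subset _ n)
      calc _ = (∫⁻ ω, ((Z (n + 1) ω).card : ℝ≥0∞) ∂seedsLaw d +
              κ * seedsLaw d (⋂ t, B t)) + n * (κ * seedsLaw d (⋂ t, B t)) := by
            push_cast; ring
        _ ≤ _ := by
            gcongr
            refine le_trans ?_ (hstep n)
            gcongr
  have hzero : seedsLaw d (⋂ t, B t) = 0 := by
    by_contra hne
    have h3 : κ * seedsLaw d (⋂ t, B t) ≠ 0 := mul_ne_zero hκ0 hne
    obtain ⟨n, hn⟩ := ENNReal.exists_nat_mul_gt h3 (ENNReal.natCast_ne_top Cu.card)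
    exact absurd ((le_add_self).trans (hsum n)) (not_le.2 hn)
  rw [ae_iff]
  refine measure_mono_null ?_ hzero
  intro ω hω
  simp only [Set.mem_ofPred_eq, not_exists, not_le] at hω
  exact Set.mem_iInter.2 hω

/-- Almost surely every call on a set of at least two centers stops. -/
theorem ae_stopTimes_nonempty [NeZero d] (hp : 1 ≤ p) {a γ : ℝ} (ha : 1 / 4 ≤ a)
    (ha' : a ≤ 1 / 2) {C : Finset (Point d)} {anchor : AnchorOracle d}
    {halt : StoppingOracle d} (hA : IsAnchorOracle a C anchor)
    (hS : IsStoppingOracle p a γ C anchor halt) :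
    ∀ᵐ ω ∂seedsLaw d, ∀ addr, ∀ Cu ⊆ C, 2 ≤ Cu.card →
      (stopTimes p anchor halt Cu fun t => ω (addr, t)).Nonempty := by
  rw [ae_all_iff]
  intro addr
  have hfin : (C.powerset : Set (Finset (Point d))).Countable := C.powerset.countable_toSet
  have : ∀ᵐ ω ∂seedsLaw d, ∀ Cu ∈ (C.powerset : Set (Finset (Point d))), 2 ≤ Cu.card →
      (stopTimes p anchor halt Cu fun t => ω (addr, t)).Nonempty := by
    rw [ae_ball_iff hfin]
    intro Cu hCu
    have hCu' : Cu ⊆ C := Finset.mem_powerset.1 (Finset.mem_coe.1 hCu)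
    by_cases h2 : 2 ≤ Cu.card
    · filter_upwards [ae_exists_mainPart_card_le hp ha ha' hA hCu' h2 addr] with ω hω _
      obtain ⟨t, ht⟩ := hω
      have ht1 : 1 ≤ t := by
        by_contra h0
        have h00 : t = 0 := by omega
        subst h00
        have h2' : (2 : ℝ) ≤ Cu.card := by exact_mod_cast h2
        have h3 : ((mainPart p (anchor Cu) Cu (fun t => ω (addr, t)) 0).card : ℝ) = Cu.card := rfl
        nlinarith
      exact ⟨t, ht1, ((hS Cu hCu' h2 t ht1).2 _).2 ht⟩
    · exact Filter.Eventually.of_forall fun ω h => absurd h h2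
  filter_upwards [this] with ω hω Cu hCu
  exact hω Cu (Finset.mem_coe.2 (Finset.mem_powerset.2 hCu))

/-! ### The output of the algorithm -/

/-- The leaves of the tree are labelled by the distinct centers of `M`, and each of these lies in
the leaf that it labels. -/
structure Tree.Represents (T : Tree d (Point d)) (M : Finset (Point d)) : Prop where
  nodup : T.leaves.Nodup
  mem_leaves : ∀ c, c ∈ T.leaves ↔ c ∈ M
  eval_eq : ∀ c ∈ M, T.eval c = c

theorem Tree.Represents.node {l r : Tree d (Point d)} {M : Finset (Point d)} (w : Cut d)
    (hl : l.Represents (w.left M)) (hr : r.Represents (w.right M)) :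
    (Tree.node w.1 w.2.2 l r).Represents M := by
  refine ⟨?_, fun c => ?_, fun c hc => ?_⟩
  · refine List.nodup_append.2 ⟨hl.nodup, hr.nodup, fun b hb c hc hbc => ?_⟩
    subst hbc
    exact absurd (Finset.mem_filter.1 ((hl.mem_leaves b).1 hb)).2
      (not_lt.2 (Finset.mem_filter.1 ((hr.mem_leaves b).1 hc)).2)
  · rw [Tree.leaves, List.mem_append, hl.mem_leaves, hr.mem_leaves, ← Cut.left_union_right]
  · rw [Tree.eval]
    split_ifs with h
    · exact hl.eval_eq c (Finset.mem_filter.2 ⟨hc, h⟩)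
    · exact hr.eval_eq c (Finset.mem_filter.2 ⟨hc, not_lt.1 h⟩)

/-- Every leaf must be smaller than `Cu` before `f` may be applied. For a side that is cut off this
follows from separation; for the last main part it is `hcard`. -/
theorem expand_grow_represents {m : Point d} {Cu : Finset (Point d)} {s : ℕ → Seed d}
    {f : List Bool → Finset (Point d) → Option (Tree d (Point d))}
    (hf : ∀ addr S, S.Nonempty → S ⊆ Cu → S.card < Cu.card →
      ∃ T, f addr S = some T ∧ T.Represents S) (hCu : Cu.Nonempty) (n t : ℕ) (addr : List Bool)
    (hcard : (mainPart p m Cu s (t + n)).card < Cu.card) :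
    ∃ T, (grow p m s n t (mainPart p m Cu s t)).expand f addr = some T ∧
      T.Represents (mainPart p m Cu s t) := by
  induction n generalizing t addr with
  | zero => exact hf addr _ (mainPart_nonempty p m hCu s t) (mainPart_subset p m Cu s t) hcard
  | succ n ih =>
    have hM := mainPart_subset p m Cu s t
    have ih' := fun addr => ih (t + 1) addr (by rwa [add_right_comm, add_assoc])
    rw [mainPart_succ] at ih'
    set M := mainPart p m Cu s t with hMdef
    set w := sampleCut p m M (s t) with hw
    rw [grow]
    simp only [← hw]
    by_cases hsep : w.Separates M
    · have hlt : ∀ y, (w.side y M).card < Cu.card := fun y =>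
        (hsep.side_card_lt y).trans_le (Finset.card_le_card hM)
      have hlleft : (w.left M).card < Cu.card := by
        obtain ⟨y, hy⟩ := hsep.1
        rw [← Cut.side_eq_left (Finset.mem_filter.1 hy).2]; exact hlt y
      have hlright : (w.right M).card < Cu.card := by
        obtain ⟨y, hy⟩ := hsep.2
        rw [← Cut.side_eq_right (not_lt.2 (Finset.mem_filter.1 hy).2)]; exact hlt y
      rw [if_pos hsep]
      by_cases hσ : w.2.1
      · rw [if_pos hσ]
        have hmain : cutMain w M = w.left M := by rw [cutMain, if_pos hsep, if_pos hσ]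
        rw [hmain] at ih'
        obtain ⟨l, hl, hlrep⟩ := ih' (false :: addr)
        obtain ⟨r, hr, hrrep⟩ := hf (true :: addr) (w.right M) hsep.2
          ((Finset.filter_subset _ _).trans hM) hlright
        refine ⟨_, ?_, hlrep.node w hrrep⟩
        simp only [Tree.expand, hl, hr, Option.bind_some, Option.map_some]
      · rw [if_neg hσ]
        have hmain : cutMain w M = w.right M := by rw [cutMain, if_pos hsep, if_neg hσ]
        rw [hmain] at ih'
        obtain ⟨l, hl, hlrep⟩ := hf (false :: addr) (w.left M) hsep.1
          ((Finset.filter_subset _ _).trans hM) hlleft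
        obtain ⟨r, hr, hrrep⟩ := ih' (true :: addr)
        refine ⟨_, ?_, hlrep.node w hrrep⟩
        simp only [Tree.expand, hl, hr, Option.bind_some, Option.map_some]
    · rw [if_neg hsep]
      have hmain : cutMain w M = M := by rw [cutMain, if_neg hsep]
      rw [hmain] at ih'
      exact ih' addr

theorem partitionLeaf_represents {a γ : ℝ} (hγ : γ < 1) {C : Finset (Point d)}
    {anchor : AnchorOracle d} {halt : StoppingOracle d}
    (hS : IsStoppingOracle p a γ C anchor halt) {ω : Seeds d}
    (hω : ∀ addr, ∀ Cu ⊆ C, 2 ≤ Cu.card →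
      (stopTimes p anchor halt Cu fun t => ω (addr, t)).Nonempty)
    (n : ℕ) (addr : List Bool) {Cu : Finset (Point d)} (hCu : Cu ⊆ C) (hne : Cu.Nonempty)
    (hn : Cu.card ≤ n) :
    ∃ T, partitionLeaf p anchor halt ω n addr Cu = some T ∧ T.Represents Cu := by
  induction n generalizing addr Cu with
  | zero => exact absurd (Finset.card_pos.2 hne) (by omega)
  | succ n ih =>
    rw [partitionLeaf]
    by_cases h1 : Cu.card = 1
    · rw [dif_pos h1]
      have hspec := (Finset.card_eq_one.1 h1).choose_spec
      set c := (Finset.card_eq_one.1 h1).choose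
      refine ⟨_, rfl, List.nodup_singleton _, fun c' => ?_, fun c' hc' => ?_⟩
      · rw [hspec, Finset.mem_singleton, Tree.leaves, List.mem_singleton]
      · rw [hspec, Finset.mem_singleton] at hc'
        rw [Tree.eval, hc']
    · rw [dif_neg h1]
      have h2 : 2 ≤ Cu.card := by have := Finset.card_pos.2 hne; omega
      have hst := hω addr Cu hCu h2
      simp only [hst, if_true]
      have hmem := Nat.sInf_mem hst
      set τ := sInf (stopTimes p anchor halt Cu fun t => ω (addr, t))
      have hle := ((hS Cu hCu h2 τ hmem.1).2 _).1 hmem.2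
      -- As γ < 1, the main part at the stopping time is a proper subset, so one level of the
      -- recursion bound is enough.
      have hlt : (mainPart p (anchor Cu) Cu (fun t => ω (addr, t)) (0 + τ)).card < Cu.card := by
        have h2' : (2 : ℝ) ≤ Cu.card := by exact_mod_cast h2
        have : ((mainPart p (anchor Cu) Cu (fun t => ω (addr, t)) τ).card : ℝ) < Cu.card := by
          nlinarith
        rw [zero_add]
        exact_mod_cast this
      exact expand_grow_represents (fun addr S hS1 hS2 hS3 =>
        ih addr (hS2.trans hCu) hS1 (by omega)) hne τ 0 addr hlt

end Call

section Chain

variable {d : ℕ}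

/-! ### The path of a point -/

/-- The position of a point during the run: the address and the set of centers of the current call,
the number of iterations of this call, and the address and the set of centers of the cell that
contains the point. -/
structure Pos (d : ℕ) : Type where
  addr : List Bool
  call : Finset (Point d)
  time : ℕ
  cellAddr : List Bool
  cell : Finset (Point d)

/-- The position at the beginning of a call. -/
def Pos.start (addr : List Bool) (Cu : Finset (Point d)) : Pos d := ⟨addr, Cu, 0, addr, Cu⟩

/-- The index of the seed that is used in the next iteration. -/
def Pos.index (z : Pos d) : List Bool × ℕ := (z.addr, z.time)

/-- The next cut. -/
noncomputable def Pos.cut (p : ℝ) (anchor : AnchorOracle d) (z : Pos d) (s : Seed d) : Cut d :=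
  sampleCut p (anchor z.call) z.cell s

open Classical in
/-- The position of the point `x` after the cut `w`, where `h` tells whether the call stops. It
continues in a new call if it leaves the main part or if the call stops. A call on a single center
is final. -/
noncomputable def Pos.stepWith (x : Point d) (z : Pos d) (w : Cut d) (h : Prop) : Pos d :=
  let b := if w.Separates z.cell then (if x w.1 < w.2.2 then false else true) :: z.cellAddr
    else z.cellAddr
  let M := (nextPair w x z.call z.cell).2
  if z.call.card = 1 then z
  else if (w.Separates z.cell ∧ ¬w.Keeps x) ∨ h then Pos.start b M
  else ⟨z.addr, z.call, z.time + 1, b, M⟩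

/-- One iteration for the point `x`. -/
noncomputable def Pos.step (p : ℝ) (anchor : AnchorOracle d) (halt : StoppingOracle d)
    (x : Point d) (z : Pos d) (ω : Seeds d) : Pos d :=
  z.stepWith x (z.cut p anchor (ω z.index)) (halt z.call (z.time + 1) fun j =>
    cutAt p (anchor z.call) z.call (fun t => ω (z.addr, t)) j)

/-- The position of `x` after `n` iterations. -/
noncomputable def chain (p : ℝ) (anchor : AnchorOracle d) (halt : StoppingOracle d)
    (C : Finset (Point d)) (x : Point d) : ℕ → Seeds d → Pos d
  | 0, _ => Pos.start [] C
  | n + 1, ω => (chain p anchor halt C x n ω).step p anchor halt x ω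

/-- The invariants of the path of a point. -/
structure Pos.Valid (p a : ℝ) (anchor : AnchorOracle d) (C : Finset (Point d)) (ω : Seeds d)
    (z : Pos d) : Prop where
  call_subset : z.call ⊆ C
  cell_subset : z.cell ⊆ z.call
  cell_nonempty : z.cell.Nonempty
  cell_eq : z.cell = mainPart p (anchor z.call) z.call (fun t => ω (z.addr, t)) z.time
  card_lt : (1 - a) * z.call.card < z.cell.card
  addr_eq_or_lt : (z.cell = z.call ∧ z.cellAddr = z.addr) ∨ z.addr.length < z.cellAddr.length

variable {p a γ : ℝ} {anchor : AnchorOracle d} {halt : StoppingOracle d} {C : Finset (Point d)}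

theorem Pos.Valid.start (ha : 1 / 4 ≤ a) (ω : Seeds d) (addr : List Bool)
    {Cu : Finset (Point d)} (hCu : Cu ⊆ C) (hne : Cu.Nonempty) :
    (Pos.start addr Cu).Valid p a anchor C ω := by
  refine ⟨hCu, Finset.Subset.refl _, hne, rfl, ?_, Or.inl ⟨rfl, rfl⟩⟩
  have : (0 : ℝ) < Cu.card := by exact_mod_cast Finset.card_pos.2 hne
  change (1 - a) * (Cu.card : ℝ) < Cu.card
  nlinarith

theorem Pos.Valid.two_le {z : Pos d} {ω : Seeds d} (hz : z.Valid p a anchor C ω)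
    (h1 : z.call.card ≠ 1) : 2 ≤ z.call.card := by
  have := Finset.card_pos.2 (hz.cell_nonempty.mono hz.cell_subset)
  omega

theorem nextPair_snd_eq_cutMain {w : Cut d} {x : Point d} {Cu M : Finset (Point d)}
    (h : ¬(w.Separates M ∧ ¬w.Keeps x)) : (nextPair w x Cu M).2 = cutMain w M := by
  unfold nextPair
  by_cases hs : w.Separates M
  · have hk : w.Keeps x := by by_contra hk; exact h ⟨hs, hk⟩
    rw [if_pos hs, if_pos hk, hs.cutMain_eq_side hk]
  · rw [if_neg hs, cutMain, if_neg hs]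

theorem Pos.Valid.cutMain_eq {z : Pos d} {ω : Seeds d} (hz : z.Valid p a anchor C ω) :
    cutMain (z.cut p anchor (ω z.index)) z.cell =
      mainPart p (anchor z.call) z.call (fun t => ω (z.addr, t)) (z.time + 1) := by
  rw [mainPart_succ, ← hz.cell_eq]
  rfl

/-- The indices of the seeds that were used before the position `z` is reached. -/
def Pos.Before (z : Pos d) (q : List Bool × ℕ) : Prop :=
  q.1.length < z.addr.length ∨ (q.1 = z.addr ∧ q.2 < z.time)

theorem Pos.Before.ne_index {z : Pos d} {q : List Bool × ℕ} (h : z.Before q) : q ≠ z.index := by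
  rintro rfl
  rcases h with h | h
  · exact lt_irrefl _ h
  · exact lt_irrefl _ h.2

/-- The second claim tracks which seeds have been used. Addresses become longer with every new call,
so the index read at a position is always fresh. -/
theorem Pos.Valid.step (ha : 1 / 4 ≤ a) (hγ : γ < 1) (hS : IsStoppingOracle p a γ C anchor halt)
    (x : Point d) {z : Pos d} {ω : Seeds d} (hz : z.Valid p a anchor C ω) :
    (z.step p anchor halt x ω).Valid p a anchor C ω ∧
      ∀ q, z.Before q ∨ (z.call.card ≠ 1 ∧ q.1 = z.addr ∧ q.2 ≤ z.time) →
        (z.step p anchor halt x ω).Before q := by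
  unfold Pos.step Pos.stepWith
  simp only
  set w := z.cut p anchor (ω z.index) with hw
  by_cases h1 : z.call.card = 1
  · rw [if_pos h1]
    refine ⟨hz, fun q hq => hq.resolve_right fun h => h.1 h1⟩
  rw [if_neg h1]
  have h2 := hz.two_le h1
  have hor := (hS z.call hz.call_subset h2 (z.time + 1) (by omega)).2 fun t => ω (z.addr, t)
  rw [← hz.cutMain_eq, ← hw] at hor
  have hlen : z.addr.length ≤ z.cellAddr.length := by
    rcases hz.addr_eq_or_lt with h | h
    · rw [h.2]
    · exact h.le
  have hMsub : (nextPair w x z.call z.cell).2 ⊆ z.call :=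
    (nextPair_snd_subset w x z.call z.cell).trans hz.cell_subset
  have hMne : (nextPair w x z.call z.cell).2.Nonempty :=
    nextPair_snd_nonempty w x z.call hz.cell_nonempty
  split_ifs with hnew hsep hx hsep' hx'
  · refine ⟨Pos.Valid.start ha ω _ (hMsub.trans hz.call_subset) hMne, fun q hq => Or.inl ?_⟩
    simp only [Pos.start, List.length_cons]
    rcases hq with (hq | hq) | hq
    · omega
    · rw [hq.1]; omega
    · rw [hq.2.1]; omega
  · refine ⟨Pos.Valid.start ha ω _ (hMsub.trans hz.call_subset) hMne, fun q hq => Or.inl ?_⟩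
    simp only [Pos.start, List.length_cons]
    rcases hq with (hq | hq) | hq
    · omega
    · rw [hq.1]; omega
    · rw [hq.2.1]; omega
  · refine ⟨Pos.Valid.start ha ω _ (hMsub.trans hz.call_subset) hMne, fun q hq => Or.inl ?_⟩
    have hhalt := hnew.resolve_left fun h => hsep h.1
    -- If the call stops right after a discarded cut, the cell needs a longer address from an
    -- earlier cut. There was one, because the oracle may stop only after the main part has lost
    -- centers.
    have hlt : z.addr.length < z.cellAddr.length := by
      rcases hz.addr_eq_or_lt with h | h
      · exfalso
        have h3 := hor.1 hhalt
        have hmain : cutMain w z.cell = z.cell := by rw [cutMain, if_neg hsep]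
        rw [hmain, h.1] at h3
        have h4 : (2 : ℝ) ≤ z.call.card := by exact_mod_cast h2
        nlinarith
      · exact h
    simp only [Pos.start]
    rcases hq with (hq | hq) | hq
    · omega
    · rw [hq.1]; omega
    · rw [hq.2.1]; omega
  all_goals
    rw [not_or] at hnew
    have hmain := nextPair_snd_eq_cutMain (Cu := z.call) hnew.1
    refine ⟨⟨hz.call_subset, hMsub, hMne, ?_, ?_, ?_⟩, fun q hq => ?_⟩
    · simp only
      rw [hmain, hz.cutMain_eq]
    · simp only
      rw [hmain]
      exact not_le.1 fun h => hnew.2 (hor.2 h)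
    · simp only
      first
        | (right; simp only [List.length_cons]; omega)
        | (rw [hmain, cutMain, if_neg hsep']; exact hz.addr_eq_or_lt)
    · rcases hq with (hq | hq) | hq
      · exact Or.inl hq
      · exact Or.inr ⟨hq.1, by simp only; omega⟩
      · exact Or.inr ⟨hq.2.1, by simp only; omega⟩

theorem chain_valid (ha : 1 / 4 ≤ a) (hγ : γ < 1) (hS : IsStoppingOracle p a γ C anchor halt)
    (hC : C.Nonempty) (x : Point d) (n : ℕ) (ω : Seeds d) :
    (chain p anchor halt C x n ω).Valid p a anchor C ω := by
  induction n with
  | zero => exact Pos.Valid.start ha ω [] (Finset.Subset.refl C) hC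
  | succ n ih => exact (ih.step ha hγ hS x).1

theorem Pos.step_congr (x : Point d) (z : Pos d) {ω ω' : Seeds d}
    (h : z.call.card ≠ 1 → ∀ q : List Bool × ℕ, q.1 = z.addr → q.2 ≤ z.time → ω q = ω' q) :
    z.step p anchor halt x ω = z.step p anchor halt x ω' := by
  unfold Pos.step
  by_cases h1 : z.call.card = 1
  · simp only [Pos.stepWith, h1, if_true]
  · have hidx : ω z.index = ω' z.index := h h1 z.index rfl le_rfl
    have hcut : (fun j : Fin (z.time + 1) =>
        cutAt p (anchor z.call) z.call (fun t => ω (z.addr, t)) j) =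
        fun j : Fin (z.time + 1) =>
          cutAt p (anchor z.call) z.call (fun t => ω' (z.addr, t)) j := by
      funext j
      exact cutAt_congr p _ _ fun t ht => h h1 (z.addr, t) rfl (by have := j.2; simp only; omega)
    rw [hidx, hcut]

/-- A position depends only on seeds at indices before it. In particular it is unaffected by the
seed that is read next. -/
theorem chain_congr (ha : 1 / 4 ≤ a) (hγ : γ < 1) (hS : IsStoppingOracle p a γ C anchor halt)
    (hC : C.Nonempty) (x : Point d) (n : ℕ) {ω ω' : Seeds d}
    (h : ∀ q, (chain p anchor halt C x n ω).Before q → ω q = ω' q) :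
    chain p anchor halt C x n ω' = chain p anchor halt C x n ω := by
  induction n with
  | zero => rfl
  | succ n ih =>
    have hstep := ((chain_valid ha hγ hS hC x n ω).step ha hγ hS x).2
    rw [chain, ih fun q hq => h q (hstep q (Or.inl hq)), chain]
    exact (Pos.step_congr x _ fun h1 q hq1 hq2 => h q (hstep q (Or.inr ⟨h1, hq1, hq2⟩))).symm

theorem countablyValued_step (hS : IsStoppingOracle p a γ C anchor halt) (x : Point d)
    {z : Pos d} (hz : z.call ⊆ C) (h2 : 2 ≤ z.call.card) :
    CountablyValued fun ω => z.step p anchor halt x ω := by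
  classical
  have hw : Measurable fun ω : Seeds d => z.cut p anchor (ω z.index) :=
    (measurable_sampleCut p _ _).comp (measurable_pi_apply z.index)
  have hsm : Measurable fun (ω : Seeds d) (t : ℕ) => ω (z.addr, t) :=
    measurable_pi_lambda _ fun t => measurable_pi_apply _
  have hhm : Measurable fun ω : Seeds d => fun j : Fin (z.time + 1) =>
      cutAt p (anchor z.call) z.call (fun t => ω (z.addr, t)) j :=
    measurable_pi_lambda _ fun j => (measurable_cutAt p _ _ j).comp hsm
  have hhalt := CountablyValued.of_measurableSet
    (hhm (hS z.call hz h2 (z.time + 1) (by omega)).1)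
  have hcv := ((((CountablyValued.of_measurableSet (measurableSet_separates z.cell)).prodMk
    (CountablyValued.of_measurableSet (measurableSet_keeps x))).prodMk
    ((CountablyValued.of_measurableSet (measurableSet_lt_cut x)).prodMk
    (countablyValued_nextPair x z.call z.cell))).comp_measurable hw).prodMk hhalt
  exact hcv.comp fun r =>
    let b := if r.1.1.1 then (if r.1.2.1 then false else true) :: z.cellAddr else z.cellAddr
    let M := r.1.2.2.2
    if z.call.card = 1 then z
    else if (r.1.1.1 ∧ ¬r.1.1.2) ∨ r.2 then Pos.start b M
    else ⟨z.addr, z.call, z.time + 1, b, M⟩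

theorem countablyValued_chain (ha : 1 / 4 ≤ a) (hγ : γ < 1)
    (hS : IsStoppingOracle p a γ C anchor halt) (hC : C.Nonempty) (x : Point d) (n : ℕ) :
    CountablyValued (chain p anchor halt C x n) := by
  induction n with
  | zero => exact CountablyValued.const _
  | succ n ih =>
    refine ih.bind_range (W := fun z ω => z.step p anchor halt x ω) ?_
    rintro _ ⟨ω, rfl⟩
    have hz := chain_valid ha hγ hS hC x n ω
    set z := chain p anchor halt C x n ω
    by_cases h1 : z.call.card = 1
    · have : (fun ω => z.step p anchor halt x ω) = fun _ => z := by
        funext ω'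
        simp only [Pos.step, Pos.stepWith, h1, if_true]
      rw [this]
      exact CountablyValued.const z
    · exact countablyValued_step hS x hz.call_subset (hz.two_le h1)

/-! ### The expected value along the path -/

/-- A step differs from `nextPair` only if the oracle stops, which replaces the call by the current
cell. This can only lower the value, so the stopping rule does not enter the drift estimate. -/
theorem Pos.Valid.value_step_le (hp : 1 ≤ p) (q : ℕ) (x : Point d) {z : Pos d} {ω : Seeds d}
    (hz : z.Valid p a anchor C ω) (h1 : z.call.card ≠ 1) :
    value p q x (z.step p anchor halt x ω).call (z.step p anchor halt x ω).cell ≤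
      value p q x (nextPair (z.cut p anchor (ω z.index)) x z.call z.cell).1
        (nextPair (z.cut p anchor (ω z.index)) x z.call z.cell).2 := by
  set w := z.cut p anchor (ω z.index) with hw
  have hne := nextPair_snd_nonempty w x z.call hz.cell_nonempty
  unfold Pos.step Pos.stepWith
  rw [← hw]
  simp only
  rw [if_neg h1]
  by_cases hnew : (w.Separates z.cell ∧ ¬w.Keeps x) ∨ halt z.call (z.time + 1) fun j =>
      cutAt p (anchor z.call) z.call (fun t => ω (z.addr, t)) j
  · rw [if_pos hnew]
    exact value_mono_left hp q x (nextPair_subset w x hz.cell_subset) hne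
  · rw [if_neg hnew]
    have hfst : (nextPair w x z.call z.cell).1 = z.call := by
      rw [not_or] at hnew
      unfold nextPair
      split_ifs with hs hk
      · rfl
      · exact absurd ⟨hs, hk⟩ hnew.1
      · rfl
    rw [hfst]

/-- The one-step estimate applies conditionally on the position because the next seed is fresh. The
main part of a running call is balanced, since the oracle would otherwise have stopped. -/
theorem lintegral_value_chain_le [NeZero d] (hp : 1 ≤ p) (ha : 1 / 4 ≤ a) (ha' : a ≤ 1 / 2)
    (hγ : γ < 1) (hA : IsAnchorOracle a C anchor) (hS : IsStoppingOracle p a γ C anchor halt)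
    (hC : C.Nonempty) {q : ℕ} (hq : ScaleBound p q C.card) (x : Point d) (n : ℕ) :
    ∫⁻ ω, value p q x (chain p anchor halt C x n ω).call (chain p anchor halt C x n ω).cell
      ∂seedsLaw d ≤ value p q x C C := by
  classical
  induction n with
  | zero => simp [chain, Pos.start, seedsLaw]
  | succ n ih =>
    refine le_trans ?_ ih
    set Z := chain p anchor halt C x n with hZ
    set g : Pos d → Seed d → ℝ≥0∞ := fun z s =>
      if z.call.card = 1 then value p q x z.call z.cell
      else value p q x (nextPair (z.cut p anchor s) x z.call z.cell).1
        (nextPair (z.cut p anchor s) x z.call z.cell).2 with hg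
    have hgm : ∀ z, Measurable (g z) := by
      intro z
      by_cases h1 : z.call.card = 1
      · simp only [hg, h1, if_true]; exact measurable_const
      · simp only [hg, h1, if_false]
        exact ((countablyValued_nextPair x z.call z.cell).comp_measurable
          (measurable_sampleCut p _ _)).measurable fun r => value p q x r.1 r.2
    have hfresh := lintegral_infinitePi_fresh (seedLaw d)
      (countablyValued_chain ha hγ hS hC x n) Pos.index
      (fun ω u => chain_congr ha hγ hS hC x n fun r hr => by
        rw [Function.update_of_ne hr.ne_index]) hgm
    calc _ ≤ ∫⁻ ω, g (Z ω) (ω (Z ω).index) ∂seedsLaw d := by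
          refine lintegral_mono fun ω => ?_
          have hz := chain_valid ha hγ hS hC x n ω
          rw [chain]
          by_cases h1 : (Z ω).call.card = 1
          · have : (Z ω).step p anchor halt x ω = Z ω := by
              simp only [Pos.step, Pos.stepWith, h1, if_true]
            simp only [hg, h1, if_true]
            rw [← hZ, this]
          · simp only [hg, h1, if_false]
            exact hz.value_step_le hp q x h1
      _ = ∫⁻ ω, ∫⁻ u, g (Z ω) u ∂seedLaw d ∂seedsLaw d := hfresh
      _ ≤ _ := by
          refine lintegral_mono fun ω => ?_
          have hz := chain_valid ha hγ hS hC x n ω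
          by_cases h1 : (Z ω).call.card = 1
          · simp only [hg, h1, if_true]
            simp
          · simp only [hg, h1, if_false]
            exact lintegral_value_nextPair_le hp hq (hA.balanced ha ha' hz.call_subset
              (hz.two_le h1) hz.cell_subset hz.card_lt) (Finset.card_le_card hz.call_subset) x

/-! ### The path of a point leads to the center that the output assigns to it -/

open Classical in
/-- The cost of the point `x` at a final position, and `0` at all other positions. -/
noncomputable def Pos.finalCost (p : ℝ) (x : Point d) (z : Pos d) : ℝ :=
  if h : z.call.card = 1 then lpDist p x (Finset.card_eq_one.mp h).choose else 0

theorem Pos.Valid.finalCost_le_value (hp : 1 ≤ p) (q : ℕ) (x : Point d) {z : Pos d}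
    {ω : Seeds d} (hz : z.Valid p a anchor C ω) :
    ENNReal.ofReal (z.finalCost p x) ≤ value p q x z.call z.cell := by
  unfold Pos.finalCost
  split_ifs with h
  · have hspec := (Finset.card_eq_one.1 h).choose_spec
    set c := (Finset.card_eq_one.1 h).choose
    have hcell : z.cell = {c} := by
      have h1 := hz.cell_subset
      rw [hspec] at h1
      exact (Finset.subset_singleton_iff.1 h1).resolve_left hz.cell_nonempty.ne_empty
    have h0 := lpDist_nonneg (p := p) x c
    rw [value, hcell]
    simp only [Finset.mem_singleton, iSup_iSup_eq_left, iInf_iInf_eq_left]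
    refine le_inf le_rfl (le_trans (ENNReal.ofReal_le_ofReal ?_) le_self_add)
    nlinarith
  · simp

theorem chain_eq_of_final {x : Point d} {N : ℕ} {ω : Seeds d}
    (h : (chain p anchor halt C x N ω).call.card = 1) {k : ℕ} (hk : N ≤ k) :
    chain p anchor halt C x k ω = chain p anchor halt C x N ω := by
  induction k, hk using Nat.le_induction with
  | base => rfl
  | succ k _ ih =>
    rw [chain, ih]
    simp only [Pos.step, Pos.stepWith, h, if_true]

/-- The path of `x` finally stays at the center of cost `v`. -/
def Settles (p : ℝ) (anchor : AnchorOracle d) (halt : StoppingOracle d) (C : Finset (Point d))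
    (x : Point d) (ω : Seeds d) (v : ℝ) : Prop :=
  ∃ N, ∀ k, N ≤ k → (chain p anchor halt C x k ω).finalCost p x = v

/-- Induction on the number of iterations left: `x` either stays in the main part or enters a leaf,
where `hf` takes over. For `n = 0` the call has just stopped and the path is already at the start of
the next call, hence the two forms of `hN`. -/
theorem settles_of_expand_grow {x : Point d} {ω : Seeds d}
    {f : List Bool → Finset (Point d) → Option (Tree d (Point d))}
    (hf : ∀ addr S T N, f addr S = some T → chain p anchor halt C x N ω = Pos.start addr S →
      Settles p anchor halt C x ω (lpDist p x (T.eval x)))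
    {addr : List Bool} {Cu : Finset (Point d)} (h1 : Cu.card ≠ 1) {τ : ℕ}
    (hτ : ∀ t, 1 ≤ t → t ≤ τ → ((halt Cu t fun j =>
      cutAt p (anchor Cu) Cu (fun t => ω (addr, t)) j) ↔ t = τ))
    (n t : ℕ) (htn : t + n = τ) (b : List Bool) {M : Finset (Point d)}
    (hM : M = mainPart p (anchor Cu) Cu (fun t => ω (addr, t)) t) {T : Tree d (Point d)}
    (hT : (grow p (anchor Cu) (fun t => ω (addr, t)) n t M).expand f b = some T) {N : ℕ}
    (hN : chain p anchor halt C x N ω =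
      if n = 0 then Pos.start b M else ⟨addr, Cu, t, b, M⟩) :
    Settles p anchor halt C x ω (lpDist p x (T.eval x)) := by
  classical
  induction n generalizing t b M T N with
  | zero => exact hf b M T N hT hN
  | succ n ih =>
    rw [if_neg (Nat.succ_ne_zero n)] at hN
    set w := sampleCut p (anchor Cu) M (ω (addr, t)) with hw
    have hhalt := hτ (t + 1) (by omega) (by omega)
    have hn0 : t + 1 = τ ↔ n = 0 := by omega
    rw [hn0] at hhalt
    set bx := (if w.Separates M then (if x w.1 < w.2.2 then false else true) :: b else b)
      with hbx
    have hnext : chain p anchor halt C x (N + 1) ω =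
        if (w.Separates M ∧ ¬w.Keeps x) ∨ n = 0 then Pos.start bx (nextPair w x Cu M).2
        else ⟨addr, Cu, t + 1, bx, (nextPair w x Cu M).2⟩ := by
      rw [chain, hN]
      have hcut : Pos.cut p anchor ⟨addr, Cu, t, b, M⟩
          (ω (Pos.index ⟨addr, Cu, t, b, M⟩)) = w := rfl
      rw [Pos.step, hcut, propext hhalt, hbx]
      unfold Pos.stepWith
      simp only
      rw [if_neg h1]
    have hmain : mainPart p (anchor Cu) Cu (fun t => ω (addr, t)) (t + 1) = cutMain w M := by
      rw [mainPart_succ, ← hM]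
    rw [grow] at hT
    simp only [← hw] at hT
    by_cases hsep : w.Separates M
    · have hbx' : bx = (if x w.1 < w.2.2 then false else true) :: b := by rw [hbx, if_pos hsep]
      have hside : (nextPair w x Cu M).2 = w.side x M := by
        unfold nextPair; rw [if_pos hsep]; split_ifs <;> rfl
      rw [if_pos hsep] at hT
      rw [hside, hbx'] at hnext
      have hsub : ∀ {l r : Tree d (Point d)}, T = Tree.node w.1 w.2.2 l r →
          T.eval x = if x w.1 < w.2.2 then l.eval x else r.eval x := by
        rintro l r rfl; rfl
      by_cases hσ : w.2.1
      · rw [if_pos hσ] at hT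
        simp only [Tree.expand, Option.bind_eq_some_iff, Option.map_eq_some_iff] at hT
        obtain ⟨l, hl, r, hr, hlr⟩ := hT
        rw [hsub hlr.symm]
        have hkeeps : w.Keeps x ↔ x w.1 < w.2.2 := by simp only [Cut.Keeps, hσ, if_true]
        rw [cutMain, if_pos hsep, if_pos hσ] at hmain
        by_cases hx : x w.1 < w.2.2
        · rw [if_pos hx]
          refine ih (t + 1) (by omega) (false :: b) hmain.symm hl (N := N + 1) ?_
          simpa [hkeeps, hx, Cut.side_eq_left hx] using hnext
        · rw [if_neg hx]
          refine hf (true :: b) _ r (N + 1) hr ?_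
          simpa [hkeeps, hx, hsep, Cut.side_eq_right hx] using hnext
      · rw [if_neg hσ] at hT
        simp only [Tree.expand, Option.bind_eq_some_iff, Option.map_eq_some_iff] at hT
        obtain ⟨l, hl, r, hr, hlr⟩ := hT
        rw [hsub hlr.symm]
        have hkeeps : w.Keeps x ↔ ¬x w.1 < w.2.2 := by
          simp only [Cut.Keeps, hσ, if_false, not_lt, Bool.false_eq_true]
        rw [cutMain, if_pos hsep, if_neg hσ] at hmain
        by_cases hx : x w.1 < w.2.2
        · rw [if_pos hx]
          refine hf (false :: b) _ l (N + 1) hl ?_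
          simpa [hkeeps, hx, hsep, Cut.side_eq_left hx] using hnext
        · rw [if_neg hx]
          refine ih (t + 1) (by omega) (true :: b) hmain.symm hr (N := N + 1) ?_
          simpa [hkeeps, hx, Cut.side_eq_right hx] using hnext
    · rw [if_neg hsep] at hT
      have hM' : (nextPair w x Cu M).2 = M := by unfold nextPair; rw [if_neg hsep]
      have hbx' : bx = b := by rw [hbx, if_neg hsep]
      rw [cutMain, if_neg hsep] at hmain
      refine ih (t + 1) (by omega) b hmain.symm hT (N := N + 1) ?_
      simpa [hM', hbx', hsep] using hnext

theorem settles_of_partitionLeaf {x : Point d} {ω : Seeds d} (n : ℕ) (addr : List Bool)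
    {Cu : Finset (Point d)} {T : Tree d (Point d)}
    (hT : partitionLeaf p anchor halt ω n addr Cu = some T) {N : ℕ}
    (hN : chain p anchor halt C x N ω = Pos.start addr Cu) :
    Settles p anchor halt C x ω (lpDist p x (T.eval x)) := by
  induction n generalizing addr Cu T N with
  | zero => simp [partitionLeaf] at hT
  | succ n ih =>
    rw [partitionLeaf] at hT
    by_cases h1 : Cu.card = 1
    · rw [dif_pos h1, Option.some_inj] at hT
      subst hT
      refine ⟨N, fun k hk => ?_⟩
      have hfin : (chain p anchor halt C x N ω).call.card = 1 := by rw [hN]; exact h1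
      rw [chain_eq_of_final hfin hk, hN, Pos.finalCost]
      exact dif_pos h1
    · rw [dif_neg h1] at hT
      simp only at hT
      split_ifs at hT with hst
      have hmem := Nat.sInf_mem hst
      set τ := sInf (stopTimes p anchor halt Cu fun t => ω (addr, t)) with hτ
      refine settles_of_expand_grow (fun addr S T N hT hN => ih addr hT hN) h1 (τ := τ) ?_ τ 0
        (zero_add τ) addr rfl hT (N := N) ?_
      · intro t ht1 htτ
        constructor
        · intro hh
          exact le_antisymm htτ (Nat.sInf_le ⟨ht1, hh⟩)
        · rintro rfl
          exact hmem.2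
      · rw [hN, if_neg (by have := hmem.1; omega)]
        rfl

end Chain

/-! ### From the path of a point to the expected cost of the output -/

open Filter Topology

section Output

variable {d : ℕ} {p a γ : ℝ} {anchor : AnchorOracle d} {halt : StoppingOracle d}
  {C : Finset (Point d)}

theorem Tree.eval_mem_leaves {α : Type} (x : Point d) (T : Tree d α) :
    T.eval x ∈ T.leaves := by
  induction T with
  | leaf b => simp [Tree.eval, Tree.leaves]
  | node i ϑ l r hl hr =>
    rw [Tree.eval, Tree.leaves, List.mem_append]
    split_ifs
    · exact Or.inl hl
    · exact Or.inr hr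

theorem Tree.Represents.length_leaves {T : Tree d (Point d)} {M : Finset (Point d)}
    (hT : T.Represents M) : T.leaves.length = M.card := by
  classical
  rw [← List.toFinset_card_of_nodup hT.nodup]
  congr 1
  ext c
  rw [List.mem_toFinset, hT.mem_leaves]

theorem ae_algorithm_represents [NeZero d] (hp : 1 ≤ p) (ha : 1 / 4 ≤ a) (ha' : a ≤ 1 / 2)
    (hγ : γ < 1) (hA : IsAnchorOracle a C anchor) (hS : IsStoppingOracle p a γ C anchor halt)
    (hC : C.Nonempty) :
    ∀ᵐ ω ∂seedsLaw d, ∃ T, algorithm p anchor halt C ω = some T ∧ T.Represents C := by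
  filter_upwards [ae_stopTimes_nonempty hp ha ha' hA hS] with ω hω
  exact partitionLeaf_represents hγ hS hω C.card [] (Finset.Subset.refl C) hC le_rfl

/-- The cost of the single point `x` in the output. -/
noncomputable def pointCost (p : ℝ) (anchor : AnchorOracle d) (halt : StoppingOracle d)
    (C : Finset (Point d)) (x : Point d) (ω : Seeds d) : ℝ :=
  (algorithm p anchor halt C ω).elim 0 fun T => lpDist p x (T.eval x)

theorem pointCost_nonneg (x : Point d) (ω : Seeds d) :
    0 ≤ pointCost p anchor halt C x ω := by
  unfold pointCost
  cases algorithm p anchor halt C ω with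
  | none => exact le_rfl
  | some T => exact lpDist_nonneg _ _

theorem outputCost_eq_sum (X : Finset (Point d)) (ω : Seeds d) :
    outputCost p anchor halt X C ω = ∑ x ∈ X, pointCost p anchor halt C x ω := by
  unfold outputCost pointCost
  cases algorithm p anchor halt C ω with
  | none => simp
  | some T => rfl

/-- The limit supplies the measurability of the cost, which is not evident from the recursion, and
is the input for Fatou's lemma. -/
theorem ae_tendsto_finalCost [NeZero d] (hp : 1 ≤ p) (ha : 1 / 4 ≤ a) (ha' : a ≤ 1 / 2)
    (hγ : γ < 1) (hA : IsAnchorOracle a C anchor) (hS : IsStoppingOracle p a γ C anchor halt)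
    (hC : C.Nonempty) (x : Point d) :
    ∀ᵐ ω ∂seedsLaw d, Tendsto (fun n => (chain p anchor halt C x n ω).finalCost p x) atTop
      (𝓝 (pointCost p anchor halt C x ω)) := by
  filter_upwards [ae_algorithm_represents hp ha ha' hγ hA hS hC] with ω ⟨T, hT, _⟩
  obtain ⟨N, hN⟩ := settles_of_partitionLeaf (C := C) (x := x) C.card [] hT (N := 0) rfl
  have : pointCost p anchor halt C x ω = lpDist p x (T.eval x) := by rw [pointCost, hT]; rfl
  rw [this]
  exact tendsto_const_nhds.congr' (eventually_atTop.2 ⟨N, fun k hk => (hN k hk).symm⟩)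

theorem measurable_finalCost_chain (ha : 1 / 4 ≤ a) (hγ : γ < 1)
    (hS : IsStoppingOracle p a γ C anchor halt) (hC : C.Nonempty) (x : Point d) (n : ℕ) :
    Measurable fun ω => (chain p anchor halt C x n ω).finalCost p x :=
  (countablyValued_chain ha hγ hS hC x n).measurable fun z => z.finalCost p x

theorem integrable_pointCost [NeZero d] (hp : 1 ≤ p) (ha : 1 / 4 ≤ a) (ha' : a ≤ 1 / 2)
    (hγ : γ < 1) (hA : IsAnchorOracle a C anchor) (hS : IsStoppingOracle p a γ C anchor halt)
    (hC : C.Nonempty) (x : Point d) :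
    Integrable (pointCost p anchor halt C x) (seedsLaw d) := by
  have : IsProbabilityMeasure (seedsLaw d) := by unfold seedsLaw; infer_instance
  refine Integrable.of_bound (aemeasurable_of_tendsto_metrizable_ae' (fun n =>
    (measurable_finalCost_chain ha hγ hS hC x n).aemeasurable)
    (ae_tendsto_finalCost hp ha ha' hγ hA hS hC x)).aestronglyMeasurable
    (∑ c ∈ C, lpDist p x c) ?_
  filter_upwards [ae_algorithm_represents hp ha ha' hγ hA hS hC] with ω ⟨T, hT, hrep⟩
  rw [Real.norm_of_nonneg (pointCost_nonneg x ω), pointCost, hT]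
  exact Finset.single_le_sum (f := fun c => lpDist p x c) (fun c _ => lpDist_nonneg x c)
    ((hrep.mem_leaves _).1 (Tree.eval_mem_leaves x T))

theorem integral_pointCost_le [NeZero d] (hp : 1 ≤ p) (ha : 1 / 4 ≤ a) (ha' : a ≤ 1 / 2)
    (hγ : γ < 1) (hA : IsAnchorOracle a C anchor) (hS : IsStoppingOracle p a γ C anchor halt)
    {q : ℕ} (hq : ScaleBound p q C.card) (x : Point d) {c : Point d} (hc : c ∈ C) :
    ∫ ω, pointCost p anchor halt C x ω ∂seedsLaw d ≤ 2 ^ q * lpDist p x c := by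
  have hC : C.Nonempty := ⟨c, hc⟩
  have hD := lpDist_nonneg (p := p) x c
  have hint := integrable_pointCost hp ha ha' hγ hA hS hC x
  rw [integral_eq_lintegral_of_nonneg_ae (ae_of_all _ (pointCost_nonneg x))
    hint.aestronglyMeasurable]
  refine ENNReal.toReal_le_of_le_ofReal (by positivity) ?_
  calc _ = ∫⁻ ω, liminf (fun n => ENNReal.ofReal
          ((chain p anchor halt C x n ω).finalCost p x)) atTop ∂seedsLaw d := by
        refine lintegral_congr_ae ?_
        filter_upwards [ae_tendsto_finalCost hp ha ha' hγ hA hS hC x] with ω hω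
        exact (ENNReal.tendsto_ofReal hω).liminf_eq.symm
    _ ≤ liminf (fun n => ∫⁻ ω, ENNReal.ofReal
          ((chain p anchor halt C x n ω).finalCost p x) ∂seedsLaw d) atTop :=
        lintegral_liminf_le fun n => (measurable_finalCost_chain ha hγ hS hC x n).ennreal_ofReal
    _ ≤ value p q x C C := by
        refine liminf_le_of_le (by isBoundedDefault) fun b hb => ?_
        obtain ⟨n, hn⟩ := hb.exists
        exact hn.trans ((lintegral_mono fun ω =>
          (chain_valid ha hγ hS hC x n ω).finalCost_le_value hp q x).trans
          (lintegral_value_chain_le hp ha ha' hγ hA hS hC hq x n))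
    _ ≤ _ := (value_le_valueAt q x hc).trans
        (valueAt_le hp hq x c (Finset.Subset.refl C) hC le_rfl)

theorem integral_outputCost_le [NeZero d] (hp : 1 ≤ p) (ha : 1 / 4 ≤ a) (ha' : a ≤ 1 / 2)
    (hγ : γ < 1) (hA : IsAnchorOracle a C anchor) (hS : IsStoppingOracle p a γ C anchor halt)
    (hC : C.Nonempty) {q : ℕ} (hq : ScaleBound p q C.card) (X : Finset (Point d)) :
    ∫ ω, outputCost p anchor halt X C ω ∂seedsLaw d ≤ 2 ^ q * cost p X C := by
  have : Nonempty {c // c ∈ C} := hC.to_subtype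
  simp only [outputCost_eq_sum]
  rw [integral_finsetSum _ fun x _ => integrable_pointCost hp ha ha' hγ hA hS hC x, cost,
    Finset.mul_sum]
  refine Finset.sum_le_sum fun x _ => ?_
  rw [← div_le_iff₀' (by positivity)]
  refine le_ciInf fun c => ?_
  rw [div_le_iff₀' (by positivity)]
  exact integral_pointCost_le hp ha ha' hγ hA hS hq x c.2

theorem cost_nonneg (X C : Finset (Point d)) : 0 ≤ cost p X C :=
  Finset.sum_nonneg fun x _ => Real.iInf_nonneg fun _ => lpDist_nonneg x _

/-- From log(3/e) ≥ 1 - e/3. The margin above 1 keeps log log k away from 0 for all k ≥ 3. -/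
theorem log_three_gt : 1.09 < Real.log 3 := by
  have h := Real.one_sub_inv_le_log_of_pos (show (0 : ℝ) < 3 / Real.exp 1 by positivity)
  rw [Real.log_div (by norm_num) (Real.exp_pos 1).ne', Real.log_exp, inv_div] at h
  have := Real.exp_one_lt_d9
  linarith

/-- Choose 2^q between 2^20 and 2^21 times p log k log log k. Then q = O(p + log log k), and since
log log k is bounded below, q log k is again O(p log k log log k); the constant 2^20 absorbs all
others. -/
theorem exists_scaleBound (hp : 1 ≤ p) {k : ℕ} (hk : 3 ≤ k) :
    ∃ q, ScaleBound p q k ∧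
      (2 : ℝ) ^ q ≤ 2 ^ 21 * (p * Real.log k * Real.log (Real.log k)) := by
  have hk' : (3 : ℝ) ≤ k := by exact_mod_cast hk
  set L := Real.log k with hLdef
  have hL : 1.09 < L := log_three_gt.trans_le (Real.log_le_log (by norm_num) hk')
  set l := Real.log L with hldef
  have hl : 0.08 ≤ l := by
    have h1 := Real.one_sub_inv_le_log_of_pos (show (0 : ℝ) < L by linarith)
    have h2 : L⁻¹ ≤ 0.92 := by
      rw [inv_le_comm₀ (by linarith) (by norm_num)]
      exact le_trans (by norm_num) hL.le
    linarith
  have hlog : Real.log (1 + k) ≤ 2 * L := by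
    rw [hLdef, ← Real.log_rpow (by linarith)]
    refine Real.log_le_log (by linarith) ?_
    rw [Real.rpow_two]
    nlinarith
  have hpL : 1 ≤ p * L := by nlinarith
  have hpl : p * 0.08 ≤ p * l := by gcongr
  have hA : 1 ≤ 2 ^ 20 * (p * L * l) := by nlinarith
  obtain ⟨n, hn, hn'⟩ := exists_nat_pow_near hA (one_lt_two)
  refine ⟨n + 1, ?_, by rw [pow_succ]; linarith⟩
  refine le_trans ?_ hn'.le
  have hn2 : ((n : ℝ) - 20) * Real.log 2 ≤ p + 2 * l := by
    have h1 := Real.log_le_log (by positivity) hn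
    rw [Real.log_mul (by positivity) (by positivity), Real.log_mul (by positivity) (by positivity),
      Real.log_mul (by positivity) (by positivity), Real.log_pow, Real.log_pow] at h1
    have h2 := Real.log_le_sub_one_of_pos (show 0 < p by linarith)
    have h3 := Real.log_le_sub_one_of_pos (show 0 < l by linarith)
    push_cast at h1
    linarith
  have hn3 : (n : ℝ) ≤ 20 + 2 * (p + 2 * l) := by
    by_contra! h
    have := Real.log_two_gt_d9
    nlinarith
  push_cast
  have h4 : ((n : ℝ) + 1 + 2) * Real.log (1 + k) ≤ (23 + 2 * (p + 2 * l)) * (2 * L) := by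
    have := Real.log_nonneg (show (1 : ℝ) ≤ 1 + k by linarith)
    exact mul_le_mul (by linarith) hlog this (by linarith)
  -- This is the scale condition divided by log k. The bound l ≥ 0.08 lets p * l dominate the terms
  -- p and 1.
  have h5 : 65 * p + 3072 * p + 768 * ((23 + 2 * (p + 2 * l)) * 2) ≤ 2 ^ 20 * (p * l) := by
    nlinarith
  have h6 := mul_le_mul_of_nonneg_right h5 (show 0 ≤ L by linarith)
  nlinarith

/-- The exponent is at least 1 because p ≥ 1, and log k ≥ 1. -/
theorem mul_log_le_rpow (hp : 1 ≤ p) {k : ℕ} (hk : 3 ≤ k) :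
    p * Real.log k * Real.log (Real.log k) ≤
      p * Real.log k ^ (1 + 1 / p - 1 / p ^ 2) * Real.log (Real.log k) := by
  have hk' : (3 : ℝ) ≤ k := by exact_mod_cast hk
  have hL : 1 ≤ Real.log k := by
    linarith [log_three_gt, Real.log_le_log (by norm_num) hk']
  have hl := Real.log_nonneg hL
  have hp2 : 1 / p ^ 2 ≤ 1 / p := by
    gcongr
    nlinarith
  gcongr
  exact Real.self_le_rpow_of_one_le hL (by linarith)

end Output

end Explainable

open Explainable in
theorem mainTheorem1 (γ : ℝ) (hγ : γ < 1) :
    ∃ K : ℝ, 0 < K ∧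
      ∀ (d : ℕ) [NeZero d] (p : ℝ), 1 ≤ p →
      ∀ C : Finset (Point d), C.Nonempty →
      ∀ a : ℝ, 1 / 4 ≤ a → a ≤ 1 / 2 →
      ∀ (anchor : AnchorOracle d) (halt : StoppingOracle d),
        IsAnchorOracle a C anchor → IsStoppingOracle p a γ C anchor halt →
        (∀ᵐ ω ∂seedsLaw d, ∃ T : Tree d (Point d),
          algorithm p anchor halt C ω = some T ∧
          T.leaves.length = C.card ∧ T.leaves.Nodup ∧ (∀ c, c ∈ T.leaves ↔ c ∈ C) ∧
          ∀ c ∈ C, T.eval c = c) ∧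
        ∀ X : Finset (Point d),
          Integrable (outputCost p anchor halt X C) (seedsLaw d) ∧
          (3 ≤ C.card →
            ∫ ω, outputCost p anchor halt X C ω ∂seedsLaw d ≤
              K * (p * Real.log C.card ^ (1 + 1 / p - 1 / p ^ 2) * Real.log (Real.log C.card)) *
                cost p X C ∧
            (cost p X C = optCost p C.card X →
              ∫ ω, outputCost p anchor halt X C ω ∂seedsLaw d ≤
                K * (p * Real.log C.card ^ (1 + 1 / p - 1 / p ^ 2) * Real.log (Real.log C.card)) *
                  optCost p C.card X)) := by
  -- The same constant serves every γ: the condition γ < 1 ensures progress of the recursion and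
  -- does not affect the rate.
  refine ⟨2 ^ 21, by positivity, ?_⟩
  intro d _ p hp C hC a ha ha' anchor halt hA hS
  refine ⟨?_, fun X => ⟨?_, fun hk => ?_⟩⟩
  · filter_upwards [ae_algorithm_represents hp ha ha' hγ hA hS hC] with ω ⟨T, hT, hrep⟩
    exact ⟨T, hT, hrep.length_leaves, hrep.nodup, hrep.mem_leaves, hrep.eval_eq⟩
  · have : outputCost p anchor halt X C =
        fun ω => ∑ x ∈ X, pointCost p anchor halt C x ω := funext (outputCost_eq_sum X)
    rw [this]
    exact integrable_finsetSum _ fun x _ => integrable_pointCost hp ha ha' hγ hA hS hC x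
  · obtain ⟨q, hq, hq2⟩ := exists_scaleBound hp hk
    have hmain : ∫ ω, outputCost p anchor halt X C ω ∂seedsLaw d ≤
        2 ^ 21 * (p * Real.log C.card ^ (1 + 1 / p - 1 / p ^ 2) * Real.log (Real.log C.card)) *
          cost p X C :=
      (integral_outputCost_le hp ha ha' hγ hA hS hC hq X).trans
        (mul_le_mul_of_nonneg_right (hq2.trans
          (mul_le_mul_of_nonneg_left (mul_log_le_rpow hp hk) (by positivity)))
          (cost_nonneg X C))
    exact ⟨hmain, fun h => h ▸ hmain⟩
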